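/- **Setting.** Let $n\in\mathbb N$, let $D\in\mathbb R^{n\times n}$ be symmetric positive definite, $A\in\mathbb R^{n\times n}$, $B\in\mathbb R^{n\times 1}$, $C\in\mathbb R^{1\times n}$, and let $\varphi:\mathbb R\to\mathbb R$ be $C^1$. Consider on the circle $S^1=\mathbb R/2\pi\mathbb Z$ (i.e. with periodic boundary conditions for $x$ and $\partial x/\partial\theta$) the closed-loop reaction-diffusion system $$\frac{\partial x}{\partial t}=D\,\frac{\partial^2x}{\partial\theta^2}+Ax+Bu,\qquad y=Cx,\qquad u=-\varphi(y).\tag{1}$$ A solution is a continuous map $x:[0,\infty)\to L^2(S^1;\mathbb R^n)$ that is continuously differentiable on $(0,\infty)$, takes values in $H^2(S^1;\mathbb R^n)$ for $t>0$, and satisfies (1) in $L^2$ for $t>0$. System (1) is *spatially homogeneous with rate $\mu\ge 0$* if there is $M>0$ such that every solution with $\frac{\partial x}{\partial\theta}(\cdot,0)\in L^2$ satisfies $$\Big\|\frac{\partial x}{\partial\theta}(\cdot,t)\Big\|_{L^2}\le M e^{-\mu t}\Big\|\frac{\partial x}{\partial\theta}(\cdot,0)\Big\|_{L^2}\qquad(t\ge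 0).$$ For $\zeta\in\mathbb Z$ let $G_\zeta(s)=C\,(sI-(A-\zeta^2D))^{-1}B$. The Nyquist plot of $G_\zeta(s-\mu)$ is the curve $\omega\mapsto G_\zeta(i\omega-\mu)$, $\omega\in\mathbb R$ (closed up by its limit $0$ at $\omega=\pm\infty$). For nonzero real $K_1,K_2$ let $$\mathcal D(K_1,K_2)=\Big\{x+iy\in\mathbb C:\Big(x+\frac{K_1+K_2}{2K_1K_2}\Big)^2+y^2\le\Big(\frac{K_2-K_1}{2K_1K_2}\Big)^2\Big\}.$$ **Theorem.** Let $\varphi$ satisfy the differential sector condition $(\varphi'(\eta)-K_1)(\varphi'(\eta)-K_2)\le 0$ for all $\eta\in\mathbb R$, and let $\mu\ge 0$. Suppose that for each $\zeta\in\mathbb Z\setminus\{0\}$ the realization $(A-\zeta^2D,B,C)$ has no hidden modes in $\operatorname{Re}s\ge-\mu$: for no complex $s$ with $\operatorname{Re}s\ge-\mu$ is there a left eigenvector $v$ of $A-\zeta^2D$ with eigenvalue $s$ and $vB=0$, or a right eigenvector $v$ with eigenvalue $s$ and $Cv=0$ (this holds in particular if the realization is controllable and observable). Suppose further that for each $\zeta\in\mathbb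 Z\setminus\{0\}$ 1. $G_\zeta(s-\mu)$ has no poles in the closed right half-plane $\{\operatorname{Re}s\ge 0\}$; and 2. one of the following holds: - (a) $0<K_1<K_2$ and the Nyquist plot of $G_\zeta(s-\mu)$ lies outside $\mathcal D(K_1,K_2)$ and does not encircle it (it has winding number $0$ about each point of the disk); - (b) $K_1<0<K_2$ and the Nyquist plot of $G_\zeta(s-\mu)$ lies inside $\mathcal D(K_1,K_2)$; - (c) $K_1<K_2<0$ and the Nyquist plot of $G_\zeta(s-\mu)$ lies outside $\mathcal D(K_1,K_2)$ and does not encircle it. Then the closed-loop system (1) is spatially homogeneous with rate $\mu$. -/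

import Mathlib

open Real Set Filter Topology MeasureTheory
open scoped ContDiff Matrix

noncomputable section

instance fact_zero_lt_two_pi : Fact (0 < 2 * π) := ⟨Real.two_pi_pos⟩

/-- The spatial domain: the circle of circumference `2π`. -/
abbrev SpatialCircle : Type := AddCircle (2 * π)

/-- The state space `L²(S¹; ℝⁿ)` (with respect to arc length, Euclidean norm on `ℝⁿ`). -/
abbrev StateSpace (n : ℕ) : Type :=
  Lp (EuclideanSpace ℝ (Fin n)) 2 (volume : Measure SpatialCircle)

/-- `g` is the weak derivative of `f` on the circle: integration by parts holds against all smooth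
`2π`-periodic test functions.  As the test functions are periodic and need not vanish at `0`, the
periodic boundary condition on `f` is part of this condition. -/
def HasWeakDeriv {n : ℕ} (f g : StateSpace n) : Prop :=
  ∀ ψ : ℝ → ℝ, ContDiff ℝ ∞ ψ → Function.Periodic ψ (2 * π) →
    ∫ r in (0 : ℝ)..(2 * π), deriv ψ r • f (r : SpatialCircle) =
      -∫ r in (0 : ℝ)..(2 * π), ψ r • g (r : SpatialCircle)

/-- `w` is the Laplacian of `f`, where `f` lies in the domain of the Laplacian, that is, in `H²`
with the periodic boundary conditions on `f` and on its first derivative. -/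
def HasLaplacian {n : ℕ} (f w : StateSpace n) : Prop :=
  ∃ g : StateSpace n, HasWeakDeriv f g ∧ HasWeakDeriv g w

/-- Global classical solutions (of the evolution equation in `L²(S¹; ℝⁿ)`) of the closed loop
`∂x/∂t = D Δx + A x + B u`, `y = C x`, `u = -φ(y)`, with scalar input and output: `x` is continuous
on `[0, ∞)`, continuously differentiable on `(0, ∞)`, and for `t > 0` the state `x t` lies in the
domain of the Laplacian and the equation holds.  The initial state `x 0` may be any element
of `L²`. -/
structure IsSolution {n : ℕ} (D A : Matrix (Fin n) (Fin n) ℝ) (B C : Fin n → ℝ) (φ : ℝ → ℝ)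
    (x : ℝ → StateSpace n) : Prop where
  continuousOn : ContinuousOn x (Ici 0)
  contDiffOn : ContDiffOn ℝ 1 x (Ioi 0)
  equation : ∀ t : ℝ, 0 < t → ∃ w : StateSpace n, HasLaplacian (x t) w ∧
    ∀ᵐ θ : SpatialCircle, (deriv x t θ).ofLp =
      D *ᵥ (w θ).ofLp + A *ᵥ (x t θ).ofLp - φ (C ⬝ᵥ (x t θ).ofLp) • B

/-- Spatial homogeneity with rate `μ`: for every solution whose initial gradient is in `L²`,
`‖∂x/∂θ(·, t)‖ ≤ M e^{-μ t} ‖∂x/∂θ(·, 0)‖`, where `M` does not depend on the solution. -/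
def SpatiallyHomogeneous {n : ℕ} (D A : Matrix (Fin n) (Fin n) ℝ) (B C : Fin n → ℝ) (φ : ℝ → ℝ)
    (μ : ℝ) : Prop :=
  ∃ M : ℝ, 0 < M ∧ ∀ x : ℝ → StateSpace n, IsSolution D A B C φ x →
    ∀ g₀ : StateSpace n, HasWeakDeriv (x 0) g₀ →
      ∀ t : ℝ, 0 ≤ t → ∃ g : StateSpace n, HasWeakDeriv (x t) g ∧
        ‖g‖ ≤ M * Real.exp (-μ * t) * ‖g₀‖

/-- The matrix `A - ζ² D` of the Fourier mode `ζ`, as a complex matrix. -/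
def modeMatrix {n : ℕ} (D A : Matrix (Fin n) (Fin n) ℝ) (ζ : ℤ) : Matrix (Fin n) (Fin n) ℂ :=
  (A - (ζ : ℝ) ^ 2 • D).map Complex.ofReal

/-- The transfer function `G_ζ(s) = C (s I - (A - ζ² D))⁻¹ B`. -/
def transferFunction {n : ℕ} (D A : Matrix (Fin n) (Fin n) ℝ) (B C : Fin n → ℝ) (ζ : ℤ) (s : ℂ) :
    ℂ :=
  (fun i => (C i : ℂ)) ⬝ᵥ ((s • (1 : Matrix (Fin n) (Fin n) ℂ) - modeMatrix D A ζ)⁻¹ *ᵥ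
    fun i => (B i : ℂ))

/-- `s` is a pole of `f`. -/
def IsPole (f : ℂ → ℂ) (s : ℂ) : Prop :=
  MeromorphicAt f s ∧ meromorphicOrderAt f s < 0

/-- The realization `(A - ζ² D, B, C)` has no hidden (uncontrollable or unobservable) modes in the
half-plane `Re s ≥ -μ`: no left eigenvector belonging to such an eigenvalue is annihilated by `B`,
and no right eigenvector belonging to such an eigenvalue is annihilated by `C`. -/
def NoHiddenModes {n : ℕ} (D A : Matrix (Fin n) (Fin n) ℝ) (B C : Fin n → ℝ) (μ : ℝ) (ζ : ℤ) :
    Prop :=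
  ∀ s : ℂ, -μ ≤ s.re → ∀ v : Fin n → ℂ, v ≠ 0 →
    (v ᵥ* modeMatrix D A ζ = s • v → v ⬝ᵥ (fun i => (B i : ℂ)) ≠ 0) ∧
    (modeMatrix D A ζ *ᵥ v = s • v → (fun i => (C i : ℂ)) ⬝ᵥ v ≠ 0)

/-- The Nyquist curve `τ ↦ G(iτ)` of a transfer function `G`. -/
def nyquistCurve (G : ℂ → ℂ) (τ : ℝ) : ℂ := G (Complex.I * τ)

/-- The Nyquist plot, as a set. -/
def nyquistPlot (G : ℂ → ℂ) : Set ℂ := range (nyquistCurve G)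

/-- The closed disk `𝒟(K₁, K₂)`, whose diameter is the segment from `-1/K₁` to `-1/K₂`. -/
def criterionDisk (K₁ K₂ : ℝ) : Set ℂ :=
  {z | (z.re + (K₁ + K₂) / (2 * K₁ * K₂)) ^ 2 + z.im ^ 2 ≤ ((K₂ - K₁) / (2 * K₁ * K₂)) ^ 2}

/-- The curve `γ : ℝ → ℂ`, which closes up at infinity, makes `k` counterclockwise encirclements of
the point `c`, which it avoids: a continuous argument `α` of `γ - c` has limits at `-∞` and `+∞` and
its total increase is `2πk`. -/
def HasWindingNumber (γ : ℝ → ℂ) (c : ℂ) (k : ℤ) : Prop :=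
  ∃ α : ℝ → ℝ, Continuous α ∧
    (∀ τ, γ τ ≠ c ∧ γ τ - c = (‖γ τ - c‖ : ℂ) * Complex.exp (α τ * Complex.I)) ∧
    ∃ a b : ℝ, Tendsto α atBot (𝓝 a) ∧ Tendsto α atTop (𝓝 b) ∧ b - a = 2 * π * k

/-- The Nyquist plot of `G` lies outside the set `S` and makes no encirclement of it. -/
def OutsideWithoutEncirclement (G : ℂ → ℂ) (S : Set ℂ) : Prop :=
  Disjoint (nyquistPlot G) S ∧ ∀ c ∈ S, HasWindingNumber (nyquistCurve G) c 0

end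

/-! In place of the gradient, consider the spatial differences x(θ+h,t) − x(θ,t). Their Fourier
coefficients (e^{iζh} − 1)x̂_ζ(t), weighted by e^{μt}, are trajectories of the linear systems z' =
(A − ζ²D + μ)z + vB with output y = Cz. The mode ζ = 0 drops out, and the nonlinearity couples the
others only through their inputs. With κ₀ = (K₁+K₂)/2 and k = (K₂−K₁)/2, the mean value theorem
makes φ(η) − κ₀η Lipschitz with constant k. By Parseval, the supplies |v + κ₀y|² − k²|y|² of all
modes therefore add up to at most zero at every time (`tsum_sector_le`).

On the other hand every mode absorbs supply. For large |ζ| diffusion is so strong that ‖z‖² is a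
storage function. For each remaining ζ ≠ 0 the Nyquist condition says k|G| ≤ |1 + κ₀G| on the
imaginary axis. A response from rest on [0,T] is continued after T by a stabilizing feedback v = −κy
with |κ − κ₀| < k. By Plancherel the total supply is nonnegative; the tail contributes −(k² −
(κ₀−κ)²)∫|y|², so the supply up to T dominates that integral and hence |y(T)|²
(`le_integral_supply_of_forced`). No storage function has to be constructed, and the frequency
inequality may be non-strict.

Such a κ exists. If K₁K₂ > 0, take −1/κ to be the centre of the disk, which the plot does not
encircle, and apply `nyquist_criterion`; if K₁ < 0 < K₂, take κ = 0. The modes themselves are stable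
because, without hidden modes, an eigenvalue in the closed right half-plane would be a pole
(`not_eigenvalue_of_tendsto`).

The initial states of the finitely many low modes perturb their outputs by exponentially decaying
errors (`exists_isDissipativeUpToDecay`). Summed over all modes, this yields m² ≤ αR² + βRm for the
supremum m of the output norm and the initial norm R. So m is at most a multiple of R, and the
states follow, with constants independent of T and h (`exists_tsum_norm_sq_le`). Dividing by h and
letting h → 0 gives the gradient bound, and Riesz–Fischer provides the weak derivative
(`exists_hasWeakDeriv_of_differences`). -/

set_option linter.unusedSectionVars false

/-! ### Exponential decay of flows of Hurwitz operators. -/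

section LinearFlow

variable {E : Type*} [NormedAddCommGroup E] [NormedSpace ℂ E] [CompleteSpace E]

/-- All eigenvalues lie in the open left half-plane. -/
def IsHurwitz (𝒜 : E →L[ℂ] E) : Prop :=
  ∀ (s : ℂ) (x : E), x ≠ 0 → 𝒜 x = s • x → s.re < 0

/-- The flow `t ↦ exp (t 𝒜)`. -/
noncomputable def linFlow (𝒜 : E →L[ℂ] E) (t : ℝ) : E →L[ℂ] E := NormedSpace.exp (t • 𝒜)

theorem linFlow_zero (𝒜 : E →L[ℂ] E) : linFlow 𝒜 0 = 1 := by simp [linFlow]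

theorem hasDerivAt_linFlow (𝒜 : E →L[ℂ] E) (t : ℝ) :
    HasDerivAt (linFlow 𝒜) (𝒜 * linFlow 𝒜 t) t :=
  hasDerivAt_exp_smul_const' 𝒜 t

theorem hasDerivAt_linFlow' (𝒜 : E →L[ℂ] E) (t : ℝ) :
    HasDerivAt (linFlow 𝒜) (linFlow 𝒜 t * 𝒜) t :=
  hasDerivAt_exp_smul_const 𝒜 t

theorem continuous_linFlow (𝒜 : E →L[ℂ] E) : Continuous (linFlow 𝒜) :=
  continuous_iff_continuousAt.2 fun t => (hasDerivAt_linFlow 𝒜 t).continuousAt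

theorem hasDerivAt_linFlow_apply (𝒜 : E →L[ℂ] E) (x : E) (t : ℝ) :
    HasDerivAt (fun t => linFlow 𝒜 t x) (𝒜 (linFlow 𝒜 t x)) t := by
  have := ((ContinuousLinearMap.apply ℂ E x).restrictScalars ℝ).hasFDerivAt.comp_hasDerivAt t
    (hasDerivAt_linFlow 𝒜 t)
  simpa [Function.comp_def] using this

/-- Scalars commute with 𝒜, so the exponential splits. On a generalized eigenspace of s the
remaining factor is polynomial in t. -/
theorem linFlow_eq_exp_smul (𝒜 : E →L[ℂ] E) (s : ℂ) (t : ℝ) :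
    linFlow 𝒜 t = Complex.exp (t * s) • linFlow (𝒜 - s • 1) t := by
  have h : t • 𝒜 = t • (𝒜 - s • (1 : E →L[ℂ] E)) + algebraMap ℂ (E →L[ℂ] E) (t * s) := by
    ext x
    simp [Algebra.algebraMap_eq_smul_one, smul_sub, mul_smul]
  have hc : Commute (t • (𝒜 - s • (1 : E →L[ℂ] E))) (algebraMap ℂ (E →L[ℂ] E) (t * s)) :=
    (Algebra.commutes _ _).symm
  let _ : NormedAlgebra ℚ (E →L[ℂ] E) := NormedAlgebra.restrictScalars ℚ ℂ _
  rw [linFlow, h, NormedSpace.exp_add_of_commute hc, ← NormedSpace.algebraMap_exp_comm,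
    Algebra.algebraMap_eq_smul_one, mul_smul_comm, mul_one, linFlow, Complex.exp_eq_exp_ℂ]

theorem linFlow_apply_of_pow_eq_zero (𝒩 : E →L[ℂ] E) (k : ℕ) (x : E) (h : (𝒩 ^ k) x = 0) (t : ℝ) :
    linFlow 𝒩 t x = ∑ j ∈ Finset.range k, ((j.factorial : ℂ)⁻¹ * (t : ℂ) ^ j) • (𝒩 ^ j) x := by
  have h1 := NormedSpace.exp_series_hasSum_exp' (𝕂 := ℂ) (t • 𝒩)
  have h2 := (ContinuousLinearMap.apply ℂ E x).hasSum h1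
  have h3 : ∀ j, ((ContinuousLinearMap.apply ℂ E x) ((j.factorial : ℂ)⁻¹ • (t • 𝒩) ^ j)) =
      ((j.factorial : ℂ)⁻¹ * (t : ℂ) ^ j) • (𝒩 ^ j) x := by
    intro j
    have : t • 𝒩 = (t : ℂ) • 𝒩 := by ext; simp
    rw [this, smul_pow]
    simp [mul_smul]
  refine (h2.unique ?_)
  simp only [h3]
  apply hasSum_sum_of_ne_finset_zero
  intro j hj
  have hj : k ≤ j := by simpa using hj
  have : (𝒩 ^ j) x = 0 := by
    rw [← Nat.sub_add_cancel hj, pow_add, mul_apply_eq_comp, h, map_zero]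
  rw [this, smul_zero]

/-- Variation of constants: in the derivative of s ↦ exp((T−s)𝒜) z(s) the two terms with 𝒜 cancel,
leaving the input term. -/
theorem eq_linFlow_add_integral (𝒜 : E →L[ℂ] E) (b : E) {z : ℝ → E} {v : ℝ → ℂ}
    (hz : ContinuousOn z (Ici 0)) (hv : ContinuousOn v (Ici 0))
    (hzv : ∀ t, 0 < t → HasDerivAt z (𝒜 (z t) + v t • b) t) {T : ℝ} (hT : 0 ≤ T) :
    z T = linFlow 𝒜 T (z 0) + ∫ s in (0 : ℝ)..T, v s • linFlow 𝒜 (T - s) b := by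
  have hsub : Icc 0 T ⊆ Ici (0 : ℝ) := Icc_subset_Ici_self
  have hc : Continuous fun s => linFlow 𝒜 (T - s) := (continuous_linFlow 𝒜).comp (by fun_prop)
  have h1 : ContinuousOn (fun s => linFlow 𝒜 (T - s) (z s)) (Icc 0 T) :=
    hc.continuousOn.clm_apply (hz.mono hsub)
  have h2 : ∀ s ∈ Ioo 0 T, HasDerivAt (fun s => linFlow 𝒜 (T - s) (z s))
      (v s • linFlow 𝒜 (T - s) b) s := by
    intro s hs
    have h3 := (hasDerivAt_linFlow' 𝒜 (T - s)).scomp s ((hasDerivAt_id s).const_sub T)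
    have h4 := ((ContinuousLinearMap.id ℂ (E →L[ℂ] E)).bilinearRestrictScalars
      ℝ).hasDerivAt_of_bilinear (fun _ => h3) (fun _ => hzv s hs.1)
    convert! h4 using 1
    simp
  have h5 : ContinuousOn (fun s => v s • linFlow 𝒜 (T - s) b) (Icc 0 T) :=
    (hv.mono hsub).smul (hc.clm_apply continuous_const).continuousOn
  have h6 := intervalIntegral.integral_eq_sub_of_hasDerivAt_of_le hT h1 h2
    (h5.intervalIntegrable_of_Icc hT)
  rw [h6]
  simp [linFlow_zero]

variable [FiniteDimensional ℂ E]

/-- Generalized eigenvectors span E over ℂ, and on each of them the flow is e^{st} times a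
polynomial in t. -/
theorem isBigO_linFlow_apply {𝒜 : E →L[ℂ] E} (h𝒜 : IsHurwitz 𝒜) (x : E) :
    ∃ δ > 0, (fun t => linFlow 𝒜 t x) =O[atTop] fun t : ℝ => Real.exp (-δ * t) := by
  have hx : x ∈ ⨆ s : ℂ, Module.End.maxGenEigenspace (𝒜 : E →ₗ[ℂ] E) s := by
    rw [Module.End.iSup_maxGenEigenspace_eq_top]; trivial
  induction hx using Submodule.iSup_induction' with
  | mem s x hx =>
    rw [Module.End.mem_maxGenEigenspace] at hx
    obtain ⟨k, hk⟩ := hx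
    by_cases hs : s.re < 0
    -- Half of the decay rate is given up to absorb the polynomial factor.
    · refine ⟨-s.re / 2, by linarith, ?_⟩
      have hk' : ((𝒜 - s • 1) ^ k) x = 0 := by
        have : (((𝒜 - s • 1 : E →L[ℂ] E) : E →ₗ[ℂ] E)) = (𝒜 : E →ₗ[ℂ] E) - s • 1 := by
          ext; simp
        rw [← this, ← ContinuousLinearMap.toLinearMap_pow] at hk
        exact hk
      simp_rw [linFlow_eq_exp_smul 𝒜 s, _root_.smul_apply,
        linFlow_apply_of_pow_eq_zero _ k x hk', Finset.smul_sum, smul_smul]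
      refine Asymptotics.IsBigO.fun_sum fun j _ => ?_
      have h1 := (isLittleO_pow_exp_pos_mul_atTop (k := j) (b := -s.re / 2) (by linarith)).isBigO
      have h2 : (fun t : ℝ => Complex.exp (t * s)) =O[atTop] fun t : ℝ => Real.exp (s.re * t) := by
        refine Asymptotics.IsBigO.of_bound 1 (Eventually.of_forall fun t => ?_)
        simp [Complex.norm_exp, mul_comm]
      have h3 : (fun t : ℝ => ((j.factorial : ℂ)⁻¹ * (t : ℂ) ^ j) • ((𝒜 - s • 1) ^ j) x)
          =O[atTop] fun t : ℝ => Real.exp (-s.re / 2 * t) := by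
        refine Asymptotics.IsBigO.trans ?_ h1
        refine Asymptotics.IsBigO.of_bound (‖(j.factorial : ℂ)⁻¹‖ * ‖((𝒜 - s • 1) ^ j) x‖)
          (Eventually.of_forall fun t => le_of_eq ?_)
        rw [norm_smul, norm_mul, norm_pow, norm_pow, Complex.norm_real]
        ring
      have h4 := h2.smul h3
      refine (h4.congr_right ?_).congr_left ?_
      · intro t
        rw [smul_eq_mul, ← Real.exp_add]
        ring_nf
      · intro t
        rw [smul_smul]
    -- If Re s ≥ 0, the last nonvanishing (𝒜 − s)^j x would be an eigenvector, contradicting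
    -- `IsHurwitz`.
    · have hx0 : x = 0 := by
        have hk0 : ∀ j : ℕ, (((𝒜 : E →ₗ[ℂ] E) - s • 1) ^ j) x = 0 → x = 0 := by
          intro j
          induction j with
          | zero => simp
          | succ j ih =>
            intro hj
            apply ih
            by_contra hne
            refine hs (h𝒜 s _ hne ?_)
            rw [pow_succ', Module.End.mul_apply] at hj
            simpa [sub_eq_zero] using hj
        exact hk0 k hk
      exact ⟨1, one_pos, by simpa [hx0] using Asymptotics.isBigO_zero _ _⟩
  | zero => exact ⟨1, one_pos, by simpa using Asymptotics.isBigO_zero _ _⟩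
  | add x y _ _ hx hy =>
    obtain ⟨δ, hδ, h1⟩ := hx
    obtain ⟨ε, hε, h2⟩ := hy
    have key : ∀ a b : ℝ, a ≤ b →
        (fun t : ℝ => Real.exp (-b * t)) =O[atTop] fun t : ℝ => Real.exp (-a * t) := by
      intro a b hab
      refine Asymptotics.IsBigO.of_bound 1 ((eventually_ge_atTop 0).mono fun t ht => ?_)
      simp only [norm_eq_abs, abs_exp, one_mul, exp_le_exp]
      nlinarith
    refine ⟨min δ ε, lt_min hδ hε, ?_⟩
    simp only [map_add]
    exact (h1.trans (key _ _ (min_le_left _ _))).add (h2.trans (key _ _ (min_le_right _ _)))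

theorem exists_norm_linFlow_apply_le {𝒜 : E →L[ℂ] E} (h𝒜 : IsHurwitz 𝒜) (x : E) :
    ∃ C > 0, ∃ δ > 0, ∀ t : ℝ, 0 ≤ t → ‖linFlow 𝒜 t x‖ ≤ C * Real.exp (-δ * t) := by
  obtain ⟨δ, hδ, h⟩ := isBigO_linFlow_apply h𝒜 x
  obtain ⟨C, hC, h⟩ := h.exists_pos
  obtain ⟨T, hT⟩ := eventually_atTop.1 h.bound
  have hcont : Continuous fun t => ‖linFlow 𝒜 t x‖ :=
    ((continuous_linFlow 𝒜).clm_apply continuous_const).norm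
  obtain ⟨m, hm⟩ := (isCompact_Icc (a := 0) (b := T)).bddAbove_image hcont.continuousOn
  refine ⟨C + |m| * Real.exp (δ * |T|), by positivity, δ, hδ, fun t ht => ?_⟩
  rcases le_total T t with h1 | h1
  · refine (hT t h1).trans ?_
    simp only [norm_eq_abs, abs_exp]
    have : 0 ≤ |m| * Real.exp (δ * |T|) := by positivity
    gcongr
    linarith
  · have h2 : ‖linFlow 𝒜 t x‖ ≤ |m| := (hm ⟨t, ⟨ht, h1⟩, rfl⟩).trans (le_abs_self m)
    have h3 : 1 ≤ Real.exp (δ * |T|) * Real.exp (-δ * t) := by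
      rw [← Real.exp_add]
      refine Real.one_le_exp ?_
      have := le_abs_self T
      nlinarith
    calc ‖linFlow 𝒜 t x‖ ≤ |m| * 1 := by linarith
      _ ≤ |m| * (Real.exp (δ * |T|) * Real.exp (-δ * t)) := by gcongr
      _ ≤ C * Real.exp (-δ * t) + |m| * (Real.exp (δ * |T|) * Real.exp (-δ * t)) := by
        have : 0 ≤ C * Real.exp (-δ * t) := by positivity
        linarith
      _ = _ := by ring

/-- The flow of a Hurwitz operator decays exponentially. -/
theorem exists_norm_linFlow_le {𝒜 : E →L[ℂ] E} (h𝒜 : IsHurwitz 𝒜) :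
    ∃ C > 0, ∃ δ > 0, ∀ t : ℝ, 0 ≤ t → ‖linFlow 𝒜 t‖ ≤ C * Real.exp (-δ * t) := by
  choose C hC δ hδ h using exists_norm_linFlow_apply_le h𝒜
  let e := Module.finBasis ℂ E
  obtain ⟨K, hK, hKb⟩ := e.exists_opNorm_le (F := E)
  -- The 1 keeps the set nonempty when E is zero-dimensional.
  let δ' := (insert 1 (Finset.univ.image fun i => δ (e i))).min' (by simp)
  have hδ' : 0 < δ' := by
    rw [Finset.lt_min'_iff]
    simp only [Finset.mem_insert, Finset.mem_image, Finset.mem_univ, true_and]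
    rintro y (rfl | ⟨i, rfl⟩)
    exacts [one_pos, hδ _]
  have hδle : ∀ i, δ' ≤ δ (e i) := fun i => Finset.min'_le _ _ (by simp)
  refine ⟨K * (1 + ∑ i, C (e i)), ?_, δ', hδ', fun t ht => ?_⟩
  · have : 0 ≤ ∑ i, C (e i) := Finset.sum_nonneg fun i _ => (hC _).le
    positivity
  have hs : 0 ≤ ∑ i, C (e i) := Finset.sum_nonneg fun i _ => (hC _).le
  have := hKb (u := linFlow 𝒜 t) (M := (1 + ∑ i, C (e i)) * Real.exp (-δ' * t)) (by positivity) ?_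
  · rw [mul_assoc]; exact this
  intro i
  refine (h (e i) t ht).trans ?_
  have h1 : C (e i) ≤ 1 + ∑ i, C (e i) := by
    have := Finset.single_le_sum (f := fun i => C (e i)) (fun i _ => (hC _).le) (Finset.mem_univ i)
    linarith
  gcongr
  exact hδle i

end LinearFlow

/-! ### Plancherel's theorem on L¹ ∩ L². -/

section Plancherel

-- The L² transform agrees with the distributional one. Moving the Fourier integral from f to a test
-- function shows that both sides have the same pairing with every smooth compactly supported
-- function.
open FourierTransform SchwartzMap in
theorem coeFn_fourier_toLp_ae_eq {f : ℝ → ℂ} (hf : Integrable f) (hf2 : MemLp f 2) :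
    (𝓕 (hf2.toLp f) : Lp ℂ 2 (volume : Measure ℝ)) =ᵐ[volume] 𝓕 f := by
  have hcont : Continuous (𝓕 f) :=
    VectorFourier.fourierIntegral_continuous Real.continuous_fourierChar
      (innerSL ℝ).continuous₂ hf
  refine ae_eq_of_integral_contDiff_smul_eq ((Lp.memLp _).locallyIntegrable (by norm_num))
    hcont.locallyIntegrable fun g g_smooth g_cpt => ?_
  have hg₁ : HasCompactSupport (Complex.ofRealCLM ∘ g) := g_cpt.comp_left rfl
  have hg₂ : ContDiff ℝ ∞ (Complex.ofRealCLM ∘ g) := by fun_prop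
  set γ : 𝓢(ℝ, ℂ) := hg₁.toSchwartzMap hg₂ with hγ
  have h1 : (∫ x, g x • (𝓕 (hf2.toLp f) : Lp ℂ 2 (volume : Measure ℝ)) x) =
      ((𝓕 (hf2.toLp f) : Lp ℂ 2 (volume : Measure ℝ)) : 𝓢'(ℝ, ℂ)) γ := by
    simp [hγ]
  rw [h1, ← Lp.fourier_toTemperedDistribution_eq, TemperedDistribution.fourier_apply,
    Lp.toTemperedDistribution_apply]
  have h2 : (∫ x, (𝓕 γ) x • (hf2.toLp f) x) = ∫ x, (𝓕 γ) x • f x := by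
    refine integral_congr_ae ?_
    filter_upwards [hf2.coeFn_toLp] with x hx
    rw [hx]
  have h3 := VectorFourier.integral_fourierIntegral_smul_eq_flip (μ := volume) (ν := volume)
    (L := innerₗ ℝ) Real.continuous_fourierChar continuous_inner γ.integrable hf
  rw [h2, SchwartzMap.fourier_coe]
  refine h3.trans ?_
  rw [flip_innerₗ]
  refine integral_congr_ae (Eventually.of_forall fun x => ?_)
  simp [hγ, Real.fourier_eq, VectorFourier.fourierIntegral]

open FourierTransform in
/-- Plancherel's theorem for the Fourier integral of functions in `L¹ ∩ L²`. -/
theorem integral_norm_sq_fourier {f : ℝ → ℂ} (hf : Integrable f) (hf2 : MemLp f 2) :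
    MemLp (𝓕 f) 2 ∧ ∫ ξ, ‖𝓕 f ξ‖ ^ 2 = ∫ t, ‖f t‖ ^ 2 := by
  have h := coeFn_fourier_toLp_ae_eq hf hf2
  refine ⟨(memLp_congr_ae h).1 (Lp.memLp _), ?_⟩
  have key : ∀ g : Lp ℂ 2 (volume : Measure ℝ), ‖g‖ ^ 2 = ∫ t, ‖g t‖ ^ 2 := by
    intro g
    have h4 := congrArg RCLike.re (L2.inner_def (𝕜 := ℂ) g g)
    rw [inner_self_eq_norm_sq, ← integral_re (L2.integrable_inner g g)] at h4
    rw [h4]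
    congr with t
    exact inner_self_eq_norm_sq (𝕜 := ℂ) _
  have h5 := Lp.norm_fourier_eq (hf2.toLp f)
  calc ∫ ξ, ‖𝓕 f ξ‖ ^ 2
      = ∫ ξ, ‖(𝓕 (hf2.toLp f) : Lp ℂ 2 (volume : Measure ℝ)) ξ‖ ^ 2 := by
        refine integral_congr_ae ?_
        filter_upwards [h] with x hx
        rw [hx]
    _ = ∫ t, ‖(hf2.toLp f) t‖ ^ 2 := by rw [← key, ← key, h5]
    _ = ∫ t, ‖f t‖ ^ 2 := by
        refine integral_congr_ae ?_
        filter_upwards [hf2.coeFn_toLp] with x hx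
        rw [hx]

end Plancherel

/-! ### Recovering the output at time zero from its L² norm. -/

section Observability

variable {E : Type*} [NormedAddCommGroup E] [NormedSpace ℂ E] [CompleteSpace E]
  [FiniteDimensional ℂ E]

/-- L is injective, hence bounded below, on a complement of its kernel, while c vanishes on the
kernel. This is why observability is not needed below: only the output has to be controlled, not the
state. -/
theorem LinearMap.exists_norm_apply_le_of_ker_le {F G : Type*} [NormedAddCommGroup F]
    [NormedSpace ℂ F] [NormedAddCommGroup G] [NormedSpace ℂ G] (L : E →ₗ[ℂ] F) (c : E →L[ℂ] G)
    (h : ∀ x, L x = 0 → c x = 0) : ∃ K > 0, ∀ x, ‖c x‖ ≤ K * ‖L x‖ := by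
  obtain ⟨S, hS⟩ := Submodule.exists_isCompl (LinearMap.ker L)
  have hinj : LinearMap.ker (L.domRestrict S) = ⊥ := by
    rw [LinearMap.ker_eq_bot']
    intro x hx
    have : (x : E) ∈ LinearMap.ker L ⊓ S := ⟨by simpa using hx, x.2⟩
    rw [hS.inf_eq_bot] at this
    simpa using this
  obtain ⟨K, hK, hKa⟩ := (L.domRestrict S).exists_antilipschitzWith hinj
  refine ⟨(‖c‖ + 1) * K, by positivity, fun x => ?_⟩
  have hx : x ∈ LinearMap.ker L ⊔ S := by rw [hS.sup_eq_top]; trivial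
  obtain ⟨y, hy, s, hs, rfl⟩ := Submodule.mem_sup.1 hx
  have hy0 : L y = 0 := by simpa using hy
  have h1 := hKa.le_mul_dist ⟨s, hs⟩ 0
  simp only [dist_zero_right, map_zero, LinearMap.domRestrict_apply] at h1
  rw [map_add, map_add, hy0, h y hy0, zero_add, zero_add, mul_assoc]
  calc ‖c s‖ ≤ ‖c‖ * ‖s‖ := c.le_opNorm s
    _ ≤ (‖c‖ + 1) * (K * ‖L s‖) := by
      gcongr
      · linarith
      · exact h1

theorem integrableOn_of_norm_le_exp {H : Type*} [NormedAddCommGroup H] {f : ℝ → H}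
    (hf : Continuous f) {C δ : ℝ} (hδ : 0 < δ) (h : ∀ t, 0 ≤ t → ‖f t‖ ≤ C * Real.exp (-δ * t)) :
    IntegrableOn f (Ioi 0) := by
  refine Integrable.mono' ((exp_neg_integrableOn_Ioi 0 hδ).const_mul C) hf.aestronglyMeasurable ?_
  filter_upwards [self_mem_ae_restrict measurableSet_Ioi] with t ht
  exact h t (le_of_lt ht)

theorem integrableOn_sq_of_norm_le_exp {H : Type*} [NormedAddCommGroup H] {f : ℝ → H}
    (hf : Continuous f) {C δ : ℝ} (hδ : 0 < δ) (h : ∀ t, 0 ≤ t → ‖f t‖ ≤ C * Real.exp (-δ * t)) :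
    IntegrableOn (fun t => ‖f t‖ ^ 2) (Ioi 0) := by
  refine integrableOn_of_norm_le_exp (C := C ^ 2) (δ := 2 * δ) (hf.norm.pow 2) (by positivity)
    fun t ht => ?_
  rw [norm_pow, norm_norm]
  calc ‖f t‖ ^ 2 ≤ (C * Real.exp (-δ * t)) ^ 2 := by gcongr; exact h t ht
    _ = _ := by rw [mul_pow, ← Real.exp_nat_mul]; congr 2; push_cast; ring

/-- The value at time zero of an output of a Hurwitz system is controlled by its `L²` norm. -/
theorem exists_norm_sq_le_integral_linFlow {𝒜 : E →L[ℂ] E} (h𝒜 : IsHurwitz 𝒜) (c : E →L[ℂ] ℂ) :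
    ∃ K > 0, ∀ x, ‖c x‖ ^ 2 ≤ K * ∫ t in Ioi (0 : ℝ), ‖c (linFlow 𝒜 t x)‖ ^ 2 := by
  obtain ⟨C, hC, δ, hδ, hb⟩ := exists_norm_linFlow_le h𝒜
  have hcont : ∀ x, Continuous fun t => c (linFlow 𝒜 t x) := fun x =>
    c.continuous.comp ((continuous_linFlow 𝒜).clm_apply continuous_const)
  have hbound : ∀ x t, 0 ≤ t → ‖c (linFlow 𝒜 t x)‖ ≤ (‖c‖ * C * ‖x‖) * Real.exp (-δ * t) := by
    intro x t ht
    calc ‖c (linFlow 𝒜 t x)‖ ≤ ‖c‖ * (‖linFlow 𝒜 t‖ * ‖x‖) := by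
          refine (c.le_opNorm _).trans ?_
          gcongr
          exact ContinuousLinearMap.le_opNorm _ _
      _ ≤ ‖c‖ * ((C * Real.exp (-δ * t)) * ‖x‖) := by gcongr; exact hb t ht
      _ = _ := by ring
  have hmem : ∀ x, MemLp (fun t => c (linFlow 𝒜 t x)) 2 (volume.restrict (Ioi (0 : ℝ))) :=
    fun x => (memLp_two_iff_integrable_sq_norm (hcont x).aestronglyMeasurable).2
      (integrableOn_sq_of_norm_le_exp (hcont x) hδ (hbound x))
  let L : E →ₗ[ℂ] Lp ℂ 2 (volume.restrict (Ioi (0 : ℝ))) :=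
    { toFun := fun x => (hmem x).toLp _
      map_add' := fun x y => by
        rw [← MemLp.toLp_add]
        congr 1
        ext t
        simp
      map_smul' := fun a x => by
        rw [RingHom.id_apply, ← MemLp.toLp_const_smul]
        congr 1
        ext t
        simp }
  have hL : ∀ x, ‖L x‖ ^ 2 = ∫ t in Ioi (0 : ℝ), ‖c (linFlow 𝒜 t x)‖ ^ 2 := by
    intro x
    have h4 := congrArg RCLike.re (L2.inner_def (𝕜 := ℂ) (L x) (L x))
    rw [inner_self_eq_norm_sq, ← integral_re (L2.integrable_inner _ _)] at h4
    rw [h4]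
    refine integral_congr_ae ?_
    filter_upwards [(hmem x).coeFn_toLp] with t ht
    rw [inner_self_eq_norm_sq]
    change ‖(hmem x).toLp _ t‖ ^ 2 = _
    rw [ht]
  -- An output that vanishes in L² vanishes on (0, ∞) by continuity, and at time 0 by passing to the
  -- closure.
  obtain ⟨K, hK, hKb⟩ := L.exists_norm_apply_le_of_ker_le c (by
    intro x hx
    have h0 : (fun t => c (linFlow 𝒜 t x)) =ᵐ[volume.restrict (Ioi (0 : ℝ))] fun _ => (0 : ℂ) :=
      ((hmem x).coeFn_toLp.symm.trans (Lp.ext_iff.1 hx)).trans (Lp.coeFn_zero _ _ _)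
    have h1 := Measure.eqOn_open_of_ae_eq h0 isOpen_Ioi (hcont x).continuousOn continuousOn_const
    have h2 := h1.closure (hcont x) continuous_const
    have h3 := h2 (x := 0) (by simp)
    simpa [linFlow_zero] using h3)
  refine ⟨K ^ 2, by positivity, fun x => ?_⟩
  rw [← hL, ← mul_pow]
  gcongr
  exact hKb x

end Observability

/-! ### Concatenation of two signals at time T. -/

section Glue

variable {H : Type*} [NormedAddCommGroup H] [NormedSpace ℝ H]

/-- The function that vanishes up to time zero, equals `p` on `(0, T]` and `q` after `T`. -/
noncomputable def glue (T : ℝ) (p q : ℝ → H) (t : ℝ) : H :=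
  if t ≤ 0 then 0 else if t ≤ T then p t else q t

theorem glue_of_mem_Ioc {T t : ℝ} (p q : ℝ → H) (h : t ∈ Ioc 0 T) : glue T p q t = p t := by
  simp [glue, h.1, h.2]

theorem glue_of_mem_Ioi {T t : ℝ} (hT : 0 ≤ T) (p q : ℝ → H) (h : t ∈ Ioi T) :
    glue T p q t = q t := by
  have h : T < t := h
  simp [glue, not_le.2 h, not_le.2 (hT.trans_lt h)]

theorem integrable_glue {T : ℝ} (hT : 0 ≤ T) {p q : ℝ → H} (hp : ContinuousOn p (Icc 0 T))
    (hq : IntegrableOn q (Ioi T)) : Integrable (glue T p q) := by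
  have h1 : IntegrableOn (glue T p q) (Iic 0) :=
    (integrableOn_zero (μ := volume)).congr_fun (fun t (ht : t ≤ 0) => by simp [glue, ht])
      measurableSet_Iic
  have h2 : IntegrableOn (glue T p q) (Ioc 0 T) :=
    ((hp.integrableOn_compact isCompact_Icc).mono_set Ioc_subset_Icc_self).congr_fun
      (fun t ht => (glue_of_mem_Ioc p q ht).symm) measurableSet_Ioc
  have h3 : IntegrableOn (glue T p q) (Ioi T) :=
    hq.congr_fun (fun t ht => (glue_of_mem_Ioi hT p q ht).symm) measurableSet_Ioi
  have h4 := h1.union (h2.union h3)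
  rwa [Ioc_union_Ioi_eq_Ioi hT, Iic_union_Ioi, integrableOn_univ] at h4

theorem integral_glue {T : ℝ} (hT : 0 ≤ T) {p q : ℝ → H} (hp : ContinuousOn p (Icc 0 T))
    (hq : IntegrableOn q (Ioi T)) :
    ∫ t, glue T p q t = (∫ t in (0 : ℝ)..T, p t) + ∫ t in Ioi T, q t := by
  have hi := integrable_glue hT hp hq
  rw [← setIntegral_eq_integral_of_forall_compl_eq_zero (s := Ioi 0), ← Ioc_union_Ioi_eq_Ioi hT,
    setIntegral_union (Ioc_disjoint_Ioi le_rfl) measurableSet_Ioi hi.integrableOn hi.integrableOn,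
    intervalIntegral.integral_of_le hT]
  · congr 1
    · exact setIntegral_congr_fun measurableSet_Ioc fun t ht => glue_of_mem_Ioc p q ht
    · exact setIntegral_congr_fun measurableSet_Ioi fun t ht => glue_of_mem_Ioi hT p q ht
  · intro t ht
    have : t ≤ 0 := by simpa using ht
    simp [glue, this]

end Glue

/-! ### From the frequency inequality to a time-domain bound on responses from rest. -/

section ForcedResponse

variable {E : Type*} [NormedAddCommGroup E] [NormedSpace ℂ E] [CompleteSpace E]
  [FiniteDimensional ℂ E]

/-- The frequency domain inequality `k |Y| ≤ |V + κ₀ Y|` for the system `x' = 𝒜 x + v b`,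
`y = c x`, on the imaginary axis. -/
def FrequencyInequality (𝒜 : E →L[ℂ] E) (b : E) (c : E →L[ℂ] ℂ) (κ₀ k : ℝ) : Prop :=
  ∀ (τ : ℝ) (x : E) (v : ℂ), (Complex.I * τ) • x = 𝒜 x + v • b →
    k ^ 2 * ‖c x‖ ^ 2 ≤ ‖v + κ₀ * c x‖ ^ 2

/-- The supply rate of the sector with centre `κ₀` and radius `k`. -/
noncomputable def supply (κ₀ k : ℝ) (y v : ℂ) : ℝ := ‖v + κ₀ * y‖ ^ 2 - k ^ 2 * ‖y‖ ^ 2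

/-- Output feedback with gain `κ`. -/
noncomputable def feedback (𝒜 : E →L[ℂ] E) (b : E) (c : E →L[ℂ] ℂ) (κ : ℝ) : E →L[ℂ] E :=
  𝒜 - (κ : ℂ) • c.smulRight b

theorem feedback_apply (𝒜 : E →L[ℂ] E) (b : E) (c : E →L[ℂ] ℂ) (κ : ℝ) (x : E) :
    feedback 𝒜 b c κ x = 𝒜 x + (-κ * c x) • b := by
  simp [feedback, sub_eq_add_neg, mul_smul]

-- The glued trajectory has no jumps: the boundary terms vanish at 0 since f 0 = 0, cancel at T
-- since f T = g T, and vanish at ∞ by decay. Its transform thus satisfies the differential equation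
-- in algebraic form.
open FourierTransform in
theorem fourier_glue_eq {𝒜 : E →L[ℂ] E} {b : E} {T : ℝ} (hT : 0 ≤ T) {f g : ℝ → E} {v w : ℝ → ℂ}
    (hf : ContinuousOn f (Icc 0 T)) (hv : ContinuousOn v (Icc 0 T)) (hf0 : f 0 = 0)
    (hfv : ∀ t ∈ Ioo 0 T, HasDerivAt f (𝒜 (f t) + v t • b) t)
    (hg : ContinuousOn g (Ici T)) (hgw : ∀ t ∈ Ioi T, HasDerivAt g (𝒜 (g t) + w t • b) t)
    (hgi : IntegrableOn g (Ioi T)) (hwi : IntegrableOn w (Ioi T)) (hlim : Tendsto g atTop (𝓝 0))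
    (hfg : f T = g T) (ξ : ℝ) :
    (Complex.I * (2 * π * ξ : ℝ)) • 𝓕 (glue T f g) ξ =
      𝒜 (𝓕 (glue T f g) ξ) + 𝓕 (glue T v w) ξ • b := by
  set e : ℝ → ℂ := fun t => Complex.exp (((-2 * π * t * ξ : ℝ) : ℂ) * Complex.I) with he
  have hed : ∀ t, HasDerivAt e (-(Complex.I * (2 * π * ξ : ℝ)) * e t) t := by
    intro t
    have h1 : HasDerivAt (fun t : ℝ => ((-2 * π * t * ξ : ℝ) : ℂ) * Complex.I)
        (((-2 * π * ξ : ℝ) : ℂ) * Complex.I) t := by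
      refine HasDerivAt.mul_const ?_ _
      refine HasDerivAt.ofReal_comp ?_
      have := ((hasDerivAt_id t).const_mul (-2 * π)).mul_const ξ
      simpa using this
    convert h1.cexp using 1
    simp only [he]
    push_cast
    ring
  have hec : Continuous e := by fun_prop
  have hen : ∀ t, ‖e t‖ = 1 := fun t => Complex.norm_exp_ofReal_mul_I _
  have hFi := integrable_glue hT hf hgi
  have hVi := integrable_glue hT hv hwi
  have hFe : Integrable fun t => e t • glue T f g t := by
    exact hFi.bdd_smul 1 hec.aestronglyMeasurable (Eventually.of_forall fun t => (hen t).le)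
  have hVe : Integrable fun t => e t • glue T v w t := by
    exact hVi.bdd_smul 1 hec.aestronglyMeasurable (Eventually.of_forall fun t => (hen t).le)
  set σ : ℂ := Complex.I * (2 * π * ξ : ℝ) with hσ
  -- the derivative of `e • f` and `e • g`
  have hder : ∀ (p : ℝ → E) (u : ℝ → ℂ) t, HasDerivAt p (𝒜 (p t) + u t • b) t →
      HasDerivAt (fun t => e t • p t) (e t • (𝒜 (p t) + u t • b - σ • p t)) t := by
    intro p u t hp
    refine ((hed t).smul hp).congr_deriv ?_
    rw [smul_sub, smul_smul, neg_mul, neg_smul, mul_comm σ]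
    abel
  have hcf : ContinuousOn (fun t => e t • (𝒜 (f t) + v t • b - σ • f t)) (Icc 0 T) :=
    hec.continuousOn.smul (((𝒜.continuous.comp_continuousOn hf).add
      (hv.smul continuousOn_const)).sub (hf.const_smul σ))
  have hig : IntegrableOn (fun t => e t • (𝒜 (g t) + w t • b - σ • g t)) (Ioi T) :=
    (((𝒜.integrable_comp hgi).add (hwi.smul_const b)).sub (hgi.smul σ)).bdd_smul 1
      hec.aestronglyMeasurable (Eventually.of_forall fun t => (hen t).le)
  have h1 : ∫ t in (0 : ℝ)..T, e t • (𝒜 (f t) + v t • b - σ • f t) = e T • f T := by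
    rw [intervalIntegral.integral_eq_sub_of_hasDerivAt_of_le hT (hec.continuousOn.smul hf)
      (fun t ht => hder f v t (hfv t ht)) (hcf.intervalIntegrable_of_Icc hT)]
    simp [hf0]
  have h2 : ∫ t in Ioi T, e t • (𝒜 (g t) + w t • b - σ • g t) = 0 - e T • g T := by
    refine integral_Ioi_of_hasDerivAt_of_tendsto
      ((hec.continuousOn.smul hg) T self_mem_Ici) (fun t ht => hder g w t (hgw t ht)) hig ?_
    rw [tendsto_zero_iff_norm_tendsto_zero] at hlim ⊢
    simpa [norm_smul, hen] using hlim
  have h3 : ∫ t, e t • (𝒜 (glue T f g t) + glue T v w t • b - σ • glue T f g t) = 0 := by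
    have : (fun t => e t • (𝒜 (glue T f g t) + glue T v w t • b - σ • glue T f g t)) =
        glue T (fun t => e t • (𝒜 (f t) + v t • b - σ • f t))
          (fun t => e t • (𝒜 (g t) + w t • b - σ • g t)) := by
      ext t
      simp only [glue]
      split_ifs <;> simp
    rw [this, integral_glue hT hcf hig, h1, h2, hfg]
    simp
  have hF : 𝓕 (glue T f g) ξ = ∫ t, e t • glue T f g t := by
    rw [Real.fourier_real_eq_integral_exp_smul]
  have hV : 𝓕 (glue T v w) ξ = ∫ t, e t • glue T v w t := by
    rw [Real.fourier_real_eq_integral_exp_smul]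
  have h4 : ∀ t, e t • (𝒜 (glue T f g t) + glue T v w t • b - σ • glue T f g t) =
      (𝒜 (e t • glue T f g t) + (e t • glue T v w t) • b) - σ • (e t • glue T f g t) := by
    intro t
    rw [smul_sub, smul_add, map_smul, smul_smul, smul_comm σ, smul_eq_mul, mul_smul, mul_smul]
  simp_rw [h4] at h3
  have hi1 : Integrable fun t => 𝒜 (e t • glue T f g t) := 𝒜.integrable_comp hFe
  have hi2 : Integrable fun t => (e t • glue T v w t) • b := hVe.smul_const b
  have hi12 : Integrable fun t => 𝒜 (e t • glue T f g t) + (e t • glue T v w t) • b := hi1.add hi2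
  have hi3 : Integrable fun t => σ • (e t • glue T f g t) := hFe.smul σ
  rw [integral_sub hi12 hi3, integral_add hi1 hi2, integral_smul,
    integral_smul_const, 𝒜.integral_comp_comm hFe, ← hF, ← hV] at h3
  exact (sub_eq_zero.1 h3).symm

open FourierTransform in
theorem fourier_clm_comp {f : ℝ → E} (hf : Integrable f) (c : E →L[ℂ] ℂ) (ξ : ℝ) :
    𝓕 (fun t => c (f t)) ξ = c (𝓕 f ξ) := by
  rw [Real.fourier_real_eq, Real.fourier_real_eq, ← c.integral_comp_comm]
  · simp [Circle.smul_def]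
  · have := (Real.fourierIntegral_convergent_iff (f := f) ξ).2 hf
    simpa [mul_comm] using this

open FourierTransform in
theorem fourier_add_const_mul {f g : ℝ → ℂ} (hf : Integrable f) (hg : Integrable g) (a : ℂ)
    (ξ : ℝ) : 𝓕 (fun t => f t + a * g t) ξ = 𝓕 f ξ + a * 𝓕 g ξ := by
  have h1 := (Real.fourierIntegral_convergent_iff (f := f) ξ).2 hf
  have h2 := (Real.fourierIntegral_convergent_iff (f := g) ξ).2 hg
  simp_rw [Real.fourier_eq]
  rw [← integral_const_mul, ← integral_add h1 (h2.const_mul a)]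
  congr with t
  simp only [Circle.smul_def, smul_eq_mul]
  ring

theorem integrableOn_comp_sub {H : Type*} [NormedAddCommGroup H] {q : ℝ → H}
    (hq : IntegrableOn q (Ioi 0)) (T : ℝ) : IntegrableOn (fun t => q (t - T)) (Ioi T) := by
  have := (measurePreserving_sub_right volume T).integrableOn_comp_preimage
    (MeasurableEquiv.subRight T).measurableEmbedding (f := q) (s := Ioi 0)
  rw [← this] at hq
  simpa [Function.comp_def] using hq

open FourierTransform in
/-- A forced response from rest absorbs at least the supply that is recovered afterwards by a
stabilizing feedback. -/
theorem le_integral_supply_of_forced {𝒜 : E →L[ℂ] E} {b : E} {c : E →L[ℂ] ℂ} {κ₀ k κ : ℝ}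
    (hfreq : FrequencyInequality 𝒜 b c κ₀ k) (hκ : IsHurwitz (feedback 𝒜 b c κ))
    {T : ℝ} (hT : 0 ≤ T) {f : ℝ → E} {v : ℝ → ℂ}
    (hf : ContinuousOn f (Icc 0 T)) (hv : ContinuousOn v (Icc 0 T)) (hf0 : f 0 = 0)
    (hfv : ∀ t ∈ Ioo 0 T, HasDerivAt f (𝒜 (f t) + v t • b) t) :
    (k ^ 2 - (κ₀ - κ) ^ 2) *
        ∫ t in Ioi (0 : ℝ), ‖c (linFlow (feedback 𝒜 b c κ) t (f T))‖ ^ 2 ≤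
      ∫ t in (0 : ℝ)..T, supply κ₀ k (c (f t)) (v t) := by
  obtain ⟨C, hC, δ, hδ, hb⟩ := exists_norm_linFlow_le hκ
  set x := f T with hx
  set g₀ : ℝ → E := fun t => linFlow (feedback 𝒜 b c κ) t x with hg₀
  have hg₀c : Continuous g₀ := (continuous_linFlow _).clm_apply continuous_const
  have hg₀b : ∀ t, 0 ≤ t → ‖g₀ t‖ ≤ (C * ‖x‖) * Real.exp (-δ * t) := by
    intro t ht
    calc ‖g₀ t‖ ≤ ‖linFlow (feedback 𝒜 b c κ) t‖ * ‖x‖ := ContinuousLinearMap.le_opNorm _ _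
      _ ≤ (C * Real.exp (-δ * t)) * ‖x‖ := by gcongr; exact hb t ht
      _ = _ := by ring
  have hcg₀b : ∀ t, 0 ≤ t → ‖c (g₀ t)‖ ≤ (‖c‖ * (C * ‖x‖)) * Real.exp (-δ * t) := by
    intro t ht
    rw [mul_assoc]
    refine (c.le_opNorm _).trans ?_
    gcongr
    exact hg₀b t ht
  -- After T the system is left to the feedback flow started at f T, whose input is −κ times its
  -- output.
  set g : ℝ → E := fun t => g₀ (t - T) with hg
  have hgc : Continuous g := hg₀c.comp (by fun_prop)
  have hgi : IntegrableOn g (Ioi T) := integrableOn_comp_sub (integrableOn_of_norm_le_exp hg₀c hδ hg₀b) T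
  have hcgi : IntegrableOn (fun t => c (g t)) (Ioi T) := c.integrable_comp hgi
  have hcgi2 : IntegrableOn (fun t => ‖c (g t)‖ ^ 2) (Ioi T) := by
    exact integrableOn_comp_sub (integrableOn_sq_of_norm_le_exp (c.continuous.comp hg₀c) hδ hcg₀b) T
  set w : ℝ → ℂ := fun t => -κ * c (g t) with hw
  have hwi : IntegrableOn w (Ioi T) := hcgi.const_mul _
  have hgw : ∀ t ∈ Ioi T, HasDerivAt g (𝒜 (g t) + w t • b) t := by
    intro t _
    have := (hasDerivAt_linFlow_apply (feedback 𝒜 b c κ) x (t - T)).scomp t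
      ((hasDerivAt_id t).sub_const T)
    rw [feedback_apply] at this
    simpa [hg, hg₀, hw, Function.comp_def] using this
  have hlim : Tendsto g atTop (𝓝 0) := by
    have h1 : Tendsto g₀ atTop (𝓝 0) := by
      refine squeeze_zero_norm' ((eventually_ge_atTop 0).mono hg₀b) ?_
      have : Tendsto (fun t : ℝ => Real.exp (-δ * t)) atTop (𝓝 0) :=
        Real.tendsto_exp_atBot.comp (tendsto_id.const_mul_atTop_of_neg (by linarith))
      simpa using this.const_mul (C * ‖x‖)
    exact h1.comp (tendsto_atTop_add_const_right _ (-T) tendsto_id)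
  have hfg : f T = g T := by simp [hg, hg₀, linFlow_zero, hx]
  have hFi := integrable_glue hT hf hgi
  have hVi := integrable_glue hT hv hwi
  have hkey := fourier_glue_eq hT hf hv hf0 hfv hgc.continuousOn hgw hgi hwi hlim hfg
  set F := glue T f g with hF
  set V := glue T v w with hV
  have hcf : ContinuousOn (fun t => c (f t)) (Icc 0 T) := c.continuous.comp_continuousOn hf
  have hYi : Integrable (fun t => c (F t)) := c.integrable_comp hFi
  have hWi : Integrable (fun t => V t + κ₀ * c (F t)) := hVi.add (hYi.const_mul _)
  have hY2 : (fun t => ‖c (F t)‖ ^ 2) =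
      glue T (fun t => ‖c (f t)‖ ^ 2) (fun t => ‖c (g t)‖ ^ 2) := by
    ext t
    simp only [hF, glue]
    split_ifs <;> simp
  -- On the tail v + κ₀y = (κ₀ − κ)y, so the supply there is −(k² − (κ₀−κ)²)|y|².
  have hW2 : (fun t => ‖V t + κ₀ * c (F t)‖ ^ 2) =
      glue T (fun t => ‖v t + κ₀ * c (f t)‖ ^ 2) (fun t => (κ₀ - κ) ^ 2 * ‖c (g t)‖ ^ 2) := by
    ext t
    simp only [hF, hV, hw, glue]
    split_ifs
    · simp
    · rfl
    · have : -(κ : ℂ) * c (g t) + κ₀ * c (g t) = ((κ₀ - κ : ℝ) : ℂ) * c (g t) := by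
        push_cast; ring
      rw [this, norm_mul, mul_pow, Complex.norm_real, norm_eq_abs, sq_abs]
  have hcY : ContinuousOn (fun t => ‖c (f t)‖ ^ 2) (Icc 0 T) := hcf.norm.pow 2
  have hcW : ContinuousOn (fun t => ‖v t + κ₀ * c (f t)‖ ^ 2) (Icc 0 T) :=
    (hv.add (continuousOn_const.mul hcf)).norm.pow 2
  have hYm : MemLp (fun t => c (F t)) 2 :=
    (memLp_two_iff_integrable_sq_norm hYi.aestronglyMeasurable).2
      (by rw [hY2]; exact integrable_glue hT hcY hcgi2)
  have hWm : MemLp (fun t => V t + κ₀ * c (F t)) 2 :=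
    (memLp_two_iff_integrable_sq_norm hWi.aestronglyMeasurable).2
      (by rw [hW2]; exact integrable_glue hT hcW (hcgi2.const_mul _))
  obtain ⟨hYm', hYp⟩ := integral_norm_sq_fourier hYi hYm
  obtain ⟨hWm', hWp⟩ := integral_norm_sq_fourier hWi hWm
  have hmain : k ^ 2 * ∫ t, ‖c (F t)‖ ^ 2 ≤ ∫ t, ‖V t + κ₀ * c (F t)‖ ^ 2 := by
    rw [← hYp, ← hWp, ← integral_const_mul]
    refine integral_mono (((memLp_two_iff_integrable_sq_norm hYm'.1).1 hYm').const_mul _)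
      ((memLp_two_iff_integrable_sq_norm hWm'.1).1 hWm') fun ξ => ?_
    simp only
    rw [fourier_add_const_mul hVi hYi, fourier_clm_comp hFi]
    -- The angular frequency is 2πξ in the normalization of `𝓕`.
    exact hfreq (2 * π * ξ) _ _ (hkey ξ)
  rw [hY2, hW2, integral_glue hT hcY hcgi2, integral_glue hT hcW (hcgi2.const_mul _),
    integral_const_mul] at hmain
  have htail : ∫ t in Ioi T, ‖c (g t)‖ ^ 2 = ∫ t in Ioi (0 : ℝ), ‖c (g₀ t)‖ ^ 2 := by
    have h1 := (measurePreserving_sub_right volume T).setIntegral_preimage_emb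
      (MeasurableEquiv.subRight T).measurableEmbedding (fun t => ‖c (g₀ t)‖ ^ 2) (Ioi 0)
    simpa using h1
  have hs : ∫ t in (0 : ℝ)..T, supply κ₀ k (c (f t)) (v t) =
      (∫ t in (0 : ℝ)..T, ‖v t + κ₀ * c (f t)‖ ^ 2) -
        k ^ 2 * ∫ t in (0 : ℝ)..T, ‖c (f t)‖ ^ 2 := by
    rw [← intervalIntegral.integral_const_mul, ← intervalIntegral.integral_sub
      (hcW.intervalIntegrable_of_Icc hT) ((hcY.intervalIntegrable_of_Icc hT).const_mul _)]
    rfl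
  rw [hs, ← htail]
  linarith

end ForcedResponse

/-! ### Dissipativity of a single low mode. -/

section Modes

variable {E : Type*} [NormedAddCommGroup E] [NormedSpace ℂ E] [CompleteSpace E]

/-- `z` is a trajectory of `z' = 𝒜 z + v b`. -/
structure IsTrajectory (𝒜 : E →L[ℂ] E) (b : E) (z : ℝ → E) (v : ℝ → ℂ) : Prop where
  continuousOn_state : ContinuousOn z (Ici 0)
  continuousOn_input : ContinuousOn v (Ici 0)
  hasDerivAt : ∀ t, 0 < t → HasDerivAt z (𝒜 (z t) + v t • b) t

/-- Up to an exponentially decaying error, the output of `z` is a signal `Y` that absorbs supply;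
moreover the state is bounded by the input. -/
def IsDissipativeUpToDecay (C κ₀ k : ℝ) (c : E →L[ℂ] ℂ) (z : ℝ → E) (v : ℝ → ℂ) : Prop :=
  (∃ Y : ℝ → ℂ, ContinuousOn Y (Ici 0) ∧
    (∀ T, 0 ≤ T → ‖Y T‖ ^ 2 ≤ C * ∫ t in (0 : ℝ)..T, supply κ₀ k (Y t) (v t)) ∧
    ∀ t, 0 ≤ t → ‖c (z t) - Y t‖ ≤ C * Real.exp (-t / C) * ‖z 0‖) ∧
  ∀ T, 0 ≤ T → ∀ m, (∀ t ∈ Icc 0 T, ‖v t‖ ≤ m) → ‖z T‖ ≤ C * (‖z 0‖ + m)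

theorem IsDissipativeUpToDecay.mono {C C' κ₀ k : ℝ} {c : E →L[ℂ] ℂ} {z : ℝ → E} {v : ℝ → ℂ}
    (h : IsDissipativeUpToDecay C κ₀ k c z v) (hC : 0 < C) (hCC' : C ≤ C') :
    IsDissipativeUpToDecay C' κ₀ k c z v := by
  obtain ⟨⟨Y, hYc, hY, hd⟩, hz⟩ := h
  refine ⟨⟨Y, hYc, fun T hT => (hY T hT).trans ?_, fun t ht => (hd t ht).trans ?_⟩,
    fun T hT m hm => (hz T hT m hm).trans ?_⟩
  · have h0 : 0 ≤ C * ∫ t in (0 : ℝ)..T, supply κ₀ k (Y t) (v t) := (sq_nonneg _).trans (hY T hT)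
    have := nonneg_of_mul_nonneg_right h0 hC
    gcongr
  · have : -t / C ≤ -t / C' := by
      rw [neg_div, neg_div, neg_le_neg_iff]
      gcongr
    have hC' : 0 ≤ C' := hC.le.trans hCC'
    gcongr
  · have : 0 ≤ m := (norm_nonneg _).trans (hm 0 ⟨le_rfl, hT⟩)
    gcongr

theorem integral_exp_neg_le {δ : ℝ} (hδ : 0 < δ) {T : ℝ} :
    ∫ t in (0 : ℝ)..T, Real.exp (-δ * t) ≤ 1 / δ := by
  have hd : ∀ t ∈ uIcc 0 T,
      HasDerivAt (fun t => -Real.exp (-δ * t) / δ) (Real.exp (-δ * t)) t := by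
    intro t _
    have := (((hasDerivAt_id t).const_mul (-δ)).exp.neg).div_const δ
    refine this.congr_deriv ?_
    simp only [id_eq, mul_one]
    field_simp
  rw [intervalIntegral.integral_eq_sub_of_hasDerivAt hd
    (Continuous.intervalIntegrable (by fun_prop) _ _)]
  have := Real.exp_pos (-δ * T)
  simp only [mul_zero, Real.exp_zero]
  rw [neg_div, neg_div, sub_neg_eq_add]
  have : 0 < Real.exp (-δ * T) / δ := by positivity
  linarith

variable [FiniteDimensional ℂ E]

/-- Split the trajectory into its free response, which decays since 𝒜 is Hurwitz, and its response
from rest, whose output serves as Y. The feedback is stable with gain strictly inside the sector, so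
the supply dominates the L² norm of the output that would follow, hence |Y(T)|². The state bound is
variation of constants. -/
theorem exists_isDissipativeUpToDecay {𝒜 : E →L[ℂ] E} {b : E} {c : E →L[ℂ] ℂ} {κ₀ k κ : ℝ}
    (h𝒜 : IsHurwitz 𝒜) (hfreq : FrequencyInequality 𝒜 b c κ₀ k)
    (hκ : IsHurwitz (feedback 𝒜 b c κ)) (hκk : (κ₀ - κ) ^ 2 < k ^ 2) :
    ∃ C > 0, ∀ z v, IsTrajectory 𝒜 b z v → IsDissipativeUpToDecay C κ₀ k c z v := by
  obtain ⟨C, hC, δ, hδ, hb⟩ := exists_norm_linFlow_le h𝒜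
  obtain ⟨K, hK, hKb⟩ := exists_norm_sq_le_integral_linFlow hκ c
  -- The strict margin of κ inside the sector. It compensates for the frequency inequality not being
  -- strict.
  have hε : 0 < k ^ 2 - (κ₀ - κ) ^ 2 := by linarith
  set C₁ := K / (k ^ 2 - (κ₀ - κ) ^ 2) with hC₁
  -- One constant for all four bounds: C₁ for the supply, ‖c‖C for the error, 1/δ for its decay
  -- rate, C and C‖b‖/δ for the state.
  set C' := C₁ + (‖c‖ + 1) * C + 1 / δ + C * ‖b‖ / δ with hC'
  have p1 : 0 < C₁ := by positivity
  have p2 : 0 ≤ ‖c‖ * C := by positivity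
  have p3 : 0 < 1 / δ := by positivity
  have p4 : 0 ≤ C * ‖b‖ / δ := by positivity
  have hC'0 : 0 < C' := by positivity
  refine ⟨C', hC'0, fun z v h => ⟨?_, ?_⟩⟩
  · set f : ℝ → E := fun t => z t - linFlow 𝒜 t (z 0) with hf
    have hfl : Continuous fun t => linFlow 𝒜 t (z 0) :=
      (continuous_linFlow 𝒜).clm_apply continuous_const
    have hfc : ContinuousOn f (Ici 0) := h.continuousOn_state.sub hfl.continuousOn
    have hfd : ∀ t, 0 < t → HasDerivAt f (𝒜 (f t) + v t • b) t := by
      intro t ht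
      refine ((h.hasDerivAt t ht).sub (hasDerivAt_linFlow_apply 𝒜 (z 0) t)).congr_deriv ?_
      simp only [hf, map_sub]
      abel
    refine ⟨fun t => c (f t), c.continuous.comp_continuousOn hfc, fun T hT => ?_, fun t ht => ?_⟩
    · have h1 := le_integral_supply_of_forced hfreq hκ hT (hfc.mono Icc_subset_Ici_self)
        (h.continuousOn_input.mono Icc_subset_Ici_self) (by simp [hf, linFlow_zero])
        (fun t ht => hfd t ht.1)
      have h2 := hKb (f T)
      have h0 : 0 ≤ ∫ t in Ioi (0 : ℝ), ‖c (linFlow (feedback 𝒜 b c κ) t (f T))‖ ^ 2 :=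
        integral_nonneg fun t => sq_nonneg _
      have h3 : 0 ≤ ∫ t in (0 : ℝ)..T, supply κ₀ k (c (f t)) (v t) :=
        (mul_nonneg hε.le h0).trans h1
      calc ‖c (f T)‖ ^ 2 ≤ K * ∫ t in Ioi (0 : ℝ), ‖c (linFlow (feedback 𝒜 b c κ) t (f T))‖ ^ 2 := h2
        _ = C₁ * ((k ^ 2 - (κ₀ - κ) ^ 2) *
            ∫ t in Ioi (0 : ℝ), ‖c (linFlow (feedback 𝒜 b c κ) t (f T))‖ ^ 2) := by
          rw [hC₁]; field_simp
        _ ≤ C₁ * ∫ t in (0 : ℝ)..T, supply κ₀ k (c (f t)) (v t) := by gcongr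
        _ ≤ _ := by
          gcongr
          rw [hC']
          nlinarith
    · have h1 : c (z t) - c (f t) = c (linFlow 𝒜 t (z 0)) := by rw [← map_sub]; simp [hf]
      rw [h1]
      have h2 : -δ * t ≤ -t / C' := by
        have : 1 / C' ≤ δ := by
          rw [one_div_le hC'0 hδ, hC']
          nlinarith
        have := mul_le_mul_of_nonneg_right this ht
        have e : -t / C' = -(1 / C' * t) := by ring
        rw [e]; linarith
      calc ‖c (linFlow 𝒜 t (z 0))‖ ≤ ‖c‖ * (‖linFlow 𝒜 t‖ * ‖z 0‖) := by
            refine (c.le_opNorm _).trans ?_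
            gcongr
            exact ContinuousLinearMap.le_opNorm _ _
        _ ≤ ‖c‖ * ((C * Real.exp (-δ * t)) * ‖z 0‖) := by gcongr; exact hb t ht
        _ = (‖c‖ * C) * Real.exp (-δ * t) * ‖z 0‖ := by ring
        _ ≤ _ := by
          gcongr
          rw [hC']
          nlinarith
  · intro T hT m hm
    have hm0 : 0 ≤ m := (norm_nonneg _).trans (hm 0 ⟨le_rfl, hT⟩)
    rw [eq_linFlow_add_integral 𝒜 b h.continuousOn_state h.continuousOn_input h.hasDerivAt hT]
    have h1 : ‖linFlow 𝒜 T (z 0)‖ ≤ C * ‖z 0‖ := by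
      refine (ContinuousLinearMap.le_opNorm _ _).trans ?_
      gcongr
      refine (hb T hT).trans ?_
      have : Real.exp (-δ * T) ≤ 1 := Real.exp_le_one_iff.2 (by nlinarith)
      nlinarith
    have h2 : ‖∫ s in (0 : ℝ)..T, v s • linFlow 𝒜 (T - s) b‖ ≤
        ∫ s in (0 : ℝ)..T, (m * C * ‖b‖) * Real.exp (-δ * (T - s)) := by
      refine intervalIntegral.norm_integral_le_of_norm_le hT ?_
        (Continuous.intervalIntegrable (by fun_prop) _ _)
      refine Eventually.of_forall fun s hs => ?_
      rw [norm_smul]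
      calc ‖v s‖ * ‖linFlow 𝒜 (T - s) b‖ ≤ m * ((C * Real.exp (-δ * (T - s))) * ‖b‖) := by
            gcongr
            · exact hm s ⟨hs.1.le, hs.2⟩
            · refine (ContinuousLinearMap.le_opNorm _ _).trans ?_
              gcongr
              exact hb _ (by linarith [hs.2])
        _ = _ := by ring
    have h3 : ∫ s in (0 : ℝ)..T, (m * C * ‖b‖) * Real.exp (-δ * (T - s)) ≤
        (m * C * ‖b‖) * (1 / δ) := by
      rw [intervalIntegral.integral_const_mul,
        intervalIntegral.integral_comp_sub_left (fun s => Real.exp (-δ * s)) T, sub_self, sub_zero]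
      gcongr
      exact integral_exp_neg_le hδ
    calc _ ≤ C * ‖z 0‖ + (m * C * ‖b‖) * (1 / δ) := (norm_add_le _ _).trans (by linarith)
      _ = C * ‖z 0‖ + (C * ‖b‖ / δ) * m := by ring
      _ ≤ C' * ‖z 0‖ + C' * m := by
        gcongr
        · rw [hC']; nlinarith
        · rw [hC']; nlinarith
      _ = _ := by ring

end Modes

/-! ### Modes for which the squared norm is a storage function. -/

section LargeModes

variable {E : Type*} [NormedAddCommGroup E] [InnerProductSpace ℂ E] [CompleteSpace E]

-- Integrate the pointwise dissipation inequality, whose left side is the derivative of ‖z‖². Unlike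
-- in the low modes, there is no error term.
open scoped InnerProductSpace in
theorem norm_sq_le_add_integral_supply {𝒜 : E →L[ℂ] E} {b : E} {c : E →L[ℂ] ℂ} {κ₀ k : ℝ}
    (hdiss : ∀ x v, 2 * (⟪x, 𝒜 x + v • b⟫_ℂ).re ≤ supply κ₀ k (c x) v) {z : ℝ → E} {v : ℝ → ℂ}
    (h : IsTrajectory 𝒜 b z v) {T : ℝ} (hT : 0 ≤ T) :
    ‖z T‖ ^ 2 ≤ ‖z 0‖ ^ 2 + ∫ t in (0 : ℝ)..T, supply κ₀ k (c (z t)) (v t) := by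
  have hz : ContinuousOn z (Icc 0 T) := h.continuousOn_state.mono Icc_subset_Ici_self
  have hv : ContinuousOn v (Icc 0 T) := h.continuousOn_input.mono Icc_subset_Ici_self
  have hd : ∀ t ∈ Ioo 0 T, HasDerivAt (fun t => ‖z t‖ ^ 2)
      (2 * (⟪z t, 𝒜 (z t) + v t • b⟫_ℂ).re) t := by
    intro t ht
    have h1 := h.hasDerivAt t ht.1
    have h2 := (h1.inner ℂ h1)
    have h3 := Complex.reCLM.hasFDerivAt.comp_hasDerivAt t h2
    have e : (fun t => ‖z t‖ ^ 2) = Complex.reCLM ∘ fun t => ⟪z t, z t⟫_ℂ := by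
      ext s
      simpa using (inner_self_eq_norm_sq (𝕜 := ℂ) (z s)).symm
    rw [e]
    refine h3.congr_deriv ?_
    have := inner_re_symm (𝕜 := ℂ) (𝒜 (z t) + v t • b) (z t)
    simp only [RCLike.re_to_complex] at this
    simp only [Complex.reCLM_apply, Complex.add_re, this]
    ring
  have hc1 : ContinuousOn (fun t => 2 * (⟪z t, 𝒜 (z t) + v t • b⟫_ℂ).re) (Icc 0 T) :=
    continuousOn_const.mul (Complex.continuous_re.comp_continuousOn
      (hz.inner ((𝒜.continuous.comp_continuousOn hz).add (hv.smul continuousOn_const))))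
  have hcz := c.continuous.comp_continuousOn hz
  have hc2 : ContinuousOn (fun t => supply κ₀ k (c (z t)) (v t)) (Icc 0 T) :=
    ((hv.add (continuousOn_const.mul hcz)).norm.pow 2).sub (continuousOn_const.mul (hcz.norm.pow 2))
  have h1 := intervalIntegral.integral_eq_sub_of_hasDerivAt_of_le hT (hz.norm.pow 2) hd
    (hc1.intervalIntegrable_of_Icc hT)
  have h2 := intervalIntegral.integral_mono_on hT (hc1.intervalIntegrable_of_Icc (μ := volume) hT)
    (hc2.intervalIntegrable_of_Icc hT) (fun t _ => hdiss (z t) (v t))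
  simp only [Pi.pow_apply] at h1
  linarith

open scoped InnerProductSpace in
/-- Strong dissipation dominates the interconnection. -/
theorem two_mul_re_inner_le_supply {𝒜 : E →L[ℂ] E} {b : E} {c : E →L[ℂ] ℂ} {κ₀ k ρ : ℝ}
    (h : ∀ x, (⟪x, 𝒜 x⟫_ℂ).re ≤ -ρ * ‖x‖ ^ 2)
    (hρ : ‖b‖ ^ 2 + 2 * |κ₀| * ‖c‖ * ‖b‖ + k ^ 2 * ‖c‖ ^ 2 ≤ 2 * ρ) (x : E) (v : ℂ) :
    2 * (⟪x, 𝒜 x + v • b⟫_ℂ).re ≤ supply κ₀ k (c x) v := by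
  -- Writing the input through v + κ₀y lets Young's inequality match the first term of the supply;
  -- what remains is quadratic in x and absorbed by ρ.
  have h1 : v • b = (v + κ₀ * c x) • b - ((κ₀ : ℂ) * c x) • b := by rw [← sub_smul]; congr 1; ring
  set u := v + κ₀ * c x with hu
  have h2 : (⟪x, u • b⟫_ℂ).re ≤ ‖x‖ * (‖u‖ * ‖b‖) := by
    have := (Complex.re_le_norm _).trans (norm_inner_le_norm (𝕜 := ℂ) x (u • b))
    rwa [norm_smul] at this
  have h3 : -(⟪x, ((κ₀ : ℂ) * c x) • b⟫_ℂ).re ≤ ‖x‖ * (|κ₀| * (‖c‖ * ‖x‖) * ‖b‖) := by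
    have := (neg_le_abs _).trans ((Complex.abs_re_le_norm _).trans
      (norm_inner_le_norm (𝕜 := ℂ) x (((κ₀ : ℂ) * c x) • b)))
    refine this.trans ?_
    rw [norm_smul, norm_mul, Complex.norm_real, norm_eq_abs]
    gcongr
    exact c.le_opNorm x
  have h4 : ‖c x‖ ^ 2 ≤ ‖c‖ ^ 2 * ‖x‖ ^ 2 := by
    rw [← mul_pow]; gcongr; exact c.le_opNorm x
  rw [h1, inner_add_right, inner_sub_right, supply, ← hu, Complex.add_re, Complex.sub_re]
  have h5 := h x
  have h6 : 2 * (‖x‖ * (‖u‖ * ‖b‖)) ≤ ‖u‖ ^ 2 + ‖b‖ ^ 2 * ‖x‖ ^ 2 := by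
    nlinarith [sq_nonneg (‖u‖ - ‖b‖ * ‖x‖)]
  have h7 := mul_le_mul_of_nonneg_right hρ (sq_nonneg ‖x‖)
  have h8 := mul_le_mul_of_nonneg_left h4 (sq_nonneg k)
  nlinarith

end LargeModes

/-! ### A uniform bound for infinitely many modes coupled by the sector condition. -/

section Interconnection

theorem continuousOn_supply {κ₀ k : ℝ} {y v : ℝ → ℂ} {s : Set ℝ} (hy : ContinuousOn y s)
    (hv : ContinuousOn v s) : ContinuousOn (fun t => supply κ₀ k (y t) (v t)) s :=
  ((hv.add (continuousOn_const.mul hy)).norm.pow 2).sub (continuousOn_const.mul (hy.norm.pow 2))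

/-- Replacing y by Y costs an amount proportional to the error y − Y. With an exponentially decaying
error and bounded signals, this cost is integrable in time uniformly in T. -/
theorem supply_le_supply_add (κ₀ k : ℝ) (y Y v : ℂ) :
    supply κ₀ k Y v ≤ supply κ₀ k y v +
      2 * (1 + κ₀ ^ 2 + k ^ 2) * (‖y - Y‖ * (‖y‖ + ‖v‖ + ‖y - Y‖)) := by
  set d := y - Y with hd
  have hY : Y = y - d := by rw [hd]; ring
  have h1 : v + κ₀ * Y = (v + κ₀ * y) - κ₀ * d := by rw [hY]; ring
  have h2 : ‖v + κ₀ * Y‖ ≤ ‖v + κ₀ * y‖ + |κ₀| * ‖d‖ := by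
    rw [h1]
    refine (norm_sub_le _ _).trans ?_
    rw [norm_mul, Complex.norm_real, norm_eq_abs]
  have h3 : ‖v + κ₀ * y‖ ≤ ‖v‖ + |κ₀| * ‖y‖ := by
    refine (norm_add_le _ _).trans ?_
    rw [norm_mul, Complex.norm_real, norm_eq_abs]
  have h4 : ‖y‖ ≤ ‖Y‖ + ‖d‖ := by
    have : y = Y + d := by rw [hY]; ring
    calc ‖y‖ = ‖Y + d‖ := by rw [← this]
      _ ≤ _ := norm_add_le _ _
  have h6 : ‖Y‖ ≤ ‖y‖ + ‖d‖ := by rw [hY]; exact norm_sub_le _ _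
  have hκ : |κ₀| ≤ (1 + κ₀ ^ 2) / 2 := by
    have := sq_nonneg (|κ₀| - 1)
    rw [sub_sq, sq_abs] at this
    linarith
  have hκ2 : |κ₀| ^ 2 = κ₀ ^ 2 := sq_abs _
  have n1 := norm_nonneg d
  have n2 := norm_nonneg y
  have n3 := norm_nonneg v
  have n4 := norm_nonneg Y
  have n5 := abs_nonneg κ₀
  have h5 : ‖v + κ₀ * Y‖ ^ 2 ≤ ‖v + κ₀ * y‖ ^ 2 +
      (2 * |κ₀| * (‖d‖ * ‖v‖) + 2 * |κ₀| ^ 2 * (‖d‖ * ‖y‖) + |κ₀| ^ 2 * ‖d‖ ^ 2) := by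
    have a1 : ‖v + κ₀ * Y‖ ^ 2 ≤ (‖v + κ₀ * y‖ + |κ₀| * ‖d‖) ^ 2 := by gcongr
    have a2 : (|κ₀| * ‖d‖) * ‖v + κ₀ * y‖ ≤ (|κ₀| * ‖d‖) * (‖v‖ + |κ₀| * ‖y‖) := by gcongr
    nlinarith
  have h7 : k ^ 2 * ‖y‖ ^ 2 ≤ k ^ 2 * ‖Y‖ ^ 2 + k ^ 2 * (2 * (‖d‖ * (‖y‖ + ‖d‖))) := by
    rw [← mul_add]
    gcongr
    nlinarith
  have b1 : 2 * |κ₀| * (‖d‖ * ‖v‖) ≤ (1 + κ₀ ^ 2) * (‖d‖ * ‖v‖) := by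
    gcongr; linarith
  have p1 : 0 ≤ ‖d‖ * ‖v‖ := by positivity
  have p2 : 0 ≤ ‖d‖ * ‖y‖ := by positivity
  have p3 : 0 ≤ ‖d‖ ^ 2 := by positivity
  have q1 : 0 ≤ κ₀ ^ 2 * (‖d‖ * ‖v‖) := by positivity
  have q2 : 0 ≤ k ^ 2 * (‖d‖ * ‖v‖) := by positivity
  have q3 : 0 ≤ κ₀ ^ 2 * (‖d‖ ^ 2) := by positivity
  rw [hκ2] at h5
  simp only [supply]
  nlinarith

variable {ι : Type*} [Countable ι] {E : Type*} [NormedAddCommGroup E] [NormedSpace ℂ E]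

/-- The uniform bound on partial sums of |s i t| makes the integrals of the absolute values
summable, so sum and integral may be exchanged. -/
theorem tsum_integral_nonpos {s : ι → ℝ → ℝ} {T m : ℝ} (hT : 0 ≤ T)
    (hs : ∀ i, ContinuousOn (s i) (Icc 0 T))
    (hm : ∀ t ∈ Icc 0 T, ∀ G : Finset ι, ∑ i ∈ G, |s i t| ≤ m)
    (h0 : ∀ t ∈ Icc 0 T, ∑' i, s i t ≤ 0) :
    (Summable fun i => ∫ t in (0 : ℝ)..T, s i t) ∧ ∑' i, ∫ t in (0 : ℝ)..T, s i t ≤ 0 := by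
  have hint : ∀ i, IntegrableOn (s i) (Ioc 0 T) := fun i =>
    ((hs i).integrableOn_compact isCompact_Icc).mono_set Ioc_subset_Icc_self
  have hsum : Summable fun i => ∫ t in Ioc 0 T, ‖s i t‖ := by
    refine summable_of_sum_le (c := T * m) (fun i => integral_nonneg fun t => norm_nonneg _)
      fun G => ?_
    rw [← integral_finsetSum _ fun i _ => (hint i).norm]
    calc ∫ t in Ioc 0 T, ∑ i ∈ G, ‖s i t‖ ≤ ∫ t in Ioc 0 T, m := by
          refine setIntegral_mono_on (integrable_finsetSum _ fun i _ => (hint i).norm)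
            (by simp) measurableSet_Ioc fun t ht => hm t ⟨ht.1.le, ht.2⟩ G
      _ = T * m := by simp [hT]
  have h := hasSum_integral_of_summable_integral_norm (μ := volume.restrict (Ioc 0 T)) hint hsum
  simp_rw [intervalIntegral.integral_of_le hT]
  refine ⟨h.summable, ?_⟩
  rw [h.tsum_eq]
  exact setIntegral_nonpos measurableSet_Ioc fun t ht => h0 t ⟨ht.1.le, ht.2⟩

theorem tsum_ite_mem_const (F : Finset ι) [DecidableEq ι] (a : ℝ) :
    (Summable fun i => if i ∈ F then a else 0) ∧ ∑' i, (if i ∈ F then a else 0) = F.card * a := by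
  have h : HasSum (fun i => if i ∈ F then a else 0) (∑ i ∈ F, if i ∈ F then a else 0) :=
    hasSum_sum_of_ne_finset_zero fun i hi => by simp [hi]
  refine ⟨h.summable, h.tsum_eq.trans ?_⟩
  rw [Finset.sum_congr rfl fun i hi => if_pos hi]
  simp

/-- Bound at time `T` in terms of an a priori bound `m` of the outputs up to time `T`. -/
theorem tsum_weight_le [DecidableEq ι] {F : Finset ι} {C κ₀ k : ℝ} (hC : 0 < C) {c : E →L[ℂ] ℂ}
    {z : ι → ℝ → E} {v : ι → ℝ → ℂ} {Y : ι → ℝ → ℂ} {T R m l : ℝ} (hT : 0 ≤ T)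
    (hz : ∀ i, ContinuousOn (z i) (Icc 0 T)) (hv : ∀ i, ContinuousOn (v i) (Icc 0 T))
    (hYc : ∀ i ∈ F, ContinuousOn (Y i) (Icc 0 T))
    (hY : ∀ i ∈ F, ‖Y i T‖ ^ 2 ≤ C * ∫ t in (0 : ℝ)..T, supply κ₀ k (Y i t) (v i t))
    (hd : ∀ i ∈ F, ∀ t ∈ Icc 0 T, ‖c (z i t) - Y i t‖ ≤ C * Real.exp (-t / C) * R)
    (hlarge : ∀ i ∉ F, ‖z i T‖ ^ 2 ≤
      ‖z i 0‖ ^ 2 + ∫ t in (0 : ℝ)..T, supply κ₀ k (c (z i t)) (v i t))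
    (hsz : ∀ t ∈ Icc 0 T, Summable fun i => ‖z i t‖ ^ 2)
    (hR0 : 0 ≤ R) (hR : ∑' i, ‖z i 0‖ ^ 2 ≤ R ^ 2)
    (hym : ∀ i, ∀ t ∈ Icc 0 T, ‖c (z i t)‖ ≤ m) (hvl : ∀ i, ∀ t ∈ Icc 0 T, ‖v i t‖ ≤ l)
    (hsum : Summable fun i => ∫ t in (0 : ℝ)..T, supply κ₀ k (c (z i t)) (v i t))
    (hnonpos : ∑' i, ∫ t in (0 : ℝ)..T, supply κ₀ k (c (z i t)) (v i t) ≤ 0) :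
    (Summable fun i => if i ∈ F then ‖Y i T‖ ^ 2 / C else ‖z i T‖ ^ 2) ∧
    ∑' i, (if i ∈ F then ‖Y i T‖ ^ 2 / C else ‖z i T‖ ^ 2) ≤
      R ^ 2 + F.card * (2 * (1 + κ₀ ^ 2 + k ^ 2) * C ^ 2 * R * (m + l + C * R)) := by
  set e := 2 * (1 + κ₀ ^ 2 + k ^ 2) * C ^ 2 * R * (m + l + C * R) with he
  have hTm : T ∈ Icc 0 T := ⟨hT, le_rfl⟩
  have h0m : (0 : ℝ) ∈ Icc 0 T := ⟨le_rfl, hT⟩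
  set w : ι → ℝ := fun i => if i ∈ F then ‖Y i T‖ ^ 2 / C else ‖z i T‖ ^ 2 with hw
  have hws : Summable w := by
    have hf : Summable fun i => if i ∈ F then ‖Y i T‖ ^ 2 / C else 0 :=
      summable_of_ne_finset_zero (s := F) fun i hi => by simp [hi]
    refine ((hsz T hTm).add hf).of_nonneg_of_le (fun i => ?_) fun i => ?_
    · simp only [hw]; split_ifs <;> positivity
    · simp only [hw]
      split_ifs
      · linarith [sq_nonneg ‖z i T‖]
      · linarith
  refine ⟨hws, ?_⟩
  -- Every mode pays its weight from the supply of its true output plus its initial energy. Low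
  -- modes also pay e, where one factor C comes from ∫ e^{−t/C} dt ≤ C.
  have hle : ∀ i, w i ≤ (∫ t in (0 : ℝ)..T, supply κ₀ k (c (z i t)) (v i t)) +
      (‖z i 0‖ ^ 2 + if i ∈ F then e else 0) := by
    intro i
    by_cases hi : i ∈ F
    · simp only [hw, if_pos hi]
      have hcz : ContinuousOn (fun t => c (z i t)) (Icc 0 T) :=
        c.continuous.comp_continuousOn (hz i)
      have hs1 := (continuousOn_supply (κ₀ := κ₀) (k := k) (hYc i hi) (hv i)).intervalIntegrable_of_Icc
        (μ := volume) hT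
      have hs2 := (continuousOn_supply (κ₀ := κ₀) (k := k) hcz (hv i)).intervalIntegrable_of_Icc
        (μ := volume) hT
      have he2 : IntervalIntegrable (fun t => (2 * (1 + κ₀ ^ 2 + k ^ 2) * C * R * (m + l + C * R)) *
          Real.exp (-(1 / C) * t)) volume 0 T := Continuous.intervalIntegrable (by fun_prop) _ _
      have hp : 0 ≤ 2 * (1 + κ₀ ^ 2 + k ^ 2) := by positivity
      have h1 := intervalIntegral.integral_mono_on hT hs1 (hs2.add he2) (fun t ht => by
        refine (supply_le_supply_add κ₀ k (c (z i t)) (Y i t) (v i t)).trans ?_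
        have hd1 := hd i hi t ht
        have hm0 := (norm_nonneg _).trans (hym i t ht)
        have hl0 := (norm_nonneg _).trans (hvl i t ht)
        have hd2 : ‖c (z i t) - Y i t‖ ≤ C * R := by
          refine hd1.trans ?_
          have : Real.exp (-t / C) ≤ 1 :=
            Real.exp_le_one_iff.2 (div_nonpos_of_nonpos_of_nonneg (by linarith [ht.1]) hC.le)
          gcongr
          nlinarith
        have e1 : -(1 / C) * t = -t / C := by ring
        rw [e1]
        have : ‖c (z i t) - Y i t‖ * (‖c (z i t)‖ + ‖v i t‖ + ‖c (z i t) - Y i t‖) ≤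
            (C * Real.exp (-t / C) * R) * (m + l + C * R) := by
          gcongr
          · exact hym i t ht
          · exact hvl i t ht
        have := mul_le_mul_of_nonneg_left this hp
        have e2 : 2 * (1 + κ₀ ^ 2 + k ^ 2) * ((C * Real.exp (-t / C) * R) * (m + l + C * R)) =
          2 * (1 + κ₀ ^ 2 + k ^ 2) * C * R * (m + l + C * R) * Real.exp (-t / C) := by ring
        rw [e2] at this
        linarith)
      rw [intervalIntegral.integral_add hs2 he2, intervalIntegral.integral_const_mul] at h1
      have hm0 := (norm_nonneg _).trans (hym i T hTm)
      have hl0 := (norm_nonneg _).trans (hvl i T hTm)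
      have h2 : 2 * (1 + κ₀ ^ 2 + k ^ 2) * C * R * (m + l + C * R) *
          ∫ t in (0 : ℝ)..T, Real.exp (-(1 / C) * t) ≤ e := by
        have := integral_exp_neg_le (δ := 1 / C) (by positivity) (T := T)
        rw [one_div_one_div] at this
        calc _ ≤ 2 * (1 + κ₀ ^ 2 + k ^ 2) * C * R * (m + l + C * R) * C := by gcongr
          _ = e := by rw [he]; ring
      have h3 := hY i hi
      rw [div_le_iff₀' hC]
      refine h3.trans ?_
      gcongr
      have := sq_nonneg ‖z i 0‖
      linarith
    · simp only [hw, if_neg hi, add_zero]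
      linarith [hlarge i hi]
  obtain ⟨hes, het⟩ := tsum_ite_mem_const F e
  calc ∑' i, w i ≤ ∑' i, ((∫ t in (0 : ℝ)..T, supply κ₀ k (c (z i t)) (v i t)) +
      (‖z i 0‖ ^ 2 + if i ∈ F then e else 0)) :=
        hws.tsum_le_tsum hle (hsum.add ((hsz 0 h0m).add hes))
    _ = (∑' i, ∫ t in (0 : ℝ)..T, supply κ₀ k (c (z i t)) (v i t)) +
        (∑' i, ‖z i 0‖ ^ 2 + F.card * e) := by
      rw [hsum.tsum_add ((hsz 0 h0m).add hes), (hsz 0 h0m).tsum_add hes, het]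
    _ ≤ _ := by linarith

theorem summable_norm_sq_clm {y : ι → E} (c : E →L[ℂ] ℂ) (h : Summable fun i => ‖y i‖ ^ 2) :
    (Summable fun i => ‖c (y i)‖ ^ 2) ∧ ∑' i, ‖c (y i)‖ ^ 2 ≤ ‖c‖ ^ 2 * ∑' i, ‖y i‖ ^ 2 := by
  have hle : ∀ i, ‖c (y i)‖ ^ 2 ≤ ‖c‖ ^ 2 * ‖y i‖ ^ 2 := fun i => by
    rw [← mul_pow]; gcongr; exact c.le_opNorm _
  have hs := (h.mul_left (‖c‖ ^ 2)).of_nonneg_of_le (fun i => sq_nonneg _) hle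
  exact ⟨hs, by rw [← h.tsum_mul_left]; exact hs.tsum_le_tsum hle (h.mul_left _)⟩

theorem norm_sq_le_of_add (κ₀ : ℝ) (y v : ℂ) :
    ‖v‖ ^ 2 ≤ 2 * ‖v + κ₀ * y‖ ^ 2 + 2 * κ₀ ^ 2 * ‖y‖ ^ 2 := by
  have h : ‖v‖ ≤ ‖v + κ₀ * y‖ + |κ₀| * ‖y‖ := by
    calc ‖v‖ = ‖(v + κ₀ * y) - κ₀ * y‖ := by congr 1; ring
      _ ≤ _ := (norm_sub_le _ _).trans (by rw [norm_mul, Complex.norm_real, norm_eq_abs])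
  have h2 : ‖v‖ ^ 2 ≤ (‖v + κ₀ * y‖ + |κ₀| * ‖y‖) ^ 2 := by gcongr
  have h3 := add_sq_le (a := ‖v + κ₀ * y‖) (b := |κ₀| * ‖y‖)
  rw [mul_pow, sq_abs] at h3
  linarith

theorem norm_add_mul_sq_le (κ₀ : ℝ) (y v : ℂ) :
    ‖v + κ₀ * y‖ ^ 2 ≤ 2 * ‖v‖ ^ 2 + 2 * κ₀ ^ 2 * ‖y‖ ^ 2 := by
  have h : ‖v + κ₀ * y‖ ≤ ‖v‖ + |κ₀| * ‖y‖ :=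
    (norm_add_le _ _).trans (by rw [norm_mul, Complex.norm_real, norm_eq_abs])
  have h2 : ‖v + κ₀ * y‖ ^ 2 ≤ (‖v‖ + |κ₀| * ‖y‖) ^ 2 := by gcongr
  have h3 := add_sq_le (a := ‖v‖) (b := |κ₀| * ‖y‖)
  rw [mul_pow, sq_abs] at h3
  linarith

/-- Young's inequality moves βRm to the left. This turns the a priori finite supremum m into a bound
linear in the initial norm R. -/
theorem le_sqrt_mul_of_sq_le {m α β R : ℝ} (hα : 0 ≤ α) (hR : 0 ≤ R)
    (h : m ^ 2 ≤ α * R ^ 2 + β * (R * m)) : m ≤ √(2 * α + β ^ 2) * R := by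
  have h1 : m ^ 2 ≤ (2 * α + β ^ 2) * R ^ 2 := by
    have h2 : (m - β * R) ^ 2 = m ^ 2 - 2 * (β * (R * m)) + β ^ 2 * R ^ 2 := by ring
    have h3 := sq_nonneg (m - β * R)
    rw [add_mul]
    linarith
  have h3 : √(2 * α + β ^ 2) * R = √((2 * α + β ^ 2) * R ^ 2) := by
    rw [Real.sqrt_mul (by positivity), Real.sqrt_sq hR]
  rw [h3]
  exact Real.le_sqrt_of_sq_le h1

set_option maxHeartbeats 800000 in
/-- Square-summable families of modes coupled through a sector condition, finitely many of which
dissipate up to a decaying error while the others dissipate exactly, are uniformly bounded. -/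
theorem exists_tsum_norm_sq_le [DecidableEq ι] (F : Finset ι) {C : ℝ} (hC : 0 < C) (κ₀ k : ℝ)
    (c : E →L[ℂ] ℂ) :
    ∃ M > 0, ∀ (z : ι → ℝ → E) (v : ι → ℝ → ℂ),
      (∀ i, ContinuousOn (z i) (Ici 0)) → (∀ i, ContinuousOn (v i) (Ici 0)) →
      (∀ i ∈ F, IsDissipativeUpToDecay C κ₀ k c (z i) (v i)) →
      (∀ i ∉ F, ∀ T, 0 ≤ T → ‖z i T‖ ^ 2 ≤
        ‖z i 0‖ ^ 2 + ∫ t in (0 : ℝ)..T, supply κ₀ k (c (z i t)) (v i t)) →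
      (∀ t, 0 ≤ t → Summable fun i => ‖z i t‖ ^ 2) →
      (∀ t, 0 ≤ t → Summable fun i => ‖v i t‖ ^ 2) →
      (∀ T, ∃ m, ∀ t ∈ Icc 0 T, ∑' i, ‖z i t‖ ^ 2 ≤ m) →
      (∀ t, 0 ≤ t → ∑' i, ‖v i t + κ₀ * c (z i t)‖ ^ 2 ≤ k ^ 2 * ∑' i, ‖c (z i t)‖ ^ 2) →
      ∀ T, 0 ≤ T → ∑' i, ‖z i T‖ ^ 2 ≤ M * ∑' i, ‖z i 0‖ ^ 2 := by
  set N : ℝ := (F.card : ℝ) with hN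
  have hN0 : 0 ≤ N := Nat.cast_nonneg _
  set Λ := 2 * (k ^ 2 + κ₀ ^ 2) with hΛ
  have hΛ0 : 0 ≤ Λ := by positivity
  set L := √Λ with hL
  have hL0 : 0 ≤ L := Real.sqrt_nonneg _
  set K := 2 * (1 + κ₀ ^ 2 + k ^ 2) * C ^ 2 with hK
  have hK0 : 0 ≤ K := by positivity
  set K₃ := 2 * C + ‖c‖ ^ 2 with hK₃
  have hK₃0 : 0 ≤ K₃ := by positivity
  set α := K₃ * (1 + N * K * C) + 2 * C ^ 2 with hα
  have hα0 : 0 ≤ α := by positivity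
  set β := K₃ * N * K * (1 + L) with hβ
  have hβ0 : 0 ≤ β := by positivity
  set γ := √(2 * α + β ^ 2) with hγ
  have hγ0 : 0 ≤ γ := Real.sqrt_nonneg _
  refine ⟨1 + N * K * ((1 + L) * γ + C) + N * C ^ 2 * (1 + L * γ) ^ 2, by positivity, ?_⟩
  intro z v hz hv hF hlarge hsz hsv hbdd hsec T hT
  have hsy := fun t (ht : 0 ≤ t) => summable_norm_sq_clm c (hsz t ht)
  set q : ℝ → ℝ := fun t => ∑' i, ‖c (z i t)‖ ^ 2 with hq
  have hcz : ∀ i, ContinuousOn (fun t => c (z i t)) (Ici 0) := fun i =>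
    c.continuous.comp_continuousOn (hz i)
  have hswsum : ∀ t, 0 ≤ t → Summable fun i => ‖v i t + κ₀ * c (z i t)‖ ^ 2 := fun t ht =>
    (((hsv t ht).mul_left 2).add ((hsy t ht).1.mul_left (2 * κ₀ ^ 2))).of_nonneg_of_le
      (fun i => sq_nonneg _) fun i => norm_add_mul_sq_le _ _ _
  have hvq : ∀ t, 0 ≤ t → ∑' i, ‖v i t‖ ^ 2 ≤ Λ * q t := by
    intro t ht
    have h1 := (hsv t ht).tsum_le_tsum (fun i => norm_sq_le_of_add κ₀ (c (z i t)) (v i t))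
      (((hswsum t ht).mul_left 2).add ((hsy t ht).1.mul_left (2 * κ₀ ^ 2)))
    rw [((hswsum t ht).mul_left 2).tsum_add ((hsy t ht).1.mul_left (2 * κ₀ ^ 2)),
      (hswsum t ht).tsum_mul_left, (hsy t ht).1.tsum_mul_left] at h1
    have h2 := hsec t ht
    rw [hΛ]
    nlinarith
  -- a priori bound of the outputs on `[0, T]`
  obtain ⟨B, hB⟩ := hbdd T
  have hqB : ∀ t ∈ Icc 0 T, q t ≤ ‖c‖ ^ 2 * B := fun t ht =>
    (hsy t ht.1).2.trans (by gcongr; exact hB t ht)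
  -- The local bound on the states only makes this supremum finite; its size does not enter the
  -- final constant.
  set S := sSup (q '' Icc 0 T) with hS
  have hqS : ∀ t ∈ Icc 0 T, q t ≤ S := fun t ht =>
    le_csSup ⟨_, by rintro _ ⟨t, ht, rfl⟩; exact hqB t ht⟩ ⟨t, ht, rfl⟩
  have hS0 : 0 ≤ S := (tsum_nonneg fun i => sq_nonneg _).trans (hqS 0 ⟨le_rfl, hT⟩)
  set m := √S with hm
  have hm0 : 0 ≤ m := Real.sqrt_nonneg _
  have hm2 : m ^ 2 = S := Real.sq_sqrt hS0
  have hym : ∀ i, ∀ t ∈ Icc 0 T, ‖c (z i t)‖ ≤ m := fun i t ht =>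
    Real.le_sqrt_of_sq_le (((hsy t ht.1).1.le_tsum i fun j _ => sq_nonneg _).trans (hqS t ht))
  have hvl : ∀ i, ∀ t ∈ Icc 0 T, ‖v i t‖ ≤ L * m := fun i t ht => by
    rw [hL, hm, ← Real.sqrt_mul hΛ0]
    refine Real.le_sqrt_of_sq_le (((hsv t ht.1).le_tsum i fun j _ => sq_nonneg _).trans
      ((hvq t ht.1).trans ?_))
    gcongr
    exact hqS t ht
  set R := √(∑' i, ‖z i 0‖ ^ 2) with hR
  have hR0 : 0 ≤ R := Real.sqrt_nonneg _
  have hR2 : R ^ 2 = ∑' i, ‖z i 0‖ ^ 2 := Real.sq_sqrt (tsum_nonneg fun i => sq_nonneg _)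
  have hzR : ∀ i, ‖z i 0‖ ≤ R := fun i =>
    Real.le_sqrt_of_sq_le ((hsz 0 le_rfl).le_tsum i fun j _ => sq_nonneg _)
  have hYex : ∀ i, ∃ Y : ℝ → ℂ, i ∈ F → ContinuousOn Y (Ici 0) ∧
      (∀ T, 0 ≤ T → ‖Y T‖ ^ 2 ≤ C * ∫ t in (0 : ℝ)..T, supply κ₀ k (Y t) (v i t)) ∧
      ∀ t, 0 ≤ t → ‖c (z i t) - Y t‖ ≤ C * Real.exp (-t / C) * ‖z i 0‖ := fun i => by
    by_cases hi : i ∈ F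
    · obtain ⟨Y, hY⟩ := (hF i hi).1
      exact ⟨Y, fun _ => hY⟩
    · exact ⟨0, fun h => absurd h hi⟩
  choose Y hY using hYex
  set Bd := R ^ 2 + N * (K * R * (m + L * m + C * R)) with hBd
  have hdR : ∀ i ∈ F, ∀ t, 0 ≤ t → ‖c (z i t) - Y i t‖ ≤ C * Real.exp (-t / C) * R :=
    fun i hi t ht => ((hY i hi).2.2 t ht).trans (by gcongr; exact hzR i)
  have hstep : ∀ t ∈ Icc 0 T,
      (Summable fun i => if i ∈ F then ‖Y i t‖ ^ 2 / C else ‖z i t‖ ^ 2) ∧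
      ∑' i, (if i ∈ F then ‖Y i t‖ ^ 2 / C else ‖z i t‖ ^ 2) ≤ Bd := by
    intro t ht
    have hsub : Icc 0 t ⊆ Icc 0 T := Icc_subset_Icc_right ht.2
    have hsub' : Icc 0 t ⊆ Ici 0 := Icc_subset_Ici_self
    obtain ⟨hsum, hnon⟩ := tsum_integral_nonpos
      (s := fun i t => supply κ₀ k (c (z i t)) (v i t)) (T := t)
      (m := (k ^ 2 + k ^ 2) * S) ht.1
      (fun i => continuousOn_supply ((hcz i).mono hsub') ((hv i).mono hsub'))
      (fun s hs G => by
        have h1 : ∀ i, |supply κ₀ k (c (z i s)) (v i s)| ≤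
            ‖v i s + κ₀ * c (z i s)‖ ^ 2 + k ^ 2 * ‖c (z i s)‖ ^ 2 := fun i => by
          rw [supply, abs_le]
          have a1 : 0 ≤ k ^ 2 * ‖c (z i s)‖ ^ 2 := by positivity
          have a2 : 0 ≤ ‖v i s + κ₀ * c (z i s)‖ ^ 2 := by positivity
          constructor <;> linarith
        have h2 := ((hswsum s hs.1).add ((hsy s hs.1).1.mul_left (k ^ 2))).sum_le_tsum G
          (fun i _ => by positivity)
        rw [(hswsum s hs.1).tsum_add ((hsy s hs.1).1.mul_left (k ^ 2)),
          (hsy s hs.1).1.tsum_mul_left] at h2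
        refine (Finset.sum_le_sum fun i _ => h1 i).trans (h2.trans ?_)
        have h3 := hsec s hs.1
        have h4 := mul_le_mul_of_nonneg_left (hqS s (hsub hs)) (sq_nonneg k)
        have h5 : ∑' i, ‖c (z i s)‖ ^ 2 = q s := rfl
        rw [h5] at h3 ⊢
        linarith)
      (fun s hs => by
        simp only [supply]
        rw [(hswsum s hs.1).tsum_sub ((hsy s hs.1).1.mul_left (k ^ 2)),
          (hsy s hs.1).1.tsum_mul_left]
        linarith [hsec s hs.1])
    exact tsum_weight_le hC ht.1 (fun i => (hz i).mono hsub') (fun i => (hv i).mono hsub')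
      (fun i hi => (hY i hi).1.mono hsub') (fun i hi => (hY i hi).2.1 t ht.1)
      (fun i hi s hs => hdR i hi s hs.1) (fun i hi => hlarge i hi t ht.1)
      (fun s hs => hsz s hs.1) hR0 hR2.ge (fun i s hs => hym i s (hsub hs))
      (fun i s hs => hvl i s (hsub hs)) hsum hnon
  -- The weights at t control the outputs, up to the initial error of the low modes. The bound still
  -- contains m, but only multiplied by R.
  have hqle : ∀ t ∈ Icc 0 T, q t ≤ α * R ^ 2 + β * (R * m) := by
    intro t ht
    obtain ⟨hs, hle⟩ := hstep t ht
    have h1 : ∀ i, ‖c (z i t)‖ ^ 2 ≤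
        K₃ * (if i ∈ F then ‖Y i t‖ ^ 2 / C else ‖z i t‖ ^ 2) + 2 * C ^ 2 * ‖z i 0‖ ^ 2 := by
      intro i
      by_cases hi : i ∈ F
      · simp only [if_pos hi]
        have a1 : ‖c (z i t)‖ ≤ ‖Y i t‖ + C * ‖z i 0‖ := by
          have e1 : c (z i t) = Y i t + (c (z i t) - Y i t) := by ring
          have e2 : Real.exp (-t / C) ≤ 1 :=
            Real.exp_le_one_iff.2 (div_nonpos_of_nonpos_of_nonneg (by linarith [ht.1]) hC.le)
          have e3 := (hY i hi).2.2 t ht.1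
          have e4 : C * Real.exp (-t / C) * ‖z i 0‖ ≤ C * 1 * ‖z i 0‖ := by gcongr
          calc ‖c (z i t)‖ = ‖Y i t + (c (z i t) - Y i t)‖ := by rw [← e1]
            _ ≤ ‖Y i t‖ + ‖c (z i t) - Y i t‖ := norm_add_le _ _
            _ ≤ _ := by linarith
        have a2 : ‖c (z i t)‖ ^ 2 ≤ (‖Y i t‖ + C * ‖z i 0‖) ^ 2 := by gcongr
        have a3 := add_sq_le (a := ‖Y i t‖) (b := C * ‖z i 0‖)
        have a4 : 2 * ‖Y i t‖ ^ 2 ≤ K₃ * (‖Y i t‖ ^ 2 / C) := by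
          calc 2 * ‖Y i t‖ ^ 2 = 2 * C * (‖Y i t‖ ^ 2 / C) := by field_simp
            _ ≤ _ := by
              gcongr
              rw [hK₃]
              linarith [sq_nonneg ‖c‖]
        rw [mul_pow] at a3
        linarith
      · simp only [if_neg hi]
        have a1 : ‖c (z i t)‖ ^ 2 ≤ ‖c‖ ^ 2 * ‖z i t‖ ^ 2 := by
          rw [← mul_pow]; gcongr; exact c.le_opNorm _
        have a2 : 0 ≤ 2 * C ^ 2 * ‖z i 0‖ ^ 2 := by positivity
        have a3 : 0 ≤ 2 * C * ‖z i t‖ ^ 2 := by positivity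
        rw [hK₃, add_mul]
        linarith
    have h2 := (hsy t ht.1).1.tsum_le_tsum h1
      ((hs.mul_left _).add ((hsz 0 le_rfl).mul_left _))
    rw [(hs.mul_left _).tsum_add ((hsz 0 le_rfl).mul_left _), hs.tsum_mul_left,
      (hsz 0 le_rfl).tsum_mul_left, ← hR2] at h2
    have h3 := mul_le_mul_of_nonneg_left hle hK₃0
    refine h2.trans ((add_le_add_left h3 _).trans (le_of_eq ?_))
    rw [hBd, hα, hβ]
    ring
  have hmR : m ≤ γ * R := by
    have h1 : S ≤ α * R ^ 2 + β * (R * m) :=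
      csSup_le ⟨_, 0, ⟨le_rfl, hT⟩, rfl⟩ (by rintro _ ⟨t, ht, rfl⟩; exact hqle t ht)
    rw [← hm2] at h1
    exact le_sqrt_mul_of_sq_le hα0 hR0 h1
  have hTT : T ∈ Icc 0 T := ⟨hT, le_rfl⟩
  obtain ⟨hs, hle⟩ := hstep T hTT
  have hLm : 0 ≤ L * m := by positivity
  -- The weights of low modes see outputs only. Their states are recovered from the input bound Lm
  -- by stability.
  have hfin : ∀ i, ‖z i T‖ ^ 2 ≤ (if i ∈ F then ‖Y i T‖ ^ 2 / C else ‖z i T‖ ^ 2) +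
      (if i ∈ F then (C * (R + L * m)) ^ 2 else 0) := by
    intro i
    by_cases hi : i ∈ F
    · simp only [if_pos hi]
      have a1 := (hF i hi).2 T hT (L * m) fun t ht => hvl i t ht
      have a2 : ‖z i T‖ ≤ C * (R + L * m) := a1.trans (by gcongr; exact hzR i)
      have a3 : ‖z i T‖ ^ 2 ≤ (C * (R + L * m)) ^ 2 := by gcongr
      have a4 : 0 ≤ ‖Y i T‖ ^ 2 / C := by positivity
      linarith
    · simp [if_neg hi]
  obtain ⟨hes, het⟩ := tsum_ite_mem_const F ((C * (R + L * m)) ^ 2)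
  have h1 := (hsz T hT).tsum_le_tsum hfin (hs.add hes)
  rw [hs.tsum_add hes, het] at h1
  rw [← hR2]
  calc ∑' i, ‖z i T‖ ^ 2 ≤ Bd + N * (C * (R + L * m)) ^ 2 := by linarith
    _ ≤ (R ^ 2 + N * (K * R * ((γ * R) + L * (γ * R) + C * R))) +
        N * (C * (R + L * (γ * R))) ^ 2 := by
      rw [hBd]; gcongr
    _ = _ := by ring

end Interconnection

/-! ### The argument principle for characteristic polynomials and the Nyquist criterion. -/

section Nyquist

/-- The curve `f` avoids zero, has a continuous argument with limits at both ends, and the total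
increase of that argument is `d`. -/
def HasArgIncrease (f : ℝ → ℂ) (d : ℝ) : Prop :=
  ∃ α : ℝ → ℝ, Continuous α ∧
    (∀ τ, f τ ≠ 0 ∧ f τ = (‖f τ‖ : ℂ) * Complex.exp (α τ * Complex.I)) ∧
    ∃ a b : ℝ, Tendsto α atBot (𝓝 a) ∧ Tendsto α atTop (𝓝 b) ∧ b - a = d

theorem HasWindingNumber.hasArgIncrease {γ : ℝ → ℂ} {c : ℂ} {k : ℤ} (h : HasWindingNumber γ c k) :
    HasArgIncrease (fun τ => γ τ - c) (2 * π * k) := by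
  obtain ⟨α, hα, h, hl⟩ := h
  exact ⟨α, hα, fun τ => ⟨sub_ne_zero.2 (h τ).1, (h τ).2⟩, hl⟩

theorem HasArgIncrease.mul {f g : ℝ → ℂ} {d e : ℝ} (hf : HasArgIncrease f d)
    (hg : HasArgIncrease g e) : HasArgIncrease (fun τ => f τ * g τ) (d + e) := by
  obtain ⟨α, hα, hf, a, b, ha, hb, hab⟩ := hf
  obtain ⟨β, hβ, hg, a', b', ha', hb', hab'⟩ := hg
  refine ⟨fun τ => α τ + β τ, hα.add hβ, fun τ => ⟨mul_ne_zero (hf τ).1 (hg τ).1, ?_⟩, a + a',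
    b + b', ha.add ha', hb.add hb', by linarith⟩
  refine (congrArg₂ (· * ·) (hf τ).2 (hg τ).2).trans ?_
  rw [norm_mul]
  push_cast
  rw [add_mul, Complex.exp_add]
  ring

theorem hasArgIncrease_const {c : ℂ} (hc : c ≠ 0) : HasArgIncrease (fun _ => c) 0 :=
  ⟨fun _ => c.arg, continuous_const, fun _ => ⟨hc, (Complex.norm_mul_exp_arg_mul_I c).symm⟩,
    c.arg, c.arg, tendsto_const_nhds, tendsto_const_nhds, sub_self _⟩

/-- Two continuous arguments differ by a continuous function with values in 2πℤ, which is constant.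
-/
theorem HasArgIncrease.unique {f : ℝ → ℂ} {d e : ℝ} (hd : HasArgIncrease f d)
    (he : HasArgIncrease f e) : d = e := by
  obtain ⟨α, hα, hf, a, b, ha, hb, hab⟩ := hd
  obtain ⟨β, hβ, hg, a', b', ha', hb', hab'⟩ := he
  have hint : ∀ τ, (α τ - β τ) / (2 * π) ∈ range ((↑) : ℤ → ℝ) := by
    intro τ
    have h1 : (‖f τ‖ : ℂ) ≠ 0 := by simpa using (hf τ).1
    have h2 := mul_left_cancel₀ h1 ((hf τ).2.symm.trans (hg τ).2)
    obtain ⟨n, hn⟩ := Complex.exp_eq_exp_iff_exists_int.1 h2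
    have h3 := congrArg Complex.im hn
    simp only [Complex.mul_im, Complex.ofReal_re, Complex.I_im, mul_one, Complex.ofReal_im,
      Complex.I_re, mul_zero, add_zero, Complex.add_im, Complex.intCast_re, Complex.intCast_im,
      Complex.mul_re, Complex.re_ofNat, Complex.im_ofNat, sub_zero, zero_mul] at h3
    refine ⟨n, ?_⟩
    field_simp
    linarith
  have hT : DiscreteTopology (range ((↑) : ℤ → ℝ)) :=
    (Int.isClosedEmbedding_coe_real.isEmbedding.toHomeomorph.symm.isEmbedding).discreteTopology
  have hconst := isPreconnected_univ.eqOn_const_of_mapsTo (T := range ((↑) : ℤ → ℝ))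
    (f := fun τ => (α τ - β τ) / (2 * π)) ⟨hT⟩ ((hα.sub hβ).div_const _).continuousOn
    (fun τ _ => hint τ) ⟨_, hint 0⟩
  obtain ⟨y, -, hy⟩ := hconst
  have hy' : (fun τ => (α τ - β τ) / (2 * π)) = fun _ => y := funext fun τ => hy (mem_univ τ)
  have l1 := (ha.sub ha').div_const (2 * π)
  have l2 := (hb.sub hb').div_const (2 * π)
  rw [hy'] at l1 l2
  have e1 := tendsto_nhds_unique l1 tendsto_const_nhds
  have e2 := tendsto_nhds_unique l2 tendsto_const_nhds
  rw [← e2] at e1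
  field_simp at e1
  linarith

/-- The curve is a vertical line in the right half-plane, where the argument is an arctangent and
runs from −π/2 to π/2. -/
theorem hasArgIncrease_of_re_neg {s : ℂ} (hs : s.re < 0) :
    HasArgIncrease (fun τ => Complex.I * τ - s) π := by
  have hd : 0 < -s.re := by linarith
  have key : ∀ τ : ℝ, (Complex.I * τ - s).re = -s.re ∧ (Complex.I * τ - s).im = τ - s.im := by
    intro τ; simp
  refine ⟨fun τ => Real.arctan ((τ - s.im) / -s.re), by fun_prop, fun τ => ⟨?_, ?_⟩, -(π / 2),
    π / 2, ?_, ?_, by ring⟩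
  · intro h
    have := (key τ).1
    rw [show Complex.I * τ - s = 0 from h] at this
    simp at this
    linarith
  · have h1 : Complex.arg (Complex.I * τ - s) = Real.arctan ((τ - s.im) / -s.re) := by
      rw [← (key τ).1, ← (key τ).2, ← Complex.tan_arg, Real.arctan_tan]
      · exact Complex.neg_pi_div_two_lt_arg_iff.2 (Or.inl (by rw [(key τ).1]; exact hd))
      · exact Complex.arg_lt_pi_div_two_iff.2 (Or.inl (by rw [(key τ).1]; exact hd))
    beta_reduce
    rw [← h1]
    exact (Complex.norm_mul_exp_arg_mul_I _).symm
  · refine (tendsto_nhds_of_tendsto_nhdsWithin tendsto_arctan_atBot).comp ?_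
    exact (tendsto_atBot_add_const_right _ (-s.im) tendsto_id).atBot_div_const hd
  · refine (tendsto_nhds_of_tendsto_nhdsWithin tendsto_arctan_atTop).comp ?_
    exact (tendsto_atTop_add_const_right _ (-s.im) tendsto_id).atTop_div_const hd

theorem HasArgIncrease.conj {f : ℝ → ℂ} {d : ℝ} (h : HasArgIncrease f d) :
    HasArgIncrease (fun τ => (starRingEnd ℂ) (f τ)) (-d) := by
  obtain ⟨α, hα, hf, a, b, ha, hb, hab⟩ := h
  refine ⟨fun τ => -α τ, hα.neg, fun τ => ⟨by simpa using (hf τ).1, ?_⟩, -a, -b, ha.neg, hb.neg,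
    by linarith⟩
  refine (congrArg (starRingEnd ℂ) (hf τ).2).trans ?_
  rw [RCLike.norm_conj, map_mul, Complex.conj_ofReal, ← Complex.exp_conj, map_mul, Complex.conj_ofReal,
    Complex.conj_I]
  push_cast
  ring_nf

/-- Reflecting in the imaginary axis reduces to a root on the left and reverses the sign of the
increase. -/
theorem hasArgIncrease_of_re_pos {s : ℂ} (hs : 0 < s.re) :
    HasArgIncrease (fun τ => Complex.I * τ - s) (-π) := by
  have h1 := (hasArgIncrease_of_re_neg (s := -(starRingEnd ℂ) s) (by simpa using hs)).conj
  have h2 := h1.mul (hasArgIncrease_const (c := -1) (by norm_num))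
  rw [add_zero] at h2
  convert h2 using 2 with τ
  simp
  ring

/-- Each root on the left contributes π and each root on the right −π, so the total increase counts
the roots on the right. -/
theorem hasArgIncrease_multiset_prod (S : Multiset ℂ) (hS : ∀ s ∈ S, s.re ≠ 0) :
    HasArgIncrease (fun τ => (S.map fun s => Complex.I * τ - s).prod)
      (π * (S.card : ℝ) - 2 * π * ((S.filter fun s => 0 < s.re).card : ℝ)) := by
  induction S using Multiset.induction_on with
  | empty => simpa using hasArgIncrease_const one_ne_zero
  | cons s S ih =>
    have ih := ih fun s hs => hS s (Multiset.mem_cons_of_mem hs)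
    simp only [Multiset.map_cons, Multiset.prod_cons, Multiset.card_cons, Nat.cast_add,
      Nat.cast_one]
    rcases lt_or_gt_of_ne (hS s (Multiset.mem_cons_self s S)) with h | h
    · rw [Multiset.filter_cons_of_neg (p := fun s : ℂ => 0 < s.re) _ (not_lt.2 h.le)]
      convert (hasArgIncrease_of_re_neg h).mul ih using 1
      ring
    · rw [Multiset.filter_cons_of_pos (p := fun s : ℂ => 0 < s.re) _ h]
      convert (hasArgIncrease_of_re_pos h).mul ih using 1
      rw [Multiset.card_cons]
      push_cast
      ring

variable {n : ℕ}

theorem eval_charpoly_eq_det (M : Matrix (Fin n) (Fin n) ℂ) (s : ℂ) :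
    M.charpoly.eval s = (s • (1 : Matrix (Fin n) (Fin n) ℂ) - M).det := by
  rw [Matrix.eval_charpoly, Matrix.smul_one_eq_diagonal, Matrix.scalar_apply]

theorem eval_charpoly_eq_zero_iff (M : Matrix (Fin n) (Fin n) ℂ) (s : ℂ) :
    M.charpoly.eval s = 0 ↔ ∃ x ≠ 0, M *ᵥ x = s • x := by
  rw [eval_charpoly_eq_det, ← Matrix.exists_mulVec_eq_zero_iff]
  refine exists_congr fun x => and_congr_right fun _ => ?_
  rw [Matrix.sub_mulVec, Matrix.smul_mulVec, Matrix.one_mulVec, sub_eq_zero, eq_comm]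

theorem hasArgIncrease_charpoly (M : Matrix (Fin n) (Fin n) ℂ)
    (hM : ∀ τ : ℝ, M.charpoly.eval (Complex.I * τ) ≠ 0) :
    HasArgIncrease (fun τ => M.charpoly.eval (Complex.I * τ))
      (π * n - 2 * π * ((M.charpoly.roots.filter fun s => 0 < s.re).card : ℝ)) := by
  have h := hasArgIncrease_multiset_prod M.charpoly.roots fun s hs h0 => by
    refine hM s.im ?_
    have : Complex.I * (s.im : ℂ) = s := by
      apply Complex.ext <;> simp [h0]
    rw [this]
    exact (Polynomial.mem_roots'.1 hs).2
  rw [IsAlgClosed.card_roots_eq_natDegree, Matrix.charpoly_natDegree_eq_dim, Fintype.card_fin] at h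
  convert h using 2 with τ
  exact (IsAlgClosed.splits _).eval_eq_prod_roots_of_monic M.charpoly_monic _

/-- The matrix determinant lemma: factor out S and evaluate the determinant of a rank-one
perturbation of the identity. -/
theorem det_add_smul_vecMulVec (S : Matrix (Fin n) (Fin n) ℂ) (hS : S.det ≠ 0) (κ : ℂ)
    (B C : Fin n → ℂ) :
    (S + κ • Matrix.vecMulVec B C).det = S.det * (1 + κ * (C ⬝ᵥ (S⁻¹ *ᵥ B))) := by
  have h1 : S + κ • Matrix.vecMulVec B C =
      S * (1 + Matrix.replicateCol Unit (κ • (S⁻¹ *ᵥ B)) * Matrix.replicateRow Unit C) := by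
    rw [mul_add, mul_one, ← Matrix.vecMulVec_eq, Matrix.smul_vecMulVec, Matrix.mul_smul,
      Matrix.mul_vecMulVec, Matrix.mulVec_mulVec, Matrix.mul_nonsing_inv _ (Ne.isUnit hS),
      Matrix.one_mulVec]
  rw [h1, Matrix.det_mul, Matrix.det_one_add_replicateCol_mul_replicateRow, dotProduct_smul,
    smul_eq_mul]

/-- The Nyquist criterion for output feedback with gain `κ` around a stable system. -/
theorem nyquist_criterion {M : Matrix (Fin n) (Fin n) ℂ} {B C : Fin n → ℂ} {κ : ℝ} (hκ : κ ≠ 0)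
    (hM : ∀ (s : ℂ) x, x ≠ 0 → M *ᵥ x = s • x → s.re < 0)
    (hw : HasWindingNumber (fun τ : ℝ =>
      C ⬝ᵥ (((Complex.I * τ) • (1 : Matrix (Fin n) (Fin n) ℂ) - M)⁻¹ *ᵥ B)) (-1 / κ : ℝ) 0)
    (s : ℂ) (x : Fin n → ℂ) (hx : x ≠ 0)
    (hs : (M - (κ : ℂ) • Matrix.vecMulVec B C) *ᵥ x = s • x) : s.re < 0 := by
  have hκ' : (κ : ℂ) ≠ 0 := by exact_mod_cast hκ
  have hMroot : ∀ s, M.charpoly.eval s = 0 → s.re < 0 := fun s h => by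
    obtain ⟨x, hx, h⟩ := (eval_charpoly_eq_zero_iff M s).1 h
    exact hM s x hx h
  have hp : ∀ τ : ℝ, M.charpoly.eval (Complex.I * τ) ≠ 0 := fun τ h => by
    have := hMroot _ h
    simp at this
  set M' := M - (κ : ℂ) • Matrix.vecMulVec B C with hM'
  -- The closed-loop polynomial is the open-loop one times κ(G − (−1/κ)), whose argument increase is
  -- the given winding number, zero.
  have hq : ∀ τ : ℝ, M'.charpoly.eval (Complex.I * τ) = M.charpoly.eval (Complex.I * τ) *
      (κ * (C ⬝ᵥ (((Complex.I * τ) • (1 : Matrix (Fin n) (Fin n) ℂ) - M)⁻¹ *ᵥ B) -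
        ((-1 / κ : ℝ) : ℂ))) := by
    intro τ
    have h0 := hp τ
    rw [eval_charpoly_eq_det] at h0 ⊢
    rw [eval_charpoly_eq_det, hM', ← sub_add, det_add_smul_vecMulVec _ h0]
    congr 1
    push_cast
    field_simp
    ring
  have hG := (hasArgIncrease_const hκ').mul hw.hasArgIncrease
  have hprod := (hasArgIncrease_charpoly M hp).mul hG
  have hq0 : ∀ τ : ℝ, M'.charpoly.eval (Complex.I * τ) ≠ 0 := fun τ => by
    obtain ⟨_, _, h, _⟩ := hprod
    rw [hq]
    exact (h τ).1
  have h1 := hasArgIncrease_charpoly M' hq0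
  simp_rw [hq] at h1
  -- Open and closed loop have the same degree and the same increase, hence equally many roots on
  -- the right, namely none.
  have h2 := h1.unique hprod
  have h3 : M.charpoly.roots.filter (fun s => 0 < s.re) = 0 := by
    rw [Multiset.filter_eq_nil]
    intro s hs
    exact not_lt.2 (hMroot s (Polynomial.mem_roots'.1 hs).2).le
  rw [h3] at h2
  simp only [Int.cast_zero, mul_zero, Multiset.card_zero, Nat.cast_zero, sub_zero, add_zero] at h2
  have h4 : ((M'.charpoly.roots.filter fun s => 0 < s.re).card : ℝ) = 0 := by
    have hpi := Real.pi_pos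
    have : 2 * π * ((M'.charpoly.roots.filter fun s => 0 < s.re).card : ℝ) = 0 := by linarith
    simpa [hpi.ne'] using this
  have h5 : M'.charpoly.eval s = 0 := (eval_charpoly_eq_zero_iff M' s).2 ⟨x, hx, hs⟩
  have h6 : s ∈ M'.charpoly.roots :=
    Polynomial.mem_roots'.2 ⟨M'.charpoly_monic.ne_zero, h5⟩
  have h7 : ¬ 0 < s.re := fun h => by
    have h8 : M'.charpoly.roots.filter (fun s => 0 < s.re) = 0 :=
      Multiset.card_eq_zero.1 (by exact_mod_cast h4)
    exact (Multiset.filter_eq_nil.1 h8) s h6 h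
  refine lt_of_le_of_ne (not_lt.1 h7) fun h => hq0 s.im ?_
  have : Complex.I * (s.im : ℂ) = s := by
    apply Complex.ext <;> simp [h]
  rw [this, h5]

end Nyquist

/-! ### Without hidden modes, eigenvalues are poles of the transfer function. -/

section Poles

variable {n : ℕ}

attribute [local instance] Matrix.normedAddCommGroup Matrix.normedSpace

/-- If no eigenvector for `s₀` is hidden from the input or the output and the transfer function
stays finite at `s₀`, then `s₀` is not an eigenvalue. -/
theorem not_eigenvalue_of_tendsto {M : Matrix (Fin n) (Fin n) ℂ} {B C : Fin n → ℂ} {s₀ g : ℂ}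
    (hl : ∀ v ≠ 0, v ᵥ* M = s₀ • v → v ⬝ᵥ B ≠ 0) (hr : ∀ v ≠ 0, M *ᵥ v = s₀ • v → C ⬝ᵥ v ≠ 0)
    (hg : Tendsto (fun z => C ⬝ᵥ ((z • (1 : Matrix (Fin n) (Fin n) ℂ) - M)⁻¹ *ᵥ B))
      (𝓝[≠] s₀) (𝓝 g)) (v : Fin n → ℂ) (hv : v ≠ 0) : M *ᵥ v ≠ s₀ • v := by
  intro hMv
  obtain ⟨i₀, hi₀⟩ : ∃ i, v i ≠ 0 := by
    by_contra! h
    exact hv (funext h)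
  set R : ℂ → Matrix (Fin n) (Fin n) ℂ := fun z => (z • 1 - M)⁻¹ with hR
  have hdet : ∀ᶠ z in 𝓝[≠] s₀, (z • (1 : Matrix (Fin n) (Fin n) ℂ) - M).det ≠ 0 := by
    have hfin : (M.charpoly.rootSet ℂ \ {s₀}).Finite := (M.charpoly.rootSet_finite ℂ).subset sdiff_subset
    have h1 : ∀ᶠ z in 𝓝[≠] s₀, z ∉ M.charpoly.rootSet ℂ \ {s₀} :=
      (hfin.isClosed.isOpen_compl.eventually_mem (x := s₀) (by simp)).filter_mono
        nhdsWithin_le_nhds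
    filter_upwards [h1, self_mem_nhdsWithin] with z hz hz' h0
    refine hz ⟨?_, hz'⟩
    rw [Polynomial.mem_rootSet]
    refine ⟨M.charpoly_monic.ne_zero, ?_⟩
    rw [Polynomial.coe_aeval_eq_eval, eval_charpoly_eq_det, h0]
  have hinv : ∀ᶠ z in 𝓝[≠] s₀, (z • 1 - M) * R z = 1 ∧ R z * (z • 1 - M) = 1 := by
    filter_upwards [hdet] with z hz
    exact ⟨Matrix.mul_nonsing_inv _ (Ne.isUnit hz), Matrix.nonsing_inv_mul _ (Ne.isUnit hz)⟩
  set K : ℝ := (∑ j, ‖v j‖) / ‖v i₀‖ with hK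
  -- An eigenvector satisfies v = (z − s₀)R(z)v, which forces the resolvent to blow up at s₀.
  have hRK : ∀ᶠ z in 𝓝[≠] s₀, 1 ≤ ‖z - s₀‖ * K * ‖R z‖ := by
    filter_upwards [hinv] with z hz
    have h1 : v = (z - s₀) • (R z *ᵥ v) := by
      have h2 : (z • (1 : Matrix (Fin n) (Fin n) ℂ) - M) *ᵥ v = (z - s₀) • v := by
        rw [Matrix.sub_mulVec, Matrix.smul_mulVec, Matrix.one_mulVec, hMv, sub_smul]
      rw [← Matrix.mulVec_smul, ← h2, Matrix.mulVec_mulVec, hz.2, Matrix.one_mulVec]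
    have h3 : ‖v i₀‖ ≤ ‖z - s₀‖ * (‖R z‖ * ∑ j, ‖v j‖) := by
      calc ‖v i₀‖ = ‖z - s₀‖ * ‖∑ j, R z i₀ j * v j‖ := by
            conv_lhs => rw [h1]
            rw [Pi.smul_apply, smul_eq_mul, norm_mul]
            rfl
        _ ≤ ‖z - s₀‖ * ∑ j, ‖R z‖ * ‖v j‖ := by
            gcongr
            refine (norm_sum_le _ _).trans (Finset.sum_le_sum fun j _ => ?_)
            rw [norm_mul]
            gcongr
            exact Matrix.norm_entry_le_entrywise_sup_norm _
        _ = _ := by simp only [Finset.mul_sum]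
    have h4 : 0 < ‖v i₀‖ := norm_pos_iff.2 hi₀
    calc (1 : ℝ) = ‖v i₀‖ / ‖v i₀‖ := (div_self h4.ne').symm
      _ ≤ (‖z - s₀‖ * (‖R z‖ * ∑ j, ‖v j‖)) / ‖v i₀‖ := by gcongr
      _ = _ := by rw [hK]; ring
  have hRpos : ∀ᶠ z in 𝓝[≠] s₀, 0 < ‖R z‖ := by
    filter_upwards [hRK] with z hz
    refine (norm_nonneg _).lt_of_ne fun h => ?_
    rw [← h] at hz
    norm_num at hz
  have hRinv : Tendsto (fun z => ‖R z‖⁻¹) (𝓝[≠] s₀) (𝓝 0) := by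
    have h1 : Tendsto (fun z => ‖z - s₀‖ * K) (𝓝[≠] s₀) (𝓝 0) := by
      have : Tendsto (fun z => ‖z - s₀‖ * K) (𝓝 s₀) (𝓝 (‖s₀ - s₀‖ * K)) :=
        Continuous.tendsto (by fun_prop) _
      rw [sub_self, norm_zero, zero_mul] at this
      exact this.mono_left nhdsWithin_le_nhds
    refine squeeze_zero' (Eventually.of_forall fun z => inv_nonneg.2 (norm_nonneg _)) ?_ h1
    filter_upwards [hRK, hRpos] with z hz hp
    rw [inv_le_iff_one_le_mul₀ hp]
    exact hz
  -- By compactness the normalized resolvent has a limit N of norm 1 along an ultrafilter. Since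
  -- 1/‖R‖ → 0, N is annihilated by s₀ − M on both sides, and C N B = 0 because the transfer
  -- function stays finite.
  obtain ⟨f, hf⟩ := Ultrafilter.exists_le (𝓝[≠] s₀)
  set P : ℂ → Matrix (Fin n) (Fin n) ℂ := fun z => ((‖R z‖⁻¹ : ℝ) : ℂ) • R z with hP
  have : ProperSpace (Matrix (Fin n) (Fin n) ℂ) := FiniteDimensional.proper ℂ _
  have hPn : ∀ᶠ z in (f : Filter ℂ), P z ∈ Metric.sphere (0 : Matrix (Fin n) (Fin n) ℂ) 1 := by
    filter_upwards [hf hRpos] with z hz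
    have hz : 0 < ‖R z‖ := hz
    rw [mem_sphere_zero_iff_norm, hP, norm_smul, Complex.norm_real, norm_inv, norm_norm,
      inv_mul_cancel₀ hz.ne']
  obtain ⟨N, hN1, hN⟩ := (isCompact_sphere (0 : Matrix (Fin n) (Fin n) ℂ) 1).ultrafilter_le_nhds
    (f.map P) (Filter.le_principal_iff.2 hPn)
  have hPN : Tendsto P f (𝓝 N) := hN
  have hz : Tendsto (fun z : ℂ => z) f (𝓝 s₀) := (hf.trans nhdsWithin_le_nhds)
  have hinv0 : Tendsto (fun z => ((‖R z‖⁻¹ : ℝ) : ℂ)) f (𝓝 0) := by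
    have := (Complex.continuous_ofReal.tendsto 0).comp (hRinv.mono_left hf)
    simpa [Function.comp_def] using this
  have hsM : Tendsto (fun z : ℂ => z • (1 : Matrix (Fin n) (Fin n) ℂ) - M) f (𝓝 (s₀ • 1 - M)) :=
    (hz.smul_const _).sub_const _
  have hcm : Continuous fun p : Matrix (Fin n) (Fin n) ℂ × Matrix (Fin n) (Fin n) ℂ => p.1 * p.2 :=
    continuous_fst.matrix_mul continuous_snd
  have h0 : Tendsto (fun z => ((‖R z‖⁻¹ : ℝ) : ℂ) • (1 : Matrix (Fin n) (Fin n) ℂ)) f (𝓝 0) := by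
    simpa using hinv0.smul_const (1 : Matrix (Fin n) (Fin n) ℂ)
  have hNr : (s₀ • 1 - M) * N = 0 := by
    refine tendsto_nhds_unique ((hcm.tendsto (_, N)).comp (hsM.prodMk_nhds hPN)) (h0.congr' ?_)
    filter_upwards [hf hinv] with z hz
    have hz : (z • 1 - M) * R z = 1 ∧ R z * (z • 1 - M) = 1 := hz
    simp only [Function.comp_apply, hP]
    rw [Matrix.mul_smul, hz.1]
  have hNl : N * (s₀ • 1 - M) = 0 := by
    refine tendsto_nhds_unique ((hcm.tendsto (N, _)).comp (hPN.prodMk_nhds hsM)) (h0.congr' ?_)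
    filter_upwards [hf hinv] with z hz
    have hz : (z • 1 - M) * R z = 1 ∧ R z * (z • 1 - M) = 1 := hz
    simp only [Function.comp_apply, hP]
    rw [Matrix.smul_mul, hz.2]
  have hCNB : C ⬝ᵥ (N *ᵥ B) = 0 := by
    have hc : Continuous fun Q : Matrix (Fin n) (Fin n) ℂ => C ⬝ᵥ (Q *ᵥ B) :=
      continuous_const.dotProduct (continuous_id.matrix_mulVec continuous_const)
    have h1 := hinv0.mul (hg.mono_left hf)
    rw [zero_mul] at h1
    refine tendsto_nhds_unique ((hc.tendsto N).comp hPN) (h1.congr fun z => ?_)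
    simp only [Function.comp_apply, hP]
    rw [Matrix.smul_mulVec, dotProduct_smul, smul_eq_mul]
  -- Otherwise N B would be a right eigenvector annihilated by C.
  have hNB : N *ᵥ B = 0 := by
    by_contra hne
    refine hr _ hne ?_ hCNB
    have h1 : (s₀ • (1 : Matrix (Fin n) (Fin n) ℂ) - M) *ᵥ (N *ᵥ B) = 0 := by
      rw [Matrix.mulVec_mulVec, hNr, Matrix.zero_mulVec]
    rw [Matrix.sub_mulVec, Matrix.smul_mulVec, Matrix.one_mulVec, sub_eq_zero] at h1
    exact h1.symm
  -- A nonzero row of N would be a left eigenvector annihilated by B. So N = 0, which contradicts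
  -- norm 1.
  have hN0 : N = 0 := by
    ext i j
    by_contra hne
    have hrow : N i ≠ 0 := fun h => hne (congrFun h j)
    refine hl (N i) hrow ?_ (congrFun hNB i)
    have h1 : N i ᵥ* (s₀ • (1 : Matrix (Fin n) (Fin n) ℂ) - M) = 0 := congrFun hNl i
    rw [Matrix.vecMul_sub, Matrix.vecMul_smul, Matrix.vecMul_one, sub_eq_zero] at h1
    exact h1.symm
  rw [hN0] at hN1
  simp at hN1

/-- By Cramer's rule the entries of the resolvent are quotients of polynomials in z. -/
theorem meromorphicAt_transfer (M : Matrix (Fin n) (Fin n) ℂ) (B C : Fin n → ℂ) (μ s : ℂ) :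
    MeromorphicAt (fun z => C ⬝ᵥ (((z - μ) • (1 : Matrix (Fin n) (Fin n) ℂ) - M)⁻¹ *ᵥ B)) s := by
  have hent : ∀ i j, AnalyticAt ℂ
      (fun z : ℂ => ((z - μ) • (1 : Matrix (Fin n) (Fin n) ℂ) - M) i j) s := by
    intro i j
    simp only [Matrix.sub_apply, Matrix.smul_apply, smul_eq_mul]
    fun_prop
  have hdet : ∀ F : ℂ → Matrix (Fin n) (Fin n) ℂ, (∀ i j, AnalyticAt ℂ (fun z => F z i j) s) →
      AnalyticAt ℂ (fun z => (F z).det) s := by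
    intro F hF
    simp only [Matrix.det_apply']
    refine Finset.analyticAt_fun_sum _ fun σ _ => ?_
    exact analyticAt_const.fun_mul (Finset.analyticAt_fun_prod _ fun i _ => hF _ _)
  simp only [dotProduct, Matrix.mulVec, Matrix.inv_def, Matrix.smul_apply, Ring.inverse_eq_inv',
    smul_eq_mul]
  refine MeromorphicAt.fun_sum fun i _ => ?_
  refine (MeromorphicAt.const (C i) s).fun_mul (MeromorphicAt.fun_sum fun j _ => ?_)
  refine ((hdet _ hent).meromorphicAt.fun_inv.fun_mul (AnalyticAt.meromorphicAt ?_)).fun_mul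
    (MeromorphicAt.const (B j) s)
  simp only [Matrix.adjugate_apply]
  refine hdet _ fun k l => ?_
  simp only [Matrix.updateRow_apply]
  split_ifs
  · fun_prop
  · exact hent k l

end Poles

/-! ### Fourier coefficients of states on the circle. -/

section CircleFourier

open AddCircle

theorem haarAddCircle_absolutelyContinuous :
    (haarAddCircle : Measure SpatialCircle) ≪ volume := by
  rw [volume_eq_smul_haarAddCircle]
  exact Measure.absolutelyContinuous_smul (by simp [Real.pi_pos])

theorem hasSum_norm_sq_fourierCoeff {f : SpatialCircle → ℂ} (hf : MemLp f 2) :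
    HasSum (fun ζ => ‖fourierCoeff f ζ‖ ^ 2) ((2 * π)⁻¹ * ∫ θ, ‖f θ‖ ^ 2) := by
  have h := hasSum_sq_fourierCoeff (hf.haarAddCircle.toLp f)
  rw [fourierCoeff_congr_ae hf.haarAddCircle.coeFn_toLp] at h
  convert h using 1
  rw [← smul_eq_mul, ← integral_haarAddCircle]
  refine integral_congr_ae ?_
  filter_upwards [hf.haarAddCircle.coeFn_toLp] with θ hθ
  rw [hθ]

theorem norm_fourierCoeff_le {f : SpatialCircle → ℂ} (hf : MemLp f 2) {Q : ℝ} (hQ : 0 ≤ Q)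
    (h : ∫ θ, ‖f θ‖ ^ 2 ≤ Q ^ 2) (ζ : ℤ) : ‖fourierCoeff f ζ‖ ≤ Q := by
  have h1 := le_hasSum (hasSum_norm_sq_fourierCoeff hf) ζ fun _ _ => sq_nonneg _
  have h2 : (2 * π)⁻¹ ≤ 1 := inv_le_one_of_one_le₀ (by linarith [Real.pi_gt_three])
  have h3 : 0 ≤ ∫ θ, ‖f θ‖ ^ 2 := integral_nonneg fun _ => sq_nonneg _
  have h4 : ‖fourierCoeff f ζ‖ ^ 2 ≤ Q ^ 2 := by nlinarith
  exact (pow_le_pow_iff_left₀ (norm_nonneg _) hQ two_ne_zero).1 h4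

theorem integrable_haar {f : SpatialCircle → ℂ} (hf : MemLp f 2) :
    Integrable f haarAddCircle := hf.haarAddCircle.integrable one_le_two

theorem fourierCoeff_add' {f g : SpatialCircle → ℂ} (hf : MemLp f 2) (hg : MemLp g 2) (ζ : ℤ) :
    fourierCoeff (fun θ => f θ + g θ) ζ = fourierCoeff f ζ + fourierCoeff g ζ :=
  congrFun (fourierCoeff.add (integrable_haar hf) (integrable_haar hg)) ζ

theorem fourierCoeff_sub' {f g : SpatialCircle → ℂ} (hf : MemLp f 2) (hg : MemLp g 2) (ζ : ℤ) :
    fourierCoeff (fun θ => f θ - g θ) ζ = fourierCoeff f ζ - fourierCoeff g ζ := by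
  have h1 := fourierCoeff_add' hf (hg.const_mul (-1)) ζ
  rw [fourierCoeff.const_mul] at h1
  have h2 : (fun θ => f θ - g θ) = fun θ => f θ + -1 * g θ := by ext; ring
  rw [h2, h1]
  ring

theorem fourierCoeff_translate (f : SpatialCircle → ℂ) (h : SpatialCircle) (ζ : ℤ) :
    fourierCoeff (fun θ => f (θ + h)) ζ = fourier ζ h * fourierCoeff f ζ := by
  have h1 := integral_add_right_eq_self (μ := (haarAddCircle : Measure SpatialCircle))
    (fun θ => fourier (-ζ) (θ - h) • f θ) h
  simp only [add_sub_cancel_right] at h1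
  rw [fourierCoeff, h1, fourierCoeff, ← integral_const_mul]
  congr with θ
  have h2 : (fourier (-ζ) (θ - h) : ℂ) = fourier ζ h * fourier (-ζ) θ := by
    simp only [fourier_apply, smul_sub, neg_smul, sub_neg_eq_add, toCircle_add, Circle.coe_mul]
    ring
  rw [h2, smul_eq_mul, smul_eq_mul]
  ring

theorem memLp_translate {f : SpatialCircle → ℂ} (hf : MemLp f 2) (h : SpatialCircle) :
    MemLp (fun θ => f (θ + h)) 2 :=
  hf.comp_measurePreserving (measurePreserving_add_right volume h)

theorem hasSum_norm_sq_fourierCoeff_difference {f : SpatialCircle → ℂ} (hf : MemLp f 2)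
    (h : SpatialCircle) :
    HasSum (fun ζ => ‖(fourier ζ h - 1) * fourierCoeff f ζ‖ ^ 2)
      ((2 * π)⁻¹ * ∫ θ, ‖f (θ + h) - f θ‖ ^ 2) := by
  have h1 := hasSum_norm_sq_fourierCoeff ((memLp_translate hf h).sub hf)
  have h2 : ∀ ζ, fourierCoeff ((fun θ => f (θ + h)) - f) ζ =
      (fourier ζ h - 1) * fourierCoeff f ζ := fun ζ => by
    rw [sub_mul, one_mul, ← fourierCoeff_translate]
    exact fourierCoeff_sub' (memLp_translate hf h) hf ζ
  simp_rw [h2] at h1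
  exact h1

variable {n : ℕ}

theorem integral_norm_sq_eq (x : StateSpace n) : ∫ θ, ‖x θ‖ ^ 2 = ‖x‖ ^ 2 := by
  have h4 := L2.inner_def (𝕜 := ℝ) x x
  rw [real_inner_self_eq_norm_sq] at h4
  rw [h4]
  congr with θ
  exact (real_inner_self_eq_norm_sq _).symm

theorem integrable_norm_sq (x : StateSpace n) : Integrable fun θ => ‖x θ‖ ^ 2 :=
  (memLp_two_iff_integrable_sq_norm (Lp.aestronglyMeasurable x)).1 (Lp.memLp x)

theorem memLp_clm_comp (l : EuclideanSpace ℝ (Fin n) →L[ℝ] ℂ) (x : StateSpace n) :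
    MemLp (fun θ => l (x θ)) 2 := l.comp_memLp' (Lp.memLp x)

/-- The Fourier coefficient of a component of the state as a functional on the state space. -/
noncomputable def coeffCLM (l : EuclideanSpace ℝ (Fin n) →L[ℝ] ℂ) (ζ : ℤ) :
    StateSpace n →L[ℝ] ℂ :=
  LinearMap.mkContinuous
    { toFun := fun x => fourierCoeff (fun θ => l (x θ)) ζ
      map_add' := fun x y => by
        rw [← fourierCoeff_add' (memLp_clm_comp l x) (memLp_clm_comp l y)]
        refine congrFun (fourierCoeff_congr_ae ?_) ζ
        have h := Lp.coeFn_add x y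
        filter_upwards [haarAddCircle_absolutelyContinuous.ae_le h] with θ hθ
        rw [hθ, Pi.add_apply, map_add]
      map_smul' := fun a x => by
        rw [RingHom.id_apply, Complex.real_smul, ← fourierCoeff.const_mul]
        refine congrFun (fourierCoeff_congr_ae ?_) ζ
        have h := Lp.coeFn_smul a x
        filter_upwards [haarAddCircle_absolutelyContinuous.ae_le h] with θ hθ
        rw [hθ, Pi.smul_apply, map_smul, Complex.real_smul] }
    ‖l‖ fun x => norm_fourierCoeff_le (memLp_clm_comp l x) (by positivity) (by
      rw [mul_pow, ← integral_norm_sq_eq, ← integral_const_mul]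
      refine integral_mono ((memLp_two_iff_integrable_sq_norm (memLp_clm_comp l x).1).1
        (memLp_clm_comp l x)) ((integrable_norm_sq x).const_mul _) fun θ => ?_
      simp only
      rw [← mul_pow]
      gcongr
      exact l.le_opNorm _) ζ

/-- The functional `x ↦ a · x`, as a complex number. -/
noncomputable def dotCLM (a : Fin n → ℝ) : EuclideanSpace ℝ (Fin n) →L[ℝ] ℂ :=
  Complex.ofRealCLM ∘L ∑ i, a i • EuclideanSpace.proj i

theorem dotCLM_apply (a : Fin n → ℝ) (x : EuclideanSpace ℝ (Fin n)) :
    dotCLM a x = ((a ⬝ᵥ x.ofLp : ℝ) : ℂ) := by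
  simp [dotCLM, dotProduct]

/-- The functional `x ↦ xᵢ`, as a complex number. -/
noncomputable def entryCLM (i : Fin n) : EuclideanSpace ℝ (Fin n) →L[ℝ] ℂ :=
  Complex.ofRealCLM ∘L EuclideanSpace.proj i

theorem entryCLM_apply (i : Fin n) (x : EuclideanSpace ℝ (Fin n)) : entryCLM i x = (x i : ℂ) := rfl

/-- The vector of Fourier coefficients of the state. -/
noncomputable def modeCLM (ζ : ℤ) : StateSpace n →L[ℝ] EuclideanSpace ℂ (Fin n) where
  toFun x := WithLp.toLp 2 fun i => coeffCLM (entryCLM i) ζ x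
  map_add' x y := by ext i; simp
  map_smul' a x := by ext i; simp
  cont := (PiLp.continuous_toLp 2 _).comp (continuous_pi fun i => (coeffCLM (entryCLM i) ζ).continuous)

theorem modeCLM_apply (ζ : ℤ) (x : StateSpace n) (i : Fin n) :
    modeCLM ζ x i = fourierCoeff (fun θ => ((x θ) i : ℂ)) ζ := rfl

theorem fourierCoeff_dotProduct (a : Fin n → ℝ) (ζ : ℤ) (x : StateSpace n) :
    fourierCoeff (fun θ => ((a ⬝ᵥ (x θ).ofLp : ℝ) : ℂ)) ζ = ∑ i, (a i : ℂ) * modeCLM ζ x i := by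
  have h1 : (fun θ => ((a ⬝ᵥ (x θ).ofLp : ℝ) : ℂ)) =
      ∑ i, fun θ => (a i : ℂ) * ((x θ) i : ℂ) := by
    ext θ
    simp [dotProduct]
  rw [h1, fourierCoeff.sum, Finset.sum_apply]
  · exact Finset.sum_congr rfl fun i _ => fourierCoeff.const_mul _ _ _
  · exact fun i _ => integrable_haar ((memLp_clm_comp (entryCLM i) x).const_mul _)

theorem hasSum_norm_sq_modeCLM (x : StateSpace n) :
    HasSum (fun ζ => ‖modeCLM ζ x‖ ^ 2) ((2 * π)⁻¹ * ‖x‖ ^ 2) := by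
  have h1 := hasSum_sum (s := Finset.univ) fun i _ =>
    hasSum_norm_sq_fourierCoeff (memLp_clm_comp (entryCLM i) x)
  convert h1 using 1
  · ext ζ
    rw [EuclideanSpace.norm_sq_eq]
    rfl
  · rw [← Finset.mul_sum, ← integral_norm_sq_eq, ← integral_finsetSum]
    · congr with θ
      rw [EuclideanSpace.norm_sq_eq]
      refine Finset.sum_congr rfl fun i _ => ?_
      rw [entryCLM_apply, Complex.norm_real]
    · exact fun i _ => (memLp_two_iff_integrable_sq_norm (memLp_clm_comp (entryCLM i) x).1).1
        (memLp_clm_comp (entryCLM i) x)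

end CircleFourier

/-! ### The sector condition, pointwise and in Fourier coefficients. -/

section Sector

open AddCircle

variable {φ : ℝ → ℝ} {K₁ K₂ : ℝ}

/-- The sector condition says that φ' stays within (K₂−K₁)/2 of (K₁+K₂)/2; apply the mean value
inequality. -/
theorem abs_sub_centre_le_of_sector (hφ : ContDiff ℝ 1 φ) (hK : K₁ ≤ K₂)
    (hsector : ∀ η : ℝ, (deriv φ η - K₁) * (deriv φ η - K₂) ≤ 0) (a b : ℝ) :
    |(φ a - (K₁ + K₂) / 2 * a) - (φ b - (K₁ + K₂) / 2 * b)| ≤ (K₂ - K₁) / 2 * |a - b| := by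
  have hd : ∀ η, HasDerivAt (fun η => φ η - (K₁ + K₂) / 2 * η) (deriv φ η - (K₁ + K₂) / 2) η := by
    intro η
    have h1 := ((hφ.differentiable one_ne_zero).differentiableAt (x := η)).hasDerivAt
    have h2 := (hasDerivAt_id η).const_mul ((K₁ + K₂) / 2)
    exact (h1.sub h2).congr_deriv (by simp)
  refine Convex.norm_image_sub_le_of_norm_hasDerivWithin_le (s := univ)
    (f := fun η => φ η - (K₁ + K₂) / 2 * η)
    (fun η _ => (hd η).hasDerivWithinAt) (fun η _ => ?_) convex_univ (mem_univ b) (mem_univ a)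
  rw [norm_eq_abs, abs_le]
  have := hsector η
  constructor <;> nlinarith

theorem abs_sub_le_of_sector (hφ : ContDiff ℝ 1 φ) (hK : K₁ ≤ K₂)
    (hsector : ∀ η : ℝ, (deriv φ η - K₁) * (deriv φ η - K₂) ≤ 0) (a b : ℝ) :
    |φ a - φ b| ≤ (|(K₁ + K₂) / 2| + (K₂ - K₁) / 2) * |a - b| := by
  have h1 := abs_sub_centre_le_of_sector hφ hK hsector a b
  have h2 : φ a - φ b = ((φ a - (K₁ + K₂) / 2 * a) - (φ b - (K₁ + K₂) / 2 * b)) +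
    (K₁ + K₂) / 2 * (a - b) := by ring
  rw [h2, add_mul]
  refine (abs_add_le _ _).trans ?_
  rw [abs_mul ((K₁ + K₂) / 2)]
  linarith

variable {n : ℕ}

/-- The Fourier coefficient of the input `u = -φ(C x)`. -/
noncomputable def inputCoeff (φ : ℝ → ℝ) (C : Fin n → ℝ) (ζ : ℤ) (x : StateSpace n) : ℂ :=
  fourierCoeff (fun θ => ((-φ (C ⬝ᵥ (x θ).ofLp) : ℝ) : ℂ)) ζ

theorem memLp_output (C : Fin n → ℝ) (x : StateSpace n) :
    MemLp (fun θ => ((C ⬝ᵥ (x θ).ofLp : ℝ) : ℂ)) 2 := by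
  have := memLp_clm_comp (dotCLM C) x
  simpa only [dotCLM_apply] using this

theorem memLp_input (hφ : ContDiff ℝ 1 φ) (hK : K₁ ≤ K₂)
    (hsector : ∀ η : ℝ, (deriv φ η - K₁) * (deriv φ η - K₂) ≤ 0) (C : Fin n → ℝ)
    (x : StateSpace n) : MemLp (fun θ => ((-φ (C ⬝ᵥ (x θ).ofLp) : ℝ) : ℂ)) 2 := by
  have hy := memLp_output C x
  have hm : AEStronglyMeasurable (fun θ => (C ⬝ᵥ (x θ).ofLp : ℝ)) volume := by
    have := Complex.continuous_re.comp_aestronglyMeasurable hy.1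
    simpa using this
  have h1 : MemLp (fun _ : SpatialCircle => (|φ 0| : ℝ)) 2 := memLp_const _
  have h2 := h1.add (hy.norm.const_mul (|(K₁ + K₂) / 2| + (K₂ - K₁) / 2))
  refine h2.of_le ?_ (Eventually.of_forall fun θ => ?_)
  · exact Complex.continuous_ofReal.comp_aestronglyMeasurable
      (hφ.continuous.comp_aestronglyMeasurable hm).neg
  · have h3 := abs_sub_le_of_sector hφ hK hsector (C ⬝ᵥ (x θ).ofLp) 0
    have h4 : |φ (C ⬝ᵥ (x θ).ofLp)| ≤ |φ 0| + |φ (C ⬝ᵥ (x θ).ofLp) - φ 0| := by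
      have := abs_add_le (φ 0) (φ (C ⬝ᵥ (x θ).ofLp) - φ 0)
      simpa using this
    rw [sub_zero] at h3
    simp only [Complex.norm_real, norm_eq_abs, abs_neg, Pi.add_apply]
    exact (h4.trans (by linarith)).trans (le_abs_self _)

/-- φ is globally Lipschitz, so the input coefficients depend continuously on the state and hence on
time. -/
theorem norm_inputCoeff_sub_le (hφ : ContDiff ℝ 1 φ) (hK : K₁ ≤ K₂)
    (hsector : ∀ η : ℝ, (deriv φ η - K₁) * (deriv φ η - K₂) ≤ 0) (C : Fin n → ℝ) (ζ : ℤ)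
    (x x' : StateSpace n) :
    ‖inputCoeff φ C ζ x - inputCoeff φ C ζ x'‖ ≤
      (|(K₁ + K₂) / 2| + (K₂ - K₁) / 2) * ‖dotCLM C‖ * ‖x - x'‖ := by
  have hL : 0 ≤ |(K₁ + K₂) / 2| + (K₂ - K₁) / 2 := by
    have := abs_nonneg ((K₁ + K₂) / 2); linarith
  have hx := memLp_input hφ hK hsector C x
  have hx' := memLp_input hφ hK hsector C x'
  rw [inputCoeff, inputCoeff, ← fourierCoeff_sub' hx hx']
  refine norm_fourierCoeff_le (hx.sub hx') (by positivity) ?_ ζ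
  rw [mul_pow _ ‖x - x'‖, ← integral_norm_sq_eq, ← integral_const_mul]
  refine integral_mono_ae ((memLp_two_iff_integrable_sq_norm (hx.sub hx').1).1 (hx.sub hx'))
    ((integrable_norm_sq (x - x')).const_mul _) ?_
  filter_upwards [Lp.coeFn_sub x x'] with θ hθ
  rw [← mul_pow, hθ, Pi.sub_apply, ← Complex.ofReal_sub, Complex.norm_real, norm_eq_abs]
  gcongr
  have h1 := abs_sub_le_of_sector hφ hK hsector (C ⬝ᵥ (x' θ).ofLp) (C ⬝ᵥ (x θ).ofLp)
  have h2 : |C ⬝ᵥ (x' θ).ofLp - C ⬝ᵥ (x θ).ofLp| ≤ ‖dotCLM C‖ * ‖x θ - x' θ‖ := by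
    have h3 := (dotCLM C).le_opNorm (x' θ - x θ)
    rw [map_sub, dotCLM_apply, dotCLM_apply, ← Complex.ofReal_sub, Complex.norm_real,
      norm_sub_rev (x' θ)] at h3
    exact h3
  have h4 : -φ (C ⬝ᵥ (x θ).ofLp) - -φ (C ⬝ᵥ (x' θ).ofLp) =
    φ (C ⬝ᵥ (x' θ).ofLp) - φ (C ⬝ᵥ (x θ).ofLp) := by ring
  rw [h4, Pi.sub_apply, mul_assoc]
  exact h1.trans (by gcongr)

/-- The incremental sector condition for the Fourier coefficients of spatial differences. -/
theorem tsum_sector_le (hφ : ContDiff ℝ 1 φ) (hK : K₁ ≤ K₂)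
    (hsector : ∀ η : ℝ, (deriv φ η - K₁) * (deriv φ η - K₂) ≤ 0) (C : Fin n → ℝ)
    (h : SpatialCircle) (x : StateSpace n) :
    (Summable fun ζ => ‖(fourier ζ h - 1) * inputCoeff φ C ζ x‖ ^ 2) ∧
    ∑' ζ, ‖(fourier ζ h - 1) * (inputCoeff φ C ζ x +
        ((K₁ + K₂) / 2 : ℝ) * ∑ i, (C i : ℂ) * modeCLM ζ x i)‖ ^ 2 ≤
      ((K₂ - K₁) / 2) ^ 2 *
        ∑' ζ, ‖(fourier ζ h - 1) * ∑ i, (C i : ℂ) * modeCLM ζ x i‖ ^ 2 := by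
  have hu := memLp_input hφ hK hsector C x
  have hy := memLp_output C x
  have h1 := hasSum_norm_sq_fourierCoeff_difference hy h
  have h2 := hasSum_norm_sq_fourierCoeff_difference
    (hu.add (hy.const_mul (((K₁ + K₂) / 2 : ℝ) : ℂ))) h
  have h3 : ∀ ζ, fourierCoeff ((fun θ => ((-φ (C ⬝ᵥ (x θ).ofLp) : ℝ) : ℂ)) +
      fun θ => (((K₁ + K₂) / 2 : ℝ) : ℂ) * ((C ⬝ᵥ (x θ).ofLp : ℝ) : ℂ)) ζ =
      inputCoeff φ C ζ x + ((K₁ + K₂) / 2 : ℝ) * ∑ i, (C i : ℂ) * modeCLM ζ x i := by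
    intro ζ
    rw [← fourierCoeff_dotProduct, ← fourierCoeff.const_mul]
    exact fourierCoeff_add' hu (hy.const_mul _) ζ
  simp_rw [h3] at h2
  simp_rw [fourierCoeff_dotProduct] at h1
  refine ⟨(hasSum_norm_sq_fourierCoeff_difference hu h).summable, ?_⟩
  rw [h1.tsum_eq, h2.tsum_eq, mul_left_comm]
  have hpi : 0 ≤ (2 * π)⁻¹ := by positivity
  refine mul_le_mul_of_nonneg_left ?_ hpi
  rw [← integral_const_mul]
  have m1 := (memLp_translate hy h).sub hy
  have m2' := hu.add (hy.const_mul (((K₁ + K₂) / 2 : ℝ) : ℂ))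
  have m2 := (memLp_translate m2' h).sub m2'
  refine integral_mono ((memLp_two_iff_integrable_sq_norm m2.1).1 m2)
    (((memLp_two_iff_integrable_sq_norm m1.1).1 m1).const_mul _) fun θ => ?_
  simp only [Pi.add_apply]
  set a := C ⬝ᵥ (x (θ + h)).ofLp
  set b := C ⬝ᵥ (x θ).ofLp
  have h4 := abs_sub_centre_le_of_sector hφ hK hsector b a
  rw [← mul_pow]
  have e1 : (((-φ a : ℝ) : ℂ) + (((K₁ + K₂) / 2 : ℝ) : ℂ) * (a : ℂ)) -
      (((-φ b : ℝ) : ℂ) + (((K₁ + K₂) / 2 : ℝ) : ℂ) * (b : ℂ)) =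
      (((φ b - (K₁ + K₂) / 2 * b) - (φ a - (K₁ + K₂) / 2 * a) : ℝ) : ℂ) := by
    push_cast; ring
  rw [e1, Complex.norm_real, norm_eq_abs, ← Complex.ofReal_sub, Complex.norm_real, norm_eq_abs,
    abs_sub_comm a b]
  gcongr

end Sector

/-! ### Weak derivatives in terms of Fourier coefficients. -/

section WeakDerivative

open AddCircle

variable {n : ℕ}

theorem intervalIntegrable_coe (x : StateSpace n) :
    IntervalIntegrable (fun r : ℝ => x (r : SpatialCircle)) volume 0 (2 * π) := by
  have h1 : Integrable x volume := (Lp.memLp x).integrable one_le_two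
  have h2 := AddCircle.measurePreserving_mk (2 * π) 0
  rw [zero_add] at h2
  rw [intervalIntegrable_iff_integrableOn_Ioc_of_le two_pi_pos.le]
  exact h2.integrable_comp_of_integrable h1

theorem entryCLM_integral_smul (x : StateSpace n) {ψ : ℝ → ℝ} (hψ : Continuous ψ) (i : Fin n) :
    entryCLM i (∫ r in (0 : ℝ)..(2 * π), ψ r • x (r : SpatialCircle)) =
      ∫ r in (0 : ℝ)..(2 * π), (ψ r : ℂ) * ((x (r : SpatialCircle)) i : ℂ) := by
  rw [← ContinuousLinearMap.intervalIntegral_comp_comm _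
    ((intervalIntegrable_coe x).continuousOn_smul hψ.continuousOn)]
  refine intervalIntegral.integral_congr fun r _ => ?_
  simp [entryCLM_apply]

theorem hasWeakDeriv_iff (f g : StateSpace n) : HasWeakDeriv f g ↔
    ∀ ψ : ℝ → ℝ, ContDiff ℝ ∞ ψ → Function.Periodic ψ (2 * π) → ∀ i,
      ∫ r in (0 : ℝ)..(2 * π), ((deriv ψ r : ℝ) : ℂ) * ((f (r : SpatialCircle)) i : ℂ) =
        -∫ r in (0 : ℝ)..(2 * π), (ψ r : ℂ) * ((g (r : SpatialCircle)) i : ℂ) := by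
  refine forall₃_congr fun ψ h1 h2 => ?_
  have h3 := h1.continuous_deriv (by simp)
  refine ⟨fun h i => ?_, fun h => ?_⟩
  · rw [← entryCLM_integral_smul f h3, ← entryCLM_integral_smul g h1.continuous, h, map_neg]
  · ext i
    have h4 := h i
    rw [← entryCLM_integral_smul f h3, ← entryCLM_integral_smul g h1.continuous, ← map_neg] at h4
    exact Complex.ofReal_injective h4

theorem fourier_coe_eq (ζ : ℤ) (r : ℝ) :
    (fourier ζ (r : SpatialCircle) : ℂ) = Complex.exp (Complex.I * (ζ * r : ℝ)) := by
  rw [fourier_coe_apply]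
  congr 1
  have : (π : ℂ) ≠ 0 := Complex.ofReal_ne_zero.2 pi_ne_zero
  push_cast
  field_simp

theorem modeCLM_eq_integral (ζ : ℤ) (x : StateSpace n) (i : Fin n) :
    modeCLM ζ x i = (2 * π)⁻¹ *
      ((∫ r in (0 : ℝ)..(2 * π), ((cos (ζ * r) : ℝ) : ℂ) * ((x (r : SpatialCircle)) i : ℂ)) -
        Complex.I * ∫ r in (0 : ℝ)..(2 * π), ((sin (ζ * r) : ℝ) : ℂ) *
          ((x (r : SpatialCircle)) i : ℂ)) := by
  have hx : IntervalIntegrable (fun r : ℝ => ((x (r : SpatialCircle)) i : ℂ)) volume 0 (2 * π) :=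
    ⟨(entryCLM i).integrable_comp (intervalIntegrable_coe x).1,
      (entryCLM i).integrable_comp (intervalIntegrable_coe x).2⟩
  rw [modeCLM_apply, fourierCoeff_eq_intervalIntegral _ _ 0, zero_add,
    ← intervalIntegral.integral_const_mul, ← intervalIntegral.integral_sub, one_div,
    Complex.real_smul]
  · push_cast
    congr 1
    refine intervalIntegral.integral_congr fun r _ => ?_
    simp only [smul_eq_mul]
    rw [fourier_coe_eq, mul_comm Complex.I, Complex.exp_mul_I]
    push_cast
    rw [neg_mul, Complex.cos_neg, Complex.sin_neg]
    ring
  · exact hx.continuousOn_mul (by fun_prop)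
  · exact (hx.continuousOn_mul (by fun_prop)).const_mul _

/-- Test functions are real, so the exponential is tested through cos(ζr) and sin(ζr) separately. -/
theorem HasWeakDeriv.modeCLM_eq {f g : StateSpace n} (h : HasWeakDeriv f g) (ζ : ℤ) :
    modeCLM ζ g = (Complex.I * ζ) • modeCLM ζ f := by
  rw [hasWeakDeriv_iff] at h
  ext i
  have hp : ∀ r : ℝ, (ζ : ℝ) * (r + 2 * π) = ζ * r + ζ * (2 * π) := fun r => by ring
  have h1 := h (fun r => cos (ζ * r)) (by fun_prop) (fun r => by
    simp only [hp, cos_add_int_mul_two_pi]) i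
  have h2 := h (fun r => sin (ζ * r)) (by fun_prop) (fun r => by
    simp only [hp, sin_add_int_mul_two_pi]) i
  have d1 : deriv (fun r : ℝ => cos (ζ * r)) = fun r => -ζ * sin (ζ * r) := by
    ext r
    have := ((hasDerivAt_id r).const_mul (ζ : ℝ)).cos.deriv
    simp only [id] at this
    rw [this]; ring
  have d2 : deriv (fun r : ℝ => sin (ζ * r)) = fun r => ζ * cos (ζ * r) := by
    ext r
    have := ((hasDerivAt_id r).const_mul (ζ : ℝ)).sin.deriv
    simp only [id] at this
    rw [this]; ring
  rw [d1] at h1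
  rw [d2] at h2
  simp only [Complex.ofReal_mul, mul_assoc, intervalIntegral.integral_const_mul] at h1 h2
  rw [PiLp.smul_apply, smul_eq_mul, modeCLM_eq_integral, modeCLM_eq_integral]
  push_cast at h1 h2 ⊢
  have hI := Complex.I_sq
  linear_combination (2 * (π : ℂ))⁻¹ * (h1 - Complex.I * h2) + (2 * (π : ℂ))⁻¹ * ζ *
    (∫ r in (0 : ℝ)..(2 * π), Complex.sin (ζ * r) * ((f (r : SpatialCircle)) i : ℂ)) * hI

theorem HasLaplacian.modeCLM_eq {f w : StateSpace n} (h : HasLaplacian f w) (ζ : ℤ) :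
    modeCLM ζ w = (-(ζ : ℂ) ^ 2) • modeCLM ζ f := by
  obtain ⟨g, hg, hw⟩ := h
  rw [hw.modeCLM_eq, hg.modeCLM_eq, smul_smul]
  congr 1
  linear_combination (ζ : ℂ) ^ 2 * Complex.I_sq

/-- Riesz-Fischer. -/
theorem exists_memLp_fourierCoeff_eq {a : ℤ → ℂ} (ha : Summable fun ζ => ‖a ζ‖ ^ 2) :
    ∃ f : SpatialCircle → ℂ, MemLp f 2 ∧ ∀ ζ, fourierCoeff f ζ = a ζ := by
  have h1 : Memℓp a 2 := memℓp_gen (by simpa using ha)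
  set F := (fourierBasis (T := 2 * π)).repr.symm (⟨a, h1⟩ : lp (fun _ : ℤ => ℂ) 2) with hF
  refine ⟨F, ?_, fun ζ => ?_⟩
  · exact memLp_haarAddCircle_iff.1 (Lp.memLp F)
  · rw [← fourierBasis_repr, hF, LinearIsometryEquiv.apply_symm_apply]

theorem hasSum_conj_mul_fourierCoeff {f g : SpatialCircle → ℂ} (hf : MemLp f 2) (hg : MemLp g 2) :
    HasSum (fun ζ => (starRingEnd ℂ) (fourierCoeff f ζ) * fourierCoeff g ζ)
      ((2 * π)⁻¹ * ∫ θ, (starRingEnd ℂ) (f θ) * g θ) := by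
  have h := fourierBasis.hasSum_inner_mul_inner (hf.haarAddCircle.toLp f) (hg.haarAddCircle.toLp g)
  have e1 : ∀ ζ, inner ℂ (hf.haarAddCircle.toLp f) (fourierBasis ζ) =
      (starRingEnd ℂ) (fourierCoeff f ζ) := fun ζ => by
    rw [← inner_conj_symm, ← HilbertBasis.repr_apply_apply, fourierBasis_repr,
      fourierCoeff_congr_ae hf.haarAddCircle.coeFn_toLp]
  have e2 : ∀ ζ, inner ℂ (fourierBasis ζ) (hg.haarAddCircle.toLp g) = fourierCoeff g ζ := fun ζ => by
    rw [← HilbertBasis.repr_apply_apply, fourierBasis_repr,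
      fourierCoeff_congr_ae hg.haarAddCircle.coeFn_toLp]
  simp_rw [e1, e2] at h
  suffices e3 : inner ℂ (hf.haarAddCircle.toLp f) (hg.haarAddCircle.toLp g) =
      ((2 * π)⁻¹ : ℝ) * ∫ θ, (starRingEnd ℂ) (f θ) * g θ by rwa [e3] at h
  rw [← Complex.real_smul, ← integral_haarAddCircle, L2.inner_def]
  refine integral_congr_ae ?_
  filter_upwards [hf.haarAddCircle.coeFn_toLp, hg.haarAddCircle.coeFn_toLp] with θ h1 h2
  rw [h1, h2, RCLike.inner_apply, mul_comm]

theorem fourierCoeff_lift_deriv {ψ : ℝ → ℝ} (hψ : ContDiff ℝ ∞ ψ)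
    (hp : Function.Periodic ψ (2 * π)) {p q : SpatialCircle → ℂ}
    (hP : ∀ r : ℝ, p r = (ψ r : ℂ)) (hq : ∀ r : ℝ, q r = ((deriv ψ r : ℝ) : ℂ)) (ζ : ℤ) :
    fourierCoeff q ζ = Complex.I * ζ * fourierCoeff p ζ := by
  rw [fourierCoeff_eq_intervalIntegral _ _ 0, fourierCoeff_eq_intervalIntegral _ _ 0, zero_add]
  simp only [smul_eq_mul, hP, hq, Complex.real_smul]
  have hd : ∀ r : ℝ, HasDerivAt (fun r : ℝ => (ψ r : ℂ)) ((deriv ψ r : ℝ) : ℂ) r := fun r =>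
    ((hψ.differentiable (by simp)).differentiableAt.hasDerivAt).ofReal_comp
  have he : ∀ r : ℝ, HasDerivAt (fun r : ℝ => (fourier (-ζ) (r : SpatialCircle) : ℂ))
      (-Complex.I * ζ * fourier (-ζ) (r : SpatialCircle)) r := fun r => by
    refine (hasDerivAt_fourier_neg (2 * π) ζ r).congr_deriv ?_
    have : (π : ℂ) ≠ 0 := Complex.ofReal_ne_zero.2 pi_ne_zero
    push_cast
    field_simp
  have hc : Continuous fun r : ℝ => (fourier (-ζ) (r : SpatialCircle) : ℂ) :=
    continuous_iff_continuousAt.2 fun r => (he r).continuousAt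
  have hc' : Continuous (deriv ψ) := hψ.continuous_deriv (by simp)
  have h := intervalIntegral.integral_mul_deriv_eq_deriv_mul (a := 0) (b := 2 * π)
    (fun r _ => he r) (fun r _ => hd r)
    (Continuous.intervalIntegrable (by fun_prop) _ _)
    (Continuous.intervalIntegrable (by fun_prop) _ _)
  have hb : ψ (2 * π) = ψ 0 := by simpa using hp 0
  have hb' : ((2 * π : ℝ) : SpatialCircle) = ((0 : ℝ) : SpatialCircle) := by simp
  rw [h, hb, hb', sub_self, zero_sub]
  simp only [mul_assoc, intervalIntegral.integral_const_mul]
  ring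

/-- A state whose Fourier coefficients decay as those of an `H¹` function has a weak derivative. -/
theorem exists_hasWeakDeriv (x : StateSpace n) {Q : ℝ}
    (hQ : ∀ G : Finset ℤ, ∑ ζ ∈ G, (ζ : ℝ) ^ 2 * ‖modeCLM ζ x‖ ^ 2 ≤ Q) :
    ∃ g : StateSpace n, HasWeakDeriv x g ∧ ‖g‖ ^ 2 ≤ 2 * π * Q := by
  have hs : Summable fun ζ : ℤ => (ζ : ℝ) ^ 2 * ‖modeCLM ζ x‖ ^ 2 :=
    summable_of_sum_le (fun _ => by positivity) hQ
  have ha : ∀ i, Summable fun ζ : ℤ => ‖Complex.I * ζ * modeCLM ζ x i‖ ^ 2 := fun i => by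
    refine hs.of_nonneg_of_le (fun _ => by positivity) fun ζ => ?_
    rw [norm_mul, norm_mul, Complex.norm_I, one_mul, mul_pow, Complex.norm_intCast, sq_abs]
    gcongr
    exact PiLp.norm_apply_le _ i
  choose G hG hGc using fun i => exists_memLp_fourierCoeff_eq (ha i)
  -- Riesz–Fischer gives complex functions G i. Taking real parts avoids proving that they are real:
  -- the tests and the state are real, and the norm does not increase.
  have hm : MemLp (fun θ => (WithLp.toLp 2 fun i => (G i θ).re : EuclideanSpace ℝ (Fin n))) 2 := by
    refine MemLp.of_eval_piLp fun i => ?_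
    exact (hG i).re
  refine ⟨hm.toLp _, ?_, ?_⟩
  · rw [hasWeakDeriv_iff]
    intro ψ hψ hp i
    have hp' : Function.Periodic (deriv ψ) (2 * π) := fun r => by
      have h1 : (fun r => ψ (r + 2 * π)) = ψ := funext hp
      rw [← deriv_comp_add_const, h1]
    have hc' : Continuous (deriv ψ) := hψ.continuous_deriv (by simp)
    set p : SpatialCircle → ℂ := fun θ => (hp.lift θ : ℂ) with hpdef
    set q : SpatialCircle → ℂ := fun θ => (hp'.lift θ : ℂ) with hqdef
    have hpr : ∀ r : ℝ, p r = (ψ r : ℂ) := fun r => rfl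
    have hqr : ∀ r : ℝ, q r = ((deriv ψ r : ℝ) : ℂ) := fun r => rfl
    have hpc : Continuous p := Complex.continuous_ofReal.comp
      (continuous_coinduced_dom.2 hψ.continuous)
    have hqc : Continuous q := Complex.continuous_ofReal.comp (continuous_coinduced_dom.2 hc')
    have hpm : MemLp p 2 := hpc.memLp_of_hasCompactSupport (HasCompactSupport.of_compactSpace _)
    have hqm : MemLp q 2 := hqc.memLp_of_hasCompactSupport (HasCompactSupport.of_compactSpace _)
    -- Integration by parts against ψ is checked coefficientwise through Parseval: the factor iζ
    -- moves from the test function to the state, with a sign from conjugation.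
    have s1 := hasSum_conj_mul_fourierCoeff hqm (memLp_clm_comp (entryCLM i) x)
    have s2 := (hasSum_conj_mul_fourierCoeff hpm (hG i)).neg
    have e : (fun ζ => (starRingEnd ℂ) (fourierCoeff q ζ) *
          fourierCoeff (fun θ => entryCLM i (x θ)) ζ) =
        fun ζ => -((starRingEnd ℂ) (fourierCoeff p ζ) * fourierCoeff (G i) ζ) := by
      ext ζ
      rw [hGc, fourierCoeff_lift_deriv hψ hp hpr hqr, map_mul, map_mul, Complex.conj_I,
        modeCLM_apply]
      simp only [map_intCast, entryCLM_apply]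
      ring
    rw [e] at s1
    have s3 := s1.unique s2
    have hpi : (((2 * π)⁻¹ : ℝ) : ℂ) ≠ 0 := Complex.ofReal_ne_zero.2 (by positivity)
    rw [← mul_neg] at s3
    have s4 := mul_left_cancel₀ hpi s3
    have k1 := AddCircle.intervalIntegral_preimage (2 * π) 0 fun θ => q θ * ((x θ) i : ℂ)
    have k2 := AddCircle.intervalIntegral_preimage (2 * π) 0
      fun θ => p θ * ((hm.toLp _ θ) i : ℂ)
    rw [zero_add] at k1 k2
    simp only [hpr, hqr] at k1 k2
    rw [k1, k2]
    have hi : Integrable fun θ => (starRingEnd ℂ) (p θ) * G i θ :=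
      MemLp.integrable_mul (p := 2) (q := 2) hpm.star (hG i)
    have k3 : ∫ θ, q θ * ((x θ) i : ℂ) =
        ((∫ θ, (starRingEnd ℂ) (q θ) * entryCLM i (x θ) : ℂ).re : ℂ) := by
      have : (fun θ => (starRingEnd ℂ) (q θ) * entryCLM i (x θ)) =
          fun θ => ((hp'.lift θ * (x θ) i : ℝ) : ℂ) := by
        ext θ
        simp only [hqdef, Complex.conj_ofReal, entryCLM_apply, Complex.ofReal_mul]
      have h2 : (fun θ => q θ * ((x θ) i : ℂ)) =
          fun θ => ((hp'.lift θ * (x θ) i : ℝ) : ℂ) := by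
        ext θ
        simp only [hqdef, Complex.ofReal_mul]
      rw [this, h2, integral_complex_ofReal, Complex.ofReal_re]
    have k4 : ∫ θ, p θ * ((hm.toLp _ θ) i : ℂ) =
        ((∫ θ, (starRingEnd ℂ) (p θ) * G i θ : ℂ).re : ℂ) := by
      have h1 := integral_re hi
      simp only [RCLike.re_to_complex] at h1
      rw [← h1, ← integral_complex_ofReal]
      refine integral_congr_ae ?_
      filter_upwards [hm.coeFn_toLp] with θ hθ
      rw [hθ]
      simp [hpdef]
    rw [k3, k4, s4, Complex.neg_re, Complex.ofReal_neg]
  · have h1 : ‖hm.toLp _‖ ^ 2 = ∫ θ, ∑ i, (G i θ).re ^ 2 := by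
      rw [← integral_norm_sq_eq]
      refine integral_congr_ae ?_
      filter_upwards [hm.coeFn_toLp] with θ hθ
      simp only [hθ, EuclideanSpace.real_norm_sq_eq]
    have hG2 : ∀ i, Integrable fun θ => ‖G i θ‖ ^ 2 := fun i =>
      (memLp_two_iff_integrable_sq_norm (hG i).1).1 (hG i)
    have h2 : ∫ θ, ∑ i, (G i θ).re ^ 2 ≤ ∫ θ, ∑ i, ‖G i θ‖ ^ 2 := by
      refine integral_mono_of_nonneg (Eventually.of_forall fun θ => ?_)
        (integrable_finsetSum _ fun i _ => hG2 i) (Eventually.of_forall fun θ => ?_)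
      · exact Finset.sum_nonneg fun i _ => sq_nonneg _
      · refine Finset.sum_le_sum fun i _ => ?_
        rw [← sq_abs]
        gcongr
        exact Complex.abs_re_le_norm _
    have h3 : ∀ i, HasSum (fun ζ : ℤ => (ζ : ℝ) ^ 2 * ‖modeCLM ζ x i‖ ^ 2)
        ((2 * π)⁻¹ * ∫ θ, ‖G i θ‖ ^ 2) := fun i => by
      have := hasSum_norm_sq_fourierCoeff (hG i)
      simp_rw [hGc, norm_mul, Complex.norm_I, one_mul, mul_pow, Complex.norm_intCast,
        sq_abs] at this
      exact this
    have h4 := hasSum_sum (s := Finset.univ) fun i _ => h3 i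
    simp_rw [← Finset.mul_sum, ← EuclideanSpace.norm_sq_eq] at h4
    rw [← integral_finsetSum _ fun i _ => hG2 i] at h4
    have h5 := hasSum_le_of_sum_le h4 hQ
    have h6 := mul_le_mul_of_nonneg_left h5 two_pi_pos.le
    rw [mul_inv_cancel_left₀ two_pi_pos.ne'] at h6
    linarith

end WeakDerivative

/-! ### Spatial differences, and the mode equations of a solution. -/

section Modes

open AddCircle

variable {n : ℕ}

theorem norm_fourier_sub_one_le (ζ : ℤ) (h : SpatialCircle) : ‖(fourier ζ h : ℂ) - 1‖ ≤ 2 := by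
  refine (norm_sub_le _ _).trans ?_
  rw [fourier_apply, Circle.norm_coe, norm_one]
  norm_num

theorem summable_norm_sq_difference (h : SpatialCircle) (x : StateSpace n) :
    Summable fun ζ : ℤ => ‖((fourier ζ h : ℂ) - 1) • modeCLM ζ x‖ ^ 2 := by
  refine ((hasSum_norm_sq_modeCLM x).summable.mul_left 4).of_nonneg_of_le
    (fun _ => by positivity) fun ζ => ?_
  rw [norm_smul, mul_pow]
  gcongr
  have := norm_fourier_sub_one_le ζ h
  nlinarith [norm_nonneg ((fourier ζ h : ℂ) - 1)]

/-- A bound on all differences gives a bound on the weak derivative. -/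
theorem exists_hasWeakDeriv_of_differences {x x₀ g₀ : StateSpace n} (hg : HasWeakDeriv x₀ g₀)
    {M : ℝ} (hM : 0 ≤ M)
    (hd : ∀ h : ℝ, ∑' ζ : ℤ, ‖((fourier ζ (h : SpatialCircle) : ℂ) - 1) • modeCLM ζ x‖ ^ 2 ≤
      M * ∑' ζ : ℤ, ‖((fourier ζ (h : SpatialCircle) : ℂ) - 1) • modeCLM ζ x₀‖ ^ 2) :
    ∃ g : StateSpace n, HasWeakDeriv x g ∧ ‖g‖ ^ 2 ≤ M * ‖g₀‖ ^ 2 := by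
  have hs := hasSum_norm_sq_modeCLM g₀
  simp_rw [hg.modeCLM_eq, norm_smul, norm_mul, Complex.norm_I, one_mul, mul_pow,
    Complex.norm_intCast, sq_abs] at hs
  -- Since |e^{iζh} − 1| ≤ |ζh|, differences of x₀ are at most |h| times its derivative in norm.
  have h1 : ∀ h : ℝ, ∑' ζ : ℤ, ‖((fourier ζ (h : SpatialCircle) : ℂ) - 1) • modeCLM ζ x₀‖ ^ 2 ≤
      h ^ 2 * ((2 * π)⁻¹ * ‖g₀‖ ^ 2) := fun h => by
    rw [← (hs.mul_left (h ^ 2)).tsum_eq]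
    refine (summable_norm_sq_difference _ x₀).tsum_le_tsum (fun ζ => ?_)
      (hs.mul_left (h ^ 2)).summable
    rw [norm_smul, mul_pow, ← mul_assoc, ← mul_pow h (ζ : ℝ), ← sq_abs (h * ζ)]
    gcongr
    rw [fourier_coe_eq, mul_comm h]
    exact Real.norm_exp_I_mul_ofReal_sub_one_le
  obtain ⟨g, hxg, hg'⟩ := exists_hasWeakDeriv x (Q := M * ((2 * π)⁻¹ * ‖g₀‖ ^ 2)) fun G => by
    have h2 : ∀ ζ : ℤ, Tendsto
        (fun h : ℝ => h⁻¹ • ((fourier ζ (h : SpatialCircle) : ℂ) - 1)) (𝓝[≠] 0)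
        (𝓝 (Complex.I * ζ)) := fun ζ => by
      have h3 := (hasDerivAt_fourier (2 * π) ζ 0).tendsto_slope_zero
      have : (π : ℂ) ≠ 0 := Complex.ofReal_ne_zero.2 pi_ne_zero
      convert h3 using 2
      · simp
      · simp
        field_simp
    -- The limit h → 0 is taken in finite partial sums, where it is termwise. No weak
    -- differentiability of x is presupposed.
    have h4 : Tendsto (fun h : ℝ => ∑ ζ ∈ G,
        ‖h⁻¹ • ((fourier ζ (h : SpatialCircle) : ℂ) - 1)‖ ^ 2 * ‖modeCLM ζ x‖ ^ 2) (𝓝[≠] 0)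
        (𝓝 (∑ ζ ∈ G, ‖Complex.I * ζ‖ ^ 2 * ‖modeCLM ζ x‖ ^ 2)) :=
      tendsto_finsetSum _ fun ζ _ => ((h2 ζ).norm.pow 2).mul_const _
    simp_rw [norm_mul, Complex.norm_I, one_mul, Complex.norm_intCast, sq_abs] at h4
    refine le_of_tendsto h4 (eventually_mem_nhdsWithin.mono fun h hh => ?_)
    have h5 : ∑ ζ ∈ G, ‖h⁻¹ • ((fourier ζ (h : SpatialCircle) : ℂ) - 1)‖ ^ 2 *
        ‖modeCLM ζ x‖ ^ 2 = (h ^ 2)⁻¹ * ∑ ζ ∈ G,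
          ‖((fourier ζ (h : SpatialCircle) : ℂ) - 1) • modeCLM ζ x‖ ^ 2 := by
      rw [Finset.mul_sum]
      refine Finset.sum_congr rfl fun ζ _ => ?_
      rw [norm_smul, norm_smul, norm_eq_abs, mul_pow, mul_pow, sq_abs, inv_pow, mul_assoc]
    have h6 : 0 < h ^ 2 := by have : h ≠ 0 := hh; positivity
    rw [h5, inv_mul_le_iff₀ h6]
    calc _ ≤ _ := (summable_norm_sq_difference (h : SpatialCircle) x).sum_le_tsum G
          fun _ _ => by positivity
      _ ≤ _ := hd h
      _ ≤ M * (h ^ 2 * ((2 * π)⁻¹ * ‖g₀‖ ^ 2)) := by gcongr; exact h1 h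
      _ = _ := by ring
  refine ⟨g, hxg, hg'.trans_eq ?_⟩
  have := pi_pos.ne'
  field_simp

/-- The complex vector with the given real entries. -/
noncomputable def complexVector (a : Fin n → ℝ) : EuclideanSpace ℂ (Fin n) :=
  WithLp.toLp 2 fun i => (a i : ℂ)

/-- The functional `x ↦ C x` on complex vectors. -/
noncomputable def outputCLM (C : Fin n → ℝ) : EuclideanSpace ℂ (Fin n) →L[ℂ] ℂ :=
  ∑ i, (C i : ℂ) • EuclideanSpace.proj i

theorem outputCLM_apply (C : Fin n → ℝ) (x : EuclideanSpace ℂ (Fin n)) :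
    outputCLM C x = ∑ i, (C i : ℂ) * x i := by
  simp [outputCLM]

/-- The operator of the mode `ζ` after the substitution `z(t) = e^{μt} x(t)`. -/
noncomputable def modeOperator (D A : Matrix (Fin n) (Fin n) ℝ) (μ : ℝ) (ζ : ℤ) :
    EuclideanSpace ℂ (Fin n) →L[ℂ] EuclideanSpace ℂ (Fin n) :=
  Matrix.toEuclideanCLM (𝕜 := ℂ) (modeMatrix D A ζ + (μ : ℂ) • 1)

theorem modeOperator_apply (D A : Matrix (Fin n) (Fin n) ℝ) (μ : ℝ) (ζ : ℤ)
    (x : EuclideanSpace ℂ (Fin n)) : (modeOperator D A μ ζ x).ofLp =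
      (modeMatrix D A ζ + (μ : ℂ) • (1 : Matrix (Fin n) (Fin n) ℂ)) *ᵥ x.ofLp := rfl

variable {D A : Matrix (Fin n) (Fin n) ℝ} {B C : Fin n → ℝ} {φ : ℝ → ℝ} {K₁ K₂ : ℝ}
  {x : ℝ → StateSpace n}

/-- Apply the continuous functional of the ζ-th coefficient to the equation; the Laplacian becomes
multiplication by −ζ². -/
theorem IsSolution.hasDerivAt_modeCLM (hx : IsSolution D A B C φ x) (hφ : ContDiff ℝ 1 φ)
    (hK : K₁ ≤ K₂) (hsector : ∀ η : ℝ, (deriv φ η - K₁) * (deriv φ η - K₂) ≤ 0) (ζ : ℤ) {t : ℝ}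
    (ht : 0 < t) : HasDerivAt (fun t => modeCLM ζ (x t))
      (modeOperator D A 0 ζ (modeCLM ζ (x t)) + inputCoeff φ C ζ (x t) • complexVector B) t := by
  have h1 : HasDerivAt x (deriv x t) t :=
    ((hx.contDiffOn.differentiableOn one_ne_zero).differentiableAt (Ioi_mem_nhds ht)).hasDerivAt
  refine ((modeCLM ζ).hasFDerivAt.comp_hasDerivAt t h1).congr_deriv ?_
  obtain ⟨w, hw, heq⟩ := hx.equation t ht
  ext i
  have h2 : (fun θ => ((deriv x t θ) i : ℂ)) =ᵐ[haarAddCircle] fun θ =>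
      ((((D i ⬝ᵥ (w θ).ofLp : ℝ) : ℂ) + ((A i ⬝ᵥ (x t θ).ofLp : ℝ) : ℂ)) +
        (B i : ℂ) * ((-φ (C ⬝ᵥ (x t θ).ofLp) : ℝ) : ℂ)) := by
    filter_upwards [haarAddCircle_absolutelyContinuous.ae_le heq] with θ hθ
    have := congrFun hθ i
    rw [this]
    simp only [Pi.add_apply, Pi.sub_apply, Pi.smul_apply, smul_eq_mul, Matrix.mulVec]
    push_cast
    ring
  have m1 := memLp_output (D i) w
  have m2 := memLp_output (A i) (x t)
  have m3 := (memLp_input hφ hK hsector C (x t)).const_mul (B i : ℂ)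
  have m12 : MemLp (fun θ => ((D i ⬝ᵥ (w θ).ofLp : ℝ) : ℂ) + ((A i ⬝ᵥ (x t θ).ofLp : ℝ) : ℂ)) 2 :=
    m1.add m2
  rw [modeCLM_apply, fourierCoeff_congr_ae h2, fourierCoeff_add' m12 m3,
    fourierCoeff_add' m1 m2, fourierCoeff_dotProduct, fourierCoeff_dotProduct,
    fourierCoeff.const_mul, hw.modeCLM_eq, PiLp.add_apply, modeOperator_apply, PiLp.smul_apply]
  have h3 : ∀ j, (modeMatrix D A ζ) i j = (A i j : ℂ) - (ζ : ℂ) ^ 2 * D i j := fun j => by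
    simp [modeMatrix]
  simp only [Complex.ofReal_zero, zero_smul, add_zero, Matrix.mulVec, dotProduct, h3,
    PiLp.smul_apply, smul_eq_mul]
  rw [← Finset.sum_add_distrib, complexVector, mul_comm (B i : ℂ)]
  congr 1
  refine Finset.sum_congr rfl fun j _ => ?_
  ring

theorem continuous_inputCoeff (hφ : ContDiff ℝ 1 φ)
    (hK : K₁ ≤ K₂) (hsector : ∀ η : ℝ, (deriv φ η - K₁) * (deriv φ η - K₂) ≤ 0)
    (C : Fin n → ℝ) (ζ : ℤ) : Continuous (inputCoeff φ C ζ) :=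
  LipschitzWith.continuous (K := Real.toNNReal
    ((|(K₁ + K₂) / 2| + (K₂ - K₁) / 2) * ‖dotCLM C‖)) <| LipschitzWith.of_dist_le_mul
    fun y y' => by
      rw [dist_eq_norm, dist_eq_norm]
      refine (norm_inputCoeff_sub_le hφ hK hsector C ζ y y').trans ?_
      gcongr
      exact le_coe_toNNReal _

/-- The modes of the differences `x(θ + h, t) - x(θ, t)`, weighted by `e^{μt}`, are trajectories of
the shifted mode systems. -/
theorem IsSolution.isTrajectory (hx : IsSolution D A B C φ x) (hφ : ContDiff ℝ 1 φ)
    (hK : K₁ ≤ K₂) (hsector : ∀ η : ℝ, (deriv φ η - K₁) * (deriv φ η - K₂) ≤ 0) (μ : ℝ) (ζ : ℤ)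
    (a : ℂ) : IsTrajectory (modeOperator D A μ ζ) (complexVector B)
      (fun t => (Real.exp (μ * t) * a) • modeCLM ζ (x t))
      (fun t => Real.exp (μ * t) * a * inputCoeff φ C ζ (x t)) where
  continuousOn_state := ContinuousOn.smul
    (f := fun t : ℝ => (Real.exp (μ * t) * a : ℂ)) (by fun_prop)
    ((modeCLM ζ).continuous.comp_continuousOn hx.continuousOn)
  continuousOn_input := ContinuousOn.mul
    (f := fun t : ℝ => (Real.exp (μ * t) * a : ℂ)) (by fun_prop)
    ((continuous_inputCoeff hφ hK hsector C ζ).comp_continuousOn hx.continuousOn)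
  hasDerivAt t ht := by
    have h1 : HasDerivAt (fun t : ℝ => (Real.exp (μ * t) : ℂ) * a) (μ * Real.exp (μ * t) * a) t := by
      have h2 : HasDerivAt (fun t : ℝ => Real.exp (μ * t)) (Real.exp (μ * t) * μ) t := by
        simpa using ((hasDerivAt_id t).const_mul μ).exp
      refine (h2.ofReal_comp.mul_const a).congr_deriv ?_
      push_cast
      ring
    refine (h1.smul (hx.hasDerivAt_modeCLM hφ hK hsector ζ ht)).congr_deriv ?_
    ext i
    simp only [PiLp.add_apply, PiLp.smul_apply, modeOperator_apply, smul_eq_mul, map_smul,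
      Matrix.add_mulVec, Matrix.smul_mulVec, Matrix.one_mulVec, Pi.add_apply, Pi.smul_apply,
      Complex.ofReal_zero, zero_smul, add_zero, smul_add]
    ring

end Modes

/-! ### Verification of the stability and dissipativity hypotheses for each mode. -/

section ModeSystems

open scoped InnerProductSpace

variable {n : ℕ} {D A : Matrix (Fin n) (Fin n) ℝ} {B C : Fin n → ℝ} {K₁ K₂ μ : ℝ} {ζ : ℤ}

theorem transferFunction_sub (z : ℂ) : transferFunction D A B C ζ (z - μ) =
    (fun i => (C i : ℂ)) ⬝ᵥ ((z • (1 : Matrix (Fin n) (Fin n) ℂ) -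
      (modeMatrix D A ζ + (μ : ℂ) • 1))⁻¹ *ᵥ fun i => (B i : ℂ)) := by
  rw [transferFunction, sub_smul, sub_sub, add_comm (modeMatrix D A ζ)]

/-- A meromorphic function without a pole at s has a finite limit there, so s cannot be an
eigenvalue once hidden modes are excluded. The shift by μ turns Re s ≥ −μ into the closed right
half-plane. -/
theorem shifted_mulVec_ne (hmodes : NoHiddenModes D A B C μ ζ)
    (hpoles : ∀ s : ℂ, 0 ≤ s.re → ¬ IsPole (fun z => transferFunction D A B C ζ (z - μ)) s)
    (s : ℂ) (x : Fin n → ℂ) (hx : x ≠ 0)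
    (hs : (modeMatrix D A ζ + (μ : ℂ) • (1 : Matrix (Fin n) (Fin n) ℂ)) *ᵥ x = s • x) :
    s.re < 0 := by
  by_contra! h0
  have hm : MeromorphicAt (fun z => transferFunction D A B C ζ (z - μ)) s :=
    meromorphicAt_transfer _ _ _ _ _
  have ho : 0 ≤ meromorphicOrderAt (fun z => transferFunction D A B C ζ (z - μ)) s := by
    by_contra! h1
    exact hpoles s h0 ⟨hm, h1⟩
  obtain ⟨g, hg⟩ := tendsto_nhds_of_meromorphicOrderAt_nonneg hm ho
  simp_rw [transferFunction_sub] at hg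
  have hre : -μ ≤ (s - μ).re := by simpa using h0
  refine not_eigenvalue_of_tendsto (fun v hv h1 => ?_) (fun v hv h1 => ?_) hg x hx hs
  · refine (hmodes (s - μ) hre v hv).1 ?_
    rw [Matrix.vecMul_add, Matrix.vecMul_smul, Matrix.vecMul_one] at h1
    rw [sub_smul, ← h1, add_sub_cancel_right]
  · refine (hmodes (s - μ) hre v hv).2 ?_
    rw [Matrix.add_mulVec, Matrix.smul_mulVec, Matrix.one_mulVec] at h1
    rw [sub_smul, ← h1, add_sub_cancel_right]

theorem isHurwitz_modeOperator (hmodes : NoHiddenModes D A B C μ ζ)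
    (hpoles : ∀ s : ℂ, 0 ≤ s.re → ¬ IsPole (fun z => transferFunction D A B C ζ (z - μ)) s) :
    IsHurwitz (modeOperator D A μ ζ) := fun s x hx hs =>
  shifted_mulVec_ne hmodes hpoles s x.ofLp (fun h => hx (WithLp.ofLp_injective 2 h))
    (congrArg WithLp.ofLp hs)

theorem isHurwitz_feedback {κ : ℝ} (hκ : κ ≠ 0) (hmodes : NoHiddenModes D A B C μ ζ)
    (hpoles : ∀ s : ℂ, 0 ≤ s.re → ¬ IsPole (fun z => transferFunction D A B C ζ (z - μ)) s)
    (hw : HasWindingNumber (nyquistCurve fun z => transferFunction D A B C ζ (z - μ))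
      (-1 / κ : ℝ) 0) :
    IsHurwitz (feedback (modeOperator D A μ ζ) (complexVector B) (outputCLM C) κ) := by
  intro s x hx hs
  refine nyquist_criterion (B := fun i => (B i : ℂ)) (C := fun i => (C i : ℂ)) hκ
    (shifted_mulVec_ne hmodes hpoles) ?_ s x.ofLp (fun h => hx (WithLp.ofLp_injective 2 h)) ?_
  · convert hw using 1
    ext τ
    rw [nyquistCurve, transferFunction_sub]
  · rw [feedback_apply] at hs
    have h1 := congrArg WithLp.ofLp hs
    rw [WithLp.ofLp_add, modeOperator_apply, WithLp.ofLp_smul, WithLp.ofLp_smul] at h1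
    rw [← h1, Matrix.sub_mulVec, sub_eq_add_neg, Matrix.smul_mulVec, Matrix.vecMulVec_mulVec,
      outputCLM_apply]
    congr 1
    ext i
    simp [complexVector, dotProduct]
    ring

/-- Since iτ is not an eigenvalue, c x = v G, and the inequality reduces to k²|G|² ≤ |1 + κ₀G|².
Expanding with κ₀² − k² = K₁K₂ and 2κ₀ = K₁ + K₂ gives the hypothesis. -/
theorem frequencyInequality_modeOperator (hA : IsHurwitz (modeOperator D A μ ζ))
    (hG : ∀ τ : ℝ, 0 ≤ K₁ * K₂ *
      Complex.normSq (nyquistCurve (fun z => transferFunction D A B C ζ (z - μ)) τ) +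
      (K₁ + K₂) * (nyquistCurve (fun z => transferFunction D A B C ζ (z - μ)) τ).re + 1) :
    FrequencyInequality (modeOperator D A μ ζ) (complexVector B) (outputCLM C)
      ((K₁ + K₂) / 2) ((K₂ - K₁) / 2) := by
  intro τ x v hx
  set M := modeMatrix D A ζ + (μ : ℂ) • (1 : Matrix (Fin n) (Fin n) ℂ) with hM
  set G := nyquistCurve (fun z => transferFunction D A B C ζ (z - μ)) τ with hGdef
  have hdet : ((Complex.I * τ) • (1 : Matrix (Fin n) (Fin n) ℂ) - M).det ≠ 0 := by
    rw [← eval_charpoly_eq_det]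
    intro h0
    obtain ⟨y, hy, h1⟩ := (eval_charpoly_eq_zero_iff M _).1 h0
    have h2 := hA (Complex.I * τ) (WithLp.toLp 2 y)
      (fun h => hy (WithLp.toLp_injective 2 h)) (WithLp.ofLp_injective 2 h1)
    simp at h2
  have h1 : ((Complex.I * τ) • (1 : Matrix (Fin n) (Fin n) ℂ) - M) *ᵥ x.ofLp =
      v • fun i => (B i : ℂ) := by
    have h2 := congrArg WithLp.ofLp hx
    rw [WithLp.ofLp_add, modeOperator_apply, WithLp.ofLp_smul, WithLp.ofLp_smul] at h2
    rw [Matrix.sub_mulVec, Matrix.smul_mulVec, Matrix.one_mulVec, h2, add_sub_cancel_left]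
    rfl
  have h3 : outputCLM C x = v * G := by
    have h4 := congrArg (((Complex.I * τ) • (1 : Matrix (Fin n) (Fin n) ℂ) - M)⁻¹ *ᵥ ·) h1
    simp only [Matrix.mulVec_mulVec, Matrix.nonsing_inv_mul _ hdet.isUnit, Matrix.one_mulVec,
      Matrix.mulVec_smul] at h4
    have h5 : outputCLM C x = (fun i => (C i : ℂ)) ⬝ᵥ x.ofLp := outputCLM_apply C x
    rw [h5, h4, dotProduct_smul, smul_eq_mul, hGdef, nyquistCurve, transferFunction_sub]
  have h6 : v + ((K₁ + K₂) / 2 : ℝ) * (v * G) = v * (1 + ((K₁ + K₂) / 2 : ℝ) * G) := by ring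
  rw [h3, h6, norm_mul, norm_mul, mul_pow, mul_pow, mul_left_comm]
  refine mul_le_mul_of_nonneg_left ?_ (sq_nonneg _)
  have h7 := hG τ
  rw [← hGdef] at h7
  rw [← Complex.normSq_eq_norm_sq, ← Complex.normSq_eq_norm_sq]
  rw [Complex.normSq_apply] at h7 ⊢
  rw [Complex.normSq_apply]
  simp only [Complex.add_re, Complex.add_im, Complex.one_re, Complex.one_im,
    Complex.re_ofReal_mul, Complex.im_ofReal_mul]
  nlinarith

/-- Completing the square identifies the frequency condition with a position relative to the disk.
The sign of K₁K₂ decides between outside and inside. -/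
theorem normSq_add_re_add_one (h1 : K₁ ≠ 0) (h2 : K₂ ≠ 0) (G : ℂ) :
    K₁ * K₂ * Complex.normSq G + (K₁ + K₂) * G.re + 1 =
      K₁ * K₂ * ((G.re + (K₁ + K₂) / (2 * K₁ * K₂)) ^ 2 + G.im ^ 2 -
        ((K₂ - K₁) / (2 * K₁ * K₂)) ^ 2) := by
  rw [Complex.normSq_apply]
  field_simp
  ring

/-- The gain κ is the harmonic mean of K₁ and K₂, for which −1/κ is the centre of the disk. It lies
strictly inside the sector because (K₂−K₁)² < (K₁+K₂)² when K₁K₂ > 0. -/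
theorem exists_isDissipativeUpToDecay_of_outside (hK : 0 < K₁ * K₂) (hne : K₁ < K₂)
    (hmodes : NoHiddenModes D A B C μ ζ)
    (hpoles : ∀ s : ℂ, 0 ≤ s.re → ¬ IsPole (fun z => transferFunction D A B C ζ (z - μ)) s)
    (hN : OutsideWithoutEncirclement
      (fun z => transferFunction D A B C ζ (z - μ)) (criterionDisk K₁ K₂)) :
    ∃ R > 0, ∀ z v, IsTrajectory (modeOperator D A μ ζ) (complexVector B) z v →
      IsDissipativeUpToDecay R ((K₁ + K₂) / 2) ((K₂ - K₁) / 2) (outputCLM C) z v := by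
  have h1 : K₁ ≠ 0 := left_ne_zero_of_mul hK.ne'
  have h2 : K₂ ≠ 0 := right_ne_zero_of_mul hK.ne'
  have h3 : K₁ + K₂ ≠ 0 := fun h => by nlinarith [sq_nonneg K₁, sq_nonneg K₂]
  have hH := isHurwitz_modeOperator hmodes hpoles
  refine exists_isDissipativeUpToDecay (κ := 2 * K₁ * K₂ / (K₁ + K₂)) hH
    (frequencyInequality_modeOperator hH fun τ => ?_) (isHurwitz_feedback ?_ hmodes hpoles
      (hN.2 _ ?_)) ?_
  · rw [normSq_add_re_add_one h1 h2]
    refine mul_nonneg hK.le (sub_nonneg.2 ?_)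
    by_contra! h4
    exact Set.disjoint_left.1 hN.1 (mem_range_self τ) h4.le
  · positivity
  · simp only [criterionDisk, mem_ofPred_eq, Complex.ofReal_re, Complex.ofReal_im]
    have h4 : -1 / (2 * K₁ * K₂ / (K₁ + K₂)) + (K₁ + K₂) / (2 * K₁ * K₂) = 0 := by
      field_simp
      ring
    rw [h4]
    simpa using sq_nonneg _
  · have h4 : ((K₁ + K₂) / 2 - 2 * K₁ * K₂ / (K₁ + K₂)) ^ 2 =
        ((K₂ - K₁) / 2) ^ 2 * ((K₂ - K₁) ^ 2 / (K₁ + K₂) ^ 2) := by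
      field_simp
      ring
    rw [h4]
    refine mul_lt_of_lt_one_right (by have := sub_pos.2 hne; positivity) ?_
    rw [div_lt_one (by positivity)]
    nlinarith

/-- Zero gain lies strictly inside the sector, so the open loop itself serves as the stabilized
system and no encirclement count is needed. -/
theorem exists_isDissipativeUpToDecay_of_inside (h1 : K₁ < 0) (h2 : 0 < K₂)
    (hmodes : NoHiddenModes D A B C μ ζ)
    (hpoles : ∀ s : ℂ, 0 ≤ s.re → ¬ IsPole (fun z => transferFunction D A B C ζ (z - μ)) s)
    (hN : nyquistPlot (fun z => transferFunction D A B C ζ (z - μ)) ⊆ criterionDisk K₁ K₂) :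
    ∃ R > 0, ∀ z v, IsTrajectory (modeOperator D A μ ζ) (complexVector B) z v →
      IsDissipativeUpToDecay R ((K₁ + K₂) / 2) ((K₂ - K₁) / 2) (outputCLM C) z v := by
  have hH := isHurwitz_modeOperator hmodes hpoles
  refine exists_isDissipativeUpToDecay (κ := 0) hH
    (frequencyInequality_modeOperator hH fun τ => ?_) ?_ ?_
  · rw [normSq_add_re_add_one h1.ne h2.ne']
    exact mul_nonneg_of_nonpos_of_nonpos (mul_neg_of_neg_of_pos h1 h2).le
      (sub_nonpos.2 (hN (mem_range_self τ)))
  · simpa [feedback] using hH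
  · nlinarith

theorem re_inner_toEuclideanCLM_map (M : Matrix (Fin n) (Fin n) ℝ)
    (x : EuclideanSpace ℂ (Fin n)) :
    (⟪x, Matrix.toEuclideanCLM (𝕜 := ℂ) (M.map Complex.ofReal) x⟫_ℂ).re =
      (fun i => (x i).re) ⬝ᵥ (M *ᵥ fun i => (x i).re) +
        (fun i => (x i).im) ⬝ᵥ (M *ᵥ fun i => (x i).im) := by
  have h1 : ⟪x, Matrix.toEuclideanCLM (𝕜 := ℂ) (M.map Complex.ofReal) x⟫_ℂ =
      ∑ i, ∑ j, (starRingEnd ℂ) (x i) * ((M i j : ℂ) * x j) := by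
    rw [PiLp.inner_apply]
    refine Finset.sum_congr rfl fun i _ => ?_
    rw [← Finset.mul_sum, RCLike.inner_apply, mul_comm]
    rfl
  rw [h1]
  simp only [dotProduct, Matrix.mulVec, Complex.re_sum, Finset.mul_sum,
    ← Finset.sum_add_distrib]
  refine Finset.sum_congr rfl fun i _ => Finset.sum_congr rfl fun j _ => ?_
  simp

/-- The real and imaginary parts contribute separately to the form. It is positive on the compact
unit sphere, and its minimum there scales quadratically. -/
theorem exists_le_re_inner (hD : D.PosDef) : ∃ d > 0, ∀ x : EuclideanSpace ℂ (Fin n),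
    d * ‖x‖ ^ 2 ≤ (⟪x, Matrix.toEuclideanCLM (𝕜 := ℂ) (D.map Complex.ofReal) x⟫_ℂ).re := by
  set L := Matrix.toEuclideanCLM (𝕜 := ℂ) (D.map Complex.ofReal) with hL
  have hpos : ∀ x : EuclideanSpace ℂ (Fin n), x ≠ 0 → 0 < (⟪x, L x⟫_ℂ).re := by
    intro x hx
    rw [hL, re_inner_toEuclideanCLM_map]
    have hnn : ∀ u : Fin n → ℝ, 0 ≤ u ⬝ᵥ (D *ᵥ u) := fun u => by
      simpa using hD.posSemidef.dotProduct_mulVec_nonneg u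
    have hp : ∀ u : Fin n → ℝ, u ≠ 0 → 0 < u ⬝ᵥ (D *ᵥ u) := fun u hu => by
      simpa using hD.dotProduct_mulVec_pos hu
    by_cases h1 : (fun i => (x i).re) = 0
    · have h2 : (fun i => (x i).im) ≠ 0 := fun h2 => hx (by
        ext i
        exact Complex.ext (congrFun h1 i) (congrFun h2 i))
      linarith [hnn fun i => (x i).re, hp _ h2]
    · linarith [hnn fun i => (x i).im, hp _ h1]
  obtain ⟨d, hd, hmin⟩ : ∃ d > 0, ∀ y ∈ Metric.sphere (0 : EuclideanSpace ℂ (Fin n)) 1,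
      d ≤ (⟪y, L y⟫_ℂ).re := by
    rcases (Metric.sphere (0 : EuclideanSpace ℂ (Fin n)) 1).eq_empty_or_nonempty with h | h
    · exact ⟨1, one_pos, fun y hy => by simp [h] at hy⟩
    · obtain ⟨y, hy, hm⟩ := (isCompact_sphere _ _).exists_isMinOn h
        (f := fun y => (⟪y, L y⟫_ℂ).re) (by fun_prop)
      exact ⟨_, hpos y (ne_zero_of_mem_unit_sphere ⟨y, hy⟩), fun w hw => hm hw⟩
  refine ⟨d, hd, fun x => ?_⟩
  rcases eq_or_ne x 0 with rfl | hx
  · simp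
  have hx' : (‖x‖ : ℂ) ≠ 0 := by exact_mod_cast norm_ne_zero_iff.2 hx
  set y := ((‖x‖ : ℂ)⁻¹) • x with hy
  have h1 : x = (‖x‖ : ℂ) • y := by rw [hy, smul_smul, mul_inv_cancel₀ hx', one_smul]
  have h2 := hmin y (by
    rw [mem_sphere_zero_iff_norm, hy, norm_smul, norm_inv, Complex.norm_real, norm_norm,
      inv_mul_cancel₀ (norm_ne_zero_iff.2 hx)])
  have h3 : (⟪x, L x⟫_ℂ).re = ‖x‖ ^ 2 * (⟪y, L y⟫_ℂ).re := by
    conv_lhs => rw [h1]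
    rw [map_smul, inner_smul_left, inner_smul_right, Complex.conj_ofReal,
      Complex.re_ofReal_mul, Complex.re_ofReal_mul]
    ring
  rw [h3, mul_comm d]
  gcongr

/-- High modes are strictly dissipative. -/
theorem exists_re_inner_modeOperator_le (hD : D.PosDef) (A : Matrix (Fin n) (Fin n) ℝ)
    (μ ρ : ℝ) : ∃ N : ℕ, ∀ ζ : ℤ, (N : ℤ) < |ζ| → ∀ x,
      (⟪x, modeOperator D A μ ζ x⟫_ℂ).re ≤ -ρ * ‖x‖ ^ 2 := by
  obtain ⟨d, hd, hDd⟩ := exists_le_re_inner hD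
  set L := Matrix.toEuclideanCLM (𝕜 := ℂ) (A.map Complex.ofReal) with hL
  obtain ⟨N, hN⟩ := exists_nat_gt ((‖L‖ + μ + ρ) / d)
  refine ⟨N, fun ζ hζ x => ?_⟩
  have h1 : modeOperator D A μ ζ x = L x + (μ : ℂ) • x - (((ζ : ℝ) ^ 2 : ℝ) : ℂ) •
      Matrix.toEuclideanCLM (𝕜 := ℂ) (D.map Complex.ofReal) x := by
    ext i
    have h3 : ∀ j, (modeMatrix D A ζ) i j = (A i j : ℂ) - (ζ : ℂ) ^ 2 * D i j := fun j => by
      simp [modeMatrix]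
    rw [modeOperator_apply, Matrix.add_mulVec, Matrix.smul_mulVec, Matrix.one_mulVec]
    simp only [hL, Pi.add_apply, Matrix.mulVec, dotProduct, h3, PiLp.sub_apply, PiLp.add_apply,
      PiLp.smul_apply, Matrix.ofLp_toEuclideanCLM, Matrix.map_apply, Pi.smul_apply, sub_mul,
      Finset.sum_sub_distrib, mul_assoc, ← Finset.mul_sum, smul_eq_mul]
    push_cast
    ring
  have h2 : (⟪x, L x⟫_ℂ).re ≤ ‖L‖ * ‖x‖ ^ 2 := by
    refine (Complex.re_le_norm _).trans ((norm_inner_le_norm _ _).trans ?_)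
    have := L.le_opNorm x
    nlinarith [norm_nonneg x]
  have h4 : (⟪x, (μ : ℂ) • x⟫_ℂ).re = μ * ‖x‖ ^ 2 := by
    rw [inner_smul_right, Complex.re_ofReal_mul, inner_self_eq_norm_sq_to_K]
    norm_cast
  rw [h1, inner_sub_right, inner_add_right, Complex.sub_re, Complex.add_re, h4,
    inner_smul_right, Complex.re_ofReal_mul]
  have h5 : (N : ℝ) ≤ (ζ : ℝ) ^ 2 := by
    have h6 : (N : ℤ) ≤ ζ ^ 2 := by
      rw [← sq_abs]
      nlinarith [Int.natCast_nonneg N]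
    exact_mod_cast h6
  have h7 : ‖L‖ + μ + ρ ≤ (ζ : ℝ) ^ 2 * d := ((div_le_iff₀ hd).1 (hN.le.trans h5))
  have h8 := mul_le_mul_of_nonneg_left (hDd x) (sq_nonneg (ζ : ℝ))
  have h9 := mul_le_mul_of_nonneg_right h7 (sq_nonneg ‖x‖)
  nlinarith

end ModeSystems

/-! ### Decay of the spatial differences. -/

section Homogeneity

variable {n : ℕ} {D A : Matrix (Fin n) (Fin n) ℝ} {B C : Fin n → ℝ} {φ : ℝ → ℝ} {K₁ K₂ μ : ℝ}

theorem norm_exp_mul_smul_sq (μ t : ℝ) (a : ℂ) (x : EuclideanSpace ℂ (Fin n)) :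
    ‖((Real.exp (μ * t) : ℂ) * a) • x‖ ^ 2 = Real.exp (2 * μ * t) * ‖a • x‖ ^ 2 := by
  rw [mul_smul, norm_smul, Complex.norm_real, norm_eq_abs, abs_of_pos (Real.exp_pos _), mul_pow,
    ← Real.exp_nat_mul]
  congr 2
  push_cast
  ring

theorem norm_exp_mul_sq (μ t : ℝ) (a : ℂ) :
    ‖(Real.exp (μ * t) : ℂ) * a‖ ^ 2 = Real.exp (2 * μ * t) * ‖a‖ ^ 2 := by
  rw [norm_mul, Complex.norm_real, norm_eq_abs, abs_of_pos (Real.exp_pos _), mul_pow,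
    ← Real.exp_nat_mul]
  congr 2
  push_cast
  ring

/-- The differences `x(θ + h, t) - x(θ, t)` decay with rate `μ`, uniformly in `h`. -/
theorem exists_tsum_norm_sq_difference_le (hD : D.PosDef) (hφ : ContDiff ℝ 1 φ) (hK : K₁ ≤ K₂)
    (hsector : ∀ η : ℝ, (deriv φ η - K₁) * (deriv φ η - K₂) ≤ 0)
    (hmode : ∀ ζ : ℤ, ζ ≠ 0 → ∃ R > 0, ∀ z v,
      IsTrajectory (modeOperator D A μ ζ) (complexVector B) z v →
        IsDissipativeUpToDecay R ((K₁ + K₂) / 2) ((K₂ - K₁) / 2) (outputCLM C) z v) :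
    ∃ M > 0, ∀ x : ℝ → StateSpace n, IsSolution D A B C φ x → ∀ (h : SpatialCircle) (t : ℝ),
      0 ≤ t → Real.exp (2 * μ * t) * ∑' ζ : ℤ, ‖((fourier ζ h : ℂ) - 1) • modeCLM ζ (x t)‖ ^ 2 ≤
        M * ∑' ζ : ℤ, ‖((fourier ζ h : ℂ) - 1) • modeCLM ζ (x 0)‖ ^ 2 := by
  choose! R hR hRz using hmode
  set κ₀ := (K₁ + K₂) / 2 with hκ₀
  set k := (K₂ - K₁) / 2 with hk
  -- The dissipation rate requested is the one needed in `two_mul_re_inner_le_supply`.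
  obtain ⟨N, hN⟩ := exists_re_inner_modeOperator_le hD A μ
    ((‖complexVector B‖ ^ 2 + 2 * |κ₀| * ‖outputCLM C‖ * ‖complexVector B‖ +
      k ^ 2 * ‖outputCLM C‖ ^ 2) / 2)
  set F := (Finset.Icc (-(N : ℤ)) N).erase 0 with hF
  have hRpos : ∀ ζ ∈ F, 0 < R ζ := fun ζ hζ => hR ζ (Finset.ne_of_mem_erase hζ)
  have hRsum : ∀ ζ ∈ F, R ζ ≤ 1 + ∑ ζ ∈ F, R ζ := fun ζ hζ =>
    (Finset.single_le_sum (fun ζ hζ => (hRpos ζ hζ).le) hζ).trans (by linarith)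
  have hC : 0 < 1 + ∑ ζ ∈ F, R ζ :=
    add_pos_of_pos_of_nonneg one_pos (Finset.sum_nonneg fun ζ hζ => (hRpos ζ hζ).le)
  obtain ⟨M, hM, hMz⟩ := exists_tsum_norm_sq_le F hC κ₀ k (outputCLM C)
  refine ⟨M, hM, fun x hx h T hT => ?_⟩
  have htraj := fun ζ : ℤ => hx.isTrajectory hφ hK hsector μ ζ ((fourier ζ h : ℂ) - 1)
  have hout : ∀ (ζ : ℤ) (t : ℝ), outputCLM C
      (((Real.exp (μ * t) : ℂ) * ((fourier ζ h : ℂ) - 1)) • modeCLM ζ (x t)) =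
      (Real.exp (μ * t) : ℂ) *
        (((fourier ζ h : ℂ) - 1) * ∑ i, (C i : ℂ) * modeCLM ζ (x t) i) := fun ζ t => by
    rw [map_smul, outputCLM_apply, smul_eq_mul, mul_assoc]
  have hfin := hMz
    (fun ζ t => ((Real.exp (μ * t) : ℂ) * ((fourier ζ h : ℂ) - 1)) • modeCLM ζ (x t))
    (fun ζ t => (Real.exp (μ * t) : ℂ) * ((fourier ζ h : ℂ) - 1) * inputCoeff φ C ζ (x t))
    (fun ζ => (htraj ζ).continuousOn_state) (fun ζ => (htraj ζ).continuousOn_input)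
    (fun ζ hζ => (hRz ζ (Finset.ne_of_mem_erase hζ) _ _ (htraj ζ)).mono (hRpos ζ hζ)
      (hRsum ζ hζ))
    (fun ζ hζ T hT => ?_) (fun t _ => ?_) (fun t _ => ?_) (fun T => ?_) (fun t _ => ?_) T hT
  · simp only [norm_exp_mul_smul_sq, tsum_mul_left, mul_zero, Real.exp_zero, Complex.ofReal_one,
      one_mul] at hfin
    exact hfin
  · rcases eq_or_ne ζ 0 with rfl | hζ0
    -- The mode ζ = 0, on which there is no Nyquist hypothesis, has the zero trajectory because the
    -- factor e^{iζh} − 1 vanishes.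
    · simp [supply]
    · have hζN : (N : ℤ) < |ζ| := by
        by_contra! h1
        exact hζ (Finset.mem_erase.2 ⟨hζ0, Finset.mem_Icc.2 (abs_le.1 h1)⟩)
      exact norm_sq_le_add_integral_supply (two_mul_re_inner_le_supply (hN ζ hζN) (by linarith))
        (htraj ζ) hT
  · simp only [norm_exp_mul_smul_sq]
    exact (summable_norm_sq_difference h (x t)).mul_left _
  · simp only [mul_assoc, norm_exp_mul_sq]
    exact (tsum_sector_le hφ hK hsector C h (x t)).1.mul_left _
  · have hc : ContinuousOn (fun t => Real.exp (2 * μ * t) * (4 * ((2 * π)⁻¹ * ‖x t‖ ^ 2)))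
        (Icc 0 T) := by
      have := hx.continuousOn.mono (Icc_subset_Ici_self : Icc 0 T ⊆ Ici 0)
      exact ContinuousOn.mul (by fun_prop) (((this.norm.pow 2).const_mul _).const_mul _)
    obtain ⟨m, hm⟩ := isCompact_Icc.exists_bound_of_continuousOn hc
    refine ⟨m, fun t ht => ?_⟩
    refine le_trans ?_ ((le_abs_self _).trans (hm t ht))
    simp only [norm_exp_mul_smul_sq, tsum_mul_left]
    gcongr
    have h1 := hasSum_norm_sq_modeCLM (x t)
    rw [← h1.tsum_eq, ← tsum_mul_left]
    refine (summable_norm_sq_difference h (x t)).tsum_le_tsum (fun ζ => ?_)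
      (h1.summable.mul_left 4)
    rw [norm_smul, mul_pow]
    gcongr
    have := norm_fourier_sub_one_le ζ h
    nlinarith [norm_nonneg ((fourier ζ h : ℂ) - 1)]
  · have h1 := (tsum_sector_le hφ hK hsector C h (x t)).2
    rw [← hκ₀, ← hk] at h1
    have h2 : ∀ ζ : ℤ, (Real.exp (μ * t) : ℂ) * ((fourier ζ h : ℂ) - 1) *
        inputCoeff φ C ζ (x t) + κ₀ * ((Real.exp (μ * t) : ℂ) *
          (((fourier ζ h : ℂ) - 1) * ∑ i, (C i : ℂ) * modeCLM ζ (x t) i)) =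
        (Real.exp (μ * t) : ℂ) * (((fourier ζ h : ℂ) - 1) * (inputCoeff φ C ζ (x t) +
          κ₀ * ∑ i, (C i : ℂ) * modeCLM ζ (x t) i)) := fun ζ => by ring
    simp only [hout, h2, norm_exp_mul_sq, tsum_mul_left]
    rw [mul_left_comm]
    gcongr

end Homogeneity

theorem mainTheorem5 {n : ℕ} (D A : Matrix (Fin n) (Fin n) ℝ) (hD : D.PosDef)
    (B C : Fin n → ℝ) (φ : ℝ → ℝ) (hφ : ContDiff ℝ 1 φ) (K₁ K₂ : ℝ)
    (hsector : ∀ η : ℝ, (deriv φ η - K₁) * (deriv φ η - K₂) ≤ 0)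
    (μ : ℝ) (hμ : 0 ≤ μ)
    (hmodes : ∀ ζ : ℤ, ζ ≠ 0 → NoHiddenModes D A B C μ ζ)
    (hpoles : ∀ ζ : ℤ, ζ ≠ 0 → ∀ s : ℂ, 0 ≤ s.re →
      ¬ IsPole (fun z => transferFunction D A B C ζ (z - μ)) s)
    (hnyquist : ∀ ζ : ℤ, ζ ≠ 0 →
      (0 < K₁ ∧ K₁ < K₂ ∧ OutsideWithoutEncirclement
        (fun z => transferFunction D A B C ζ (z - μ)) (criterionDisk K₁ K₂)) ∨
      (K₁ < 0 ∧ 0 < K₂ ∧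
        nyquistPlot (fun z => transferFunction D A B C ζ (z - μ)) ⊆ criterionDisk K₁ K₂) ∨
      (K₁ < K₂ ∧ K₂ < 0 ∧ OutsideWithoutEncirclement
        (fun z => transferFunction D A B C ζ (z - μ)) (criterionDisk K₁ K₂))) :
    SpatiallyHomogeneous D A B C φ μ := by
  -- Each alternative orders the gains; the mode ζ = 1 is used to read this off.
  have hK : K₁ ≤ K₂ := by
    rcases hnyquist 1 one_ne_zero with ⟨_, h, _⟩ | ⟨h1, h2, _⟩ | ⟨h, _⟩ <;> linarith
  obtain ⟨M, hM, hMx⟩ := exists_tsum_norm_sq_difference_le hD hφ hK hsector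
    (A := A) (B := B) (C := C) (μ := μ) fun ζ hζ => by
      rcases hnyquist ζ hζ with ⟨h1, h2, h3⟩ | ⟨h1, h2, h3⟩ | ⟨h1, h2, h3⟩
      · exact exists_isDissipativeUpToDecay_of_outside (mul_pos h1 (h1.trans h2)) h2
          (hmodes ζ hζ) (hpoles ζ hζ) h3
      · exact exists_isDissipativeUpToDecay_of_inside h1 h2 (hmodes ζ hζ) (hpoles ζ hζ) h3
      · exact exists_isDissipativeUpToDecay_of_outside (mul_pos_of_neg_of_neg (h1.trans h2) h2) h1
          (hmodes ζ hζ) (hpoles ζ hζ) h3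
  -- The estimate for the differences is quadratic, hence the square root.
  refine ⟨√M, Real.sqrt_pos.2 hM, fun x hx g₀ hg₀ t ht => ?_⟩
  have he : Real.exp (2 * μ * t) * Real.exp (-μ * t) ^ 2 = 1 := by
    rw [← Real.exp_nat_mul, ← Real.exp_add, Real.exp_eq_one_iff]
    push_cast
    ring
  obtain ⟨g, hg, hgn⟩ := exists_hasWeakDeriv_of_differences (x := x t) hg₀
    (M := M * Real.exp (-μ * t) ^ 2) (by positivity) fun h => by
      have h1 := mul_le_mul_of_nonneg_right (hMx x hx h t ht) (sq_nonneg (Real.exp (-μ * t)))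
      rw [mul_right_comm, he, one_mul, mul_right_comm] at h1
      exact h1
  refine ⟨g, hg, (pow_le_pow_iff_left₀ (norm_nonneg _) (by positivity) two_ne_zero).1 ?_⟩
  rwa [mul_pow, mul_pow, Real.sq_sqrt hM.le]
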